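/- **Setting.** Let $U:[0,1]\times\mathbb R^d\to\mathbb R$, $(t,x)\mapsto U_t(x)$, be continuously differentiable, with $Z_t=\int_{\mathbb R^d}e^{-U_t(x)}dx<\infty$ for all $t\in[0,1]$ and with $|\partial_tU_t(x)|e^{-U_t(x)}\le g(x)$ for some integrable $g$ (so that $Z_t$ may be differentiated under the integral sign). Put $\rho_t=Z_t^{-1}e^{-U_t}$ and fix $T\in(0,1]$. For $\hat\phi:[0,T]\times\mathbb R^d\to\mathbb R$ consider the action-matching functional $$L^T_{AM}[\hat\phi]=\int_0^T\!\!\int_{\mathbb R^d}\big[\tfrac12|\nabla\hat\phi_t(x)|^2+\partial_t\hat\phi_t(x)\big]\rho_t(x)\,dx\,dt+\int_{\mathbb R^d}\big[\hat\phi_0(x)\rho_0(x)-\hat\phi_T(x)\rho_T(x)\big]dx .$$ Let $\mathcal A$ be the set of $\hat\phi$ that are $C^1$ in $(t,x)$ and $C^2$ in $x$, and for which $|\nabla\hat\phi_t|^2\rho_t$ and $\partial_t\hat\phi_t\,\rho_t$ are integrable on $[0,T]\times\mathbb R^d$ and $\hat\phi_0\rho_0$, $\hat\phi_T\rho_T$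 are integrable on $\mathbb R^d$. 1. (Equation.) $\phi\in\mathcal A$ minimizes $L^T_{AM}$ over $\mathcal A$ if and only if $b_t=\nabla\phi_t$ satisfies $\nabla\cdot(b_t\rho_t)=-\partial_t\rho_t$ on $\mathbb R^d$ for all $t\in[0,T]$. 2. (Uniqueness.) If $\phi$ minimizes $L^T_{AM}$ over $\mathcal A$, then $\psi\in\mathcal A$ is a minimizer if and only if $\psi_t(x)=\phi_t(x)+c(t)$ on $[0,T]\times\mathbb R^d$ for some function $c$ of $t$ alone. 3. (Existence.) Suppose moreover that the densities $\rho_t$, $t\in[0,T]$, satisfy a Poincaré inequality with a common constant, i.e. $\int(\eta-\int\eta\rho_t)^2\rho_t\le C\int|\nabla\eta|^2\rho_t$ for all $\eta\in C_c^\infty(\mathbb R^d)$, and that $|\partial_tU_t|^2\rho_t$ is integrable on $\mathbb R^d$ for every $t\in[0,T]$ and on $[0,T]\times\mathbb R^d$. Let $\mathcal H$ be the space of measurable $\phi$ on $[0,T]\times\mathbb R^d$ such that, for a.e. $t$, $\phi_t$ has a weak gradient $\nabla\phi_t$, and $|\phi_t|^2\rho_t$ and $|\nabla\phi_t|^2\rho_t$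 are integrable on $[0,T]\times\mathbb R^d$; on $\mathcal H$ let $\bar L[\phi]=\int_0^T\int_{\mathbb R^d}\big[\tfrac12|\nabla\phi_t|^2\rho_t-\phi_t\,\partial_t\rho_t\big]dx\,dt$ ($L^T_{AM}$ integrated by parts in time). Then every $\phi\in\mathcal A$ for which $|\phi_t|^2\rho_t$ is integrable on $[0,T]\times\mathbb R^d$ lies in $\mathcal H$, with $\bar L[\phi]=L^T_{AM}[\phi]$. There is a minimizer $\phi$ of $\bar L$ over $\mathcal H$ such that, for all $t\in[0,T]$, $\phi_t$ has a weak gradient $b_t=\nabla\phi_t$ that satisfies $\nabla\cdot(b_t\rho_t)=-\partial_t\rho_t$ in the sense of distributions; moreover $\bar L[\phi]=\inf_{\mathcal A}L^T_{AM}$, and $\psi\in\mathcal H$ is a minimizer if and only if for a.e. $t\in[0,T]$ there is a constant $c$ with $\psi_t=\phi_t+c$ a.e. -/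

import Mathlib

open Set MeasureTheory

noncomputable section

namespace ActionMatching

/-- `d`-dimensional Euclidean space. -/
abbrev E (d : ℕ) : Type := EuclideanSpace ℝ (Fin d)

/-- The partition function `Z_t = ∫ exp (-U_t)`. -/
def partitionFn {d : ℕ} (U : ℝ → E d → ℝ) (t : ℝ) : ℝ :=
  ∫ x, Real.exp (-U t x)

/-- The density `ρ_t = Z_t⁻¹ exp (-U_t)`. -/
def rho {d : ℕ} (U : ℝ → E d → ℝ) (t : ℝ) (x : E d) : ℝ :=
  (partitionFn U t)⁻¹ * Real.exp (-U t x)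

/-- The partial derivative in time of a function on `[0, T] × ℝᵈ` (one-sided at the end points). -/
def timeDeriv {d : ℕ} (T : ℝ) (f : ℝ → E d → ℝ) (t : ℝ) (x : E d) : ℝ :=
  derivWithin (fun s => f s x) (Icc 0 T) t

/-- The divergence of a vector field on `ℝᵈ`. -/
def divergence {d : ℕ} (v : E d → E d) (x : E d) : ℝ :=
  ∑ i, (fderiv ℝ v x (EuclideanSpace.single i 1)) i

/-- A path of potentials `(U_t)`, `t ∈ [0, 1]`: it is continuously differentiable on `[0, 1] × ℝᵈ`
(as every twice differentiable function is), `Z_t` is finite, and `Z_t` may be differentiated under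
the integral sign, `∂_t exp (-U_t)` being dominated by an integrable function of `x`. -/
structure IsPotentialPath {d : ℕ} (U : ℝ → E d → ℝ) : Prop where
  contDiffOn : ContDiffOn ℝ 1 (fun p : ℝ × E d => U p.1 p.2) (Icc 0 1 ×ˢ univ)
  integrable : ∀ t ∈ Icc (0 : ℝ) 1, Integrable (fun x => Real.exp (-U t x))
  dominated : ∃ g : E d → ℝ, Integrable g ∧
    ∀ t ∈ Icc (0 : ℝ) 1, ∀ x, |timeDeriv 1 U t x| * Real.exp (-U t x) ≤ g x

/-! ### The functional on classical potentials -/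

/-- The classical potentials `φ` on `[0, T] × ℝᵈ`: `C¹` in `(t, x)`, `C²` in `x`, and such that
every integral in the action-matching functional converges absolutely. -/
structure Admissible {d : ℕ} (U : ℝ → E d → ℝ) (T : ℝ) (φ : ℝ → E d → ℝ) : Prop where
  contDiffOn : ContDiffOn ℝ 1 (fun p : ℝ × E d => φ p.1 p.2) (Icc 0 T ×ˢ univ)
  contDiff : ∀ t ∈ Icc 0 T, ContDiff ℝ 2 (φ t)
  gradient_sq : IntegrableOn
    (fun p : ℝ × E d => ‖gradient (φ p.1) p.2‖ ^ 2 * rho U p.1 p.2) (Icc 0 T ×ˢ univ)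
  timeDeriv : IntegrableOn
    (fun p : ℝ × E d => timeDeriv T φ p.1 p.2 * rho U p.1 p.2) (Icc 0 T ×ˢ univ)
  initial : Integrable (fun x => φ 0 x * rho U 0 x)
  final : Integrable (fun x => φ T x * rho U T x)

/-- The action-matching functional
`∫₀ᵀ ∫ (½ |∇φ_t|² + ∂_t φ_t) ρ_t dx dt + ∫ (φ_0 ρ_0 - φ_T ρ_T) dx`. -/
def actionLoss {d : ℕ} (U : ℝ → E d → ℝ) (T : ℝ) (φ : ℝ → E d → ℝ) : ℝ :=
  (∫ t in (0 : ℝ)..T, ∫ x,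
      (1 / 2 * ‖gradient (φ t) x‖ ^ 2 + timeDeriv T φ t x) * rho U t x)
    + ∫ x, (φ 0 x * rho U 0 x - φ T x * rho U T x)

/-- `φ` minimizes the action-matching functional among the classical potentials. -/
def IsMinimizer {d : ℕ} (U : ℝ → E d → ℝ) (T : ℝ) (φ : ℝ → E d → ℝ) : Prop :=
  Admissible U T φ ∧ ∀ ψ, Admissible U T ψ → actionLoss U T φ ≤ actionLoss U T ψ

/-- The equation `∇ · (b_t ρ_t) = -∂_t ρ_t` at time `t`, at every point. -/
def SolvesTransport {d : ℕ} (U : ℝ → E d → ℝ) (t : ℝ) (b : E d → E d) : Prop :=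
  ∀ x, divergence (fun y => rho U t y • b y) x = -timeDeriv 1 (rho U) t x

/-! ### The functional on potentials of finite energy -/

/-- Test functions: `C^∞` with compact support. -/
def IsTest {d : ℕ} (η : E d → ℝ) : Prop :=
  ContDiff ℝ (⊤ : ℕ∞) η ∧ HasCompactSupport η

/-- `g` is the weak gradient of `f`. -/
def HasWeakGradient {d : ℕ} (f : E d → ℝ) (g : E d → E d) : Prop :=
  LocallyIntegrable f ∧ LocallyIntegrable g ∧
    ∀ η, IsTest η → ∫ x, f x • gradient η x = -∫ x, η x • g x

/-- The equation `∇ · (b_t ρ_t) = -∂_t ρ_t` at time `t`, in the weak sense. -/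
def SolvesTransportWeakly {d : ℕ} (U : ℝ → E d → ℝ) (t : ℝ) (b : E d → E d) : Prop :=
  ∀ η, IsTest η →
    ∫ x, inner ℝ (b x) (gradient η x) * rho U t x = ∫ x, η x * timeDeriv 1 (rho U) t x

/-- The energy space `L²(0, T; H¹(ρ_t))`: `φ` is square integrable for `ρ_t dx dt`, and so is its
weak spatial gradient `G`. -/
structure FiniteEnergy {d : ℕ} (U : ℝ → E d → ℝ) (T : ℝ)
    (φ : ℝ → E d → ℝ) (G : ℝ → E d → E d) : Prop where
  aesm : AEStronglyMeasurable (fun p : ℝ × E d => φ p.1 p.2)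
    (volume.restrict (Icc 0 T ×ˢ univ))
  aesm_gradient : AEStronglyMeasurable (fun p : ℝ × E d => G p.1 p.2)
    (volume.restrict (Icc 0 T ×ˢ univ))
  sq : IntegrableOn (fun p : ℝ × E d => φ p.1 p.2 ^ 2 * rho U p.1 p.2) (Icc 0 T ×ˢ univ)
  gradient_sq : IntegrableOn
    (fun p : ℝ × E d => ‖G p.1 p.2‖ ^ 2 * rho U p.1 p.2) (Icc 0 T ×ˢ univ)
  weakGradient : ∀ᵐ t ∂volume.restrict (Icc 0 T), HasWeakGradient (φ t) (G t)

/-- The action-matching functional after integration by parts in time,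
`∫₀ᵀ ∫ (½ |∇φ_t|² ρ_t - φ_t ∂_t ρ_t) dx dt`, for a potential `φ` with weak gradient `G`. -/
def energyLoss {d : ℕ} (U : ℝ → E d → ℝ) (T : ℝ)
    (φ : ℝ → E d → ℝ) (G : ℝ → E d → E d) : ℝ :=
  ∫ t in (0 : ℝ)..T, ∫ x,
    (1 / 2 * ‖G t x‖ ^ 2 * rho U t x - φ t x * timeDeriv 1 (rho U) t x)

/-- `φ`, with weak gradient `G`, minimizes the functional in the energy space. -/
def IsEnergyMinimizer {d : ℕ} (U : ℝ → E d → ℝ) (T : ℝ)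
    (φ : ℝ → E d → ℝ) (G : ℝ → E d → E d) : Prop :=
  FiniteEnergy U T φ G ∧
    ∀ ψ H, FiniteEnergy U T ψ H → energyLoss U T φ G ≤ energyLoss U T ψ H

/-- The spectral gap (Poincaré) inequality for `ρ_t`, uniformly in `t ∈ [0, T]`. -/
def SpectralGap {d : ℕ} (U : ℝ → E d → ℝ) (T : ℝ) : Prop :=
  ∃ C : ℝ, ∀ t ∈ Icc 0 T, ∀ η : E d → ℝ, IsTest η →
    ∫ x, (η x - ∫ y, η y * rho U t y) ^ 2 * rho U t x
      ≤ C * ∫ x, ‖gradient η x‖ ^ 2 * rho U t x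

/-- `∂_t U_t` is square integrable for `ρ_t dx` at every `t ∈ [0, T]` and for `ρ_t dx dt`. -/
def SquareIntegrableRate {d : ℕ} (U : ℝ → E d → ℝ) (T : ℝ) : Prop :=
  (∀ t ∈ Icc 0 T, Integrable (fun x => timeDeriv 1 U t x ^ 2 * rho U t x)) ∧
    IntegrableOn (fun p : ℝ × E d => timeDeriv 1 U p.1 p.2 ^ 2 * rho U p.1 p.2)
      (Icc 0 T ×ˢ univ)

end ActionMatching

end

noncomputable section

namespace ActionMatching

open Filter Topology
open scoped Convolution ENNReal

/-! ### Calculus on `ℝᵈ` -/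

section Spatial

variable {d : ℕ}

/-! Up to an additive constant, the action-matching functional is a squared distance. Let `b` be a
field with `|b|² ρ` integrable that solves the transport equation. Testing the equation against a
potential `ξ` gives `∫∫ (b·∇ξ + ∂_t ξ) ρ = ∫ (ξ_T ρ_T - ξ_0 ρ_0)`, and the functional at `ξ` becomes
`½ ∫∫ |∇ξ - b|² ρ - ½ ∫∫ |b|² ρ` (`IsWeakVelocity.actionLoss_eq`). Admissible potentials need not
decay, and `ξ ∂_t ρ` need not be integrable, so the test is first made with `χ · τ(ξ)`, where `τ`
truncates at height of order `n` and the cutoff `χ` has gradient of order `n⁻²`. The error is then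
of order `1/n` times the integral of `|b| ρ`, which is finite because each `ρ_t` has mass one
(`IsWeakVelocity.integral_of_admissible`).

For classical potentials, completing the square with `b = ∇φ` shows that solutions of the equation
are minimizers. Conversely, the functional is quadratic along `φ + ε η`, so its linear coefficient
vanishes at a minimizer. Taking `η = c(t) h(x)` localizes this in time and then in space;
continuity, with `φ_t` of class `C²`, gives the equation at every point
(`IsMinimizer.solvesTransport`). Two minimizers have the same gradient almost everywhere, hence
everywhere by continuity.

Existence is a Riesz representation. Since `∂_t ρ_t` has integral zero, the form `η ↦ ∫∫ η ∂_t ρ`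
sees only `η` minus its mean at each time, and the Poincaré inequality bounds it by the weighted
norm of `∇η`. The representing field lies in the closure of gradients of test functions; by the same
inequality the centred test functions converge too, and their limit is a potential for the field
(`exists_seq_inner_eq`, `exists_global_weak_solution`). A countable `C¹`-dense set of test functions
yields the equation for almost every time; at the remaining times the Riesz argument is repeated
with `t` fixed.

Test functions are dense in the weighted Sobolev space (`exists_isTest_approx`), so the equation may
be tested against every competitor of finite energy and the square is completed again
(`FiniteEnergy.energyLoss_eq`). The same field completes the square for classical potentials and is
a limit of gradients of admissible ones, so both infima agree. Uniqueness up to constants in space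
is the Poincaré inequality applied to a difference with zero gradient. -/

theorem gradient_eq_comp_fderiv (f : E d → ℝ) :
    gradient f = fun x => (InnerProductSpace.toDual ℝ (E d)).symm (fderiv ℝ f x) := rfl

theorem norm_gradient (f : E d → ℝ) (x : E d) : ‖gradient f x‖ = ‖fderiv ℝ f x‖ := by
  rw [gradient_eq_comp_fderiv]; simp

theorem continuous_gradient {f : E d → ℝ} (hf : ContDiff ℝ 1 f) : Continuous (gradient f) :=
  (InnerProductSpace.toDual ℝ (E d)).symm.continuous.comp (hf.continuous_fderiv one_ne_zero)

theorem contDiff_gradient {f : E d → ℝ} (hf : ContDiff ℝ 2 f) : ContDiff ℝ 1 (gradient f) :=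
  (InnerProductSpace.toDual ℝ (E d)).symm.contDiff.comp
    (hf.fderiv_right (m := 1) (by norm_num [one_add_one_eq_two]))

theorem hasCompactSupport_gradient {f : E d → ℝ} (hf : HasCompactSupport f) :
    HasCompactSupport (gradient f) :=
  (hf.fderiv ℝ).comp_left (g := (InnerProductSpace.toDual ℝ (E d)).symm) (map_zero _)

theorem gradient_mul {f g : E d → ℝ} {x : E d} (hf : DifferentiableAt ℝ f x)
    (hg : DifferentiableAt ℝ g x) :
    gradient (fun y => f y * g y) x = f x • gradient g x + g x • gradient f x := by
  simp only [gradient_eq_comp_fderiv]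
  rw [fderiv_fun_mul hf hg]; simp

theorem gradient_add {f g : E d → ℝ} {x : E d} (hf : DifferentiableAt ℝ f x)
    (hg : DifferentiableAt ℝ g x) :
    gradient (fun y => f y + g y) x = gradient f x + gradient g x := by
  simp only [gradient_eq_comp_fderiv]
  rw [fderiv_fun_add hf hg]; simp

theorem gradient_sub {f g : E d → ℝ} {x : E d} (hf : DifferentiableAt ℝ f x)
    (hg : DifferentiableAt ℝ g x) :
    gradient (fun y => f y - g y) x = gradient f x - gradient g x := by
  simp only [gradient_eq_comp_fderiv]
  rw [fderiv_fun_sub hf hg]; simp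

theorem gradient_const_mul {f : E d → ℝ} {x : E d} (c : ℝ) (hf : DifferentiableAt ℝ f x) :
    gradient (fun y => c * f y) x = c • gradient f x := by
  simp only [gradient_eq_comp_fderiv]
  rw [fderiv_const_mul hf]; simp

theorem gradient_add_const (f : E d → ℝ) (c : ℝ) :
    gradient (fun y => f y + c) = gradient f := by
  simp only [gradient_eq_comp_fderiv, fderiv_add_const]

theorem gradient_comp {F : ℝ → ℝ} {f : E d → ℝ} {x : E d} {F' : ℝ}
    (hF : HasDerivAt F F' (f x)) (hf : DifferentiableAt ℝ f x) :
    gradient (fun y => F (f y)) x = F' • gradient f x := by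
  simp only [gradient_eq_comp_fderiv]
  have h : HasFDerivAt (fun y => F (f y)) (F' • fderiv ℝ f x) x :=
    hF.comp_hasFDerivAt x hf.hasFDerivAt
  rw [h.fderiv]; simp

theorem gradient_const_sub {f : E d → ℝ} (hf : ContDiff ℝ 1 f) (z x : E d) :
    gradient (fun y => f (z - y)) x = - gradient f (z - x) := by
  simp only [gradient_eq_comp_fderiv]
  have h : HasFDerivAt (fun y => f (z - y)) ((fderiv ℝ f (z - x)).comp (-.id ℝ (E d))) x :=
    ((hf.differentiable one_ne_zero) (z - x)).hasFDerivAt.comp x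
      ((hasFDerivAt_id x).const_sub z)
  rw [h.fderiv]; simp

theorem IsTest.contDiff {η : E d → ℝ} (h : IsTest η) {n : ℕ∞} : ContDiff ℝ n η :=
  h.1.of_le (by exact_mod_cast le_top)

theorem IsTest.contDiff_one {η : E d → ℝ} (h : IsTest η) : ContDiff ℝ 1 η :=
  h.contDiff (n := 1)

/-- Integration by parts for scalar functions, one of which has compact support. -/
theorem integral_smul_gradient {f h : E d → ℝ} (hf : ContDiff ℝ 1 f) (hh : ContDiff ℝ 1 h)
    (hc : HasCompactSupport h) :
    ∫ x, f x • gradient h x = -∫ x, h x • gradient f x := by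
  have hdf := hf.differentiable one_ne_zero
  have hdh := hh.differentiable one_ne_zero
  have i1 : Integrable (fun x => f x • gradient h x) :=
    (hf.continuous.smul (continuous_gradient hh)).integrable_of_hasCompactSupport
      (hasCompactSupport_gradient hc).smul_left
  have i2 : Integrable (fun x => h x • gradient f x) :=
    (hh.continuous.smul (continuous_gradient hf)).integrable_of_hasCompactSupport
      hc.smul_right
  refine ext_inner_left ℝ fun v => ?_
  rw [inner_neg_right, ← integral_inner i1 v, ← integral_inner i2 v]
  simp only [inner_smul_right, inner_gradient_right, conj_trivial]
  have i1' : Integrable (fun x => f x * fderiv ℝ h x v) := by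
    simpa [inner_smul_right, inner_gradient_right] using i1.const_inner (𝕜 := ℝ) v
  have i2' : Integrable (fun x => fderiv ℝ f x v * h x) := by
    simpa [inner_smul_right, inner_gradient_right, mul_comm] using i2.const_inner (𝕜 := ℝ) v
  rw [integral_mul_fderiv_eq_neg_fderiv_mul_of_integrable i2' i1'
    ((hf.continuous.mul hh.continuous).integrable_of_hasCompactSupport hc.mul_left)
    (fun x _ => hdf x) (fun x _ => hdh x)]
  simp only [mul_comm]

theorem continuous_divergence {F : E d → E d} (hF : ContDiff ℝ 1 F) :
    Continuous (divergence F) := by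
  unfold divergence
  refine continuous_finsetSum _ fun i _ => ?_
  exact (EuclideanSpace.proj i : E d →L[ℝ] ℝ).continuous.comp
    ((hF.continuous_fderiv one_ne_zero).clm_apply continuous_const)

/-- Integration by parts for the divergence of a vector field. -/
theorem integral_inner_gradient {F : E d → E d} {h : E d → ℝ} (hF : ContDiff ℝ 1 F)
    (hh : ContDiff ℝ 1 h) (hc : HasCompactSupport h) :
    ∫ x, inner ℝ (F x) (gradient h x) = -∫ x, h x * divergence F x := by
  have hdh := hh.differentiable one_ne_zero
  have key : ∀ x, inner ℝ (F x) (gradient h x)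
      = ∑ i, F x i * fderiv ℝ h x (EuclideanSpace.single i 1) := by
    intro x
    rw [PiLp.inner_apply]
    refine Finset.sum_congr rfl fun i _ => ?_
    have : gradient h x i = fderiv ℝ h x (EuclideanSpace.single i 1) := by
      rw [← inner_gradient_left, PiLp.inner_apply]
      simp
    rw [this]; simp [mul_comm]
  have hFi : ∀ i, ContDiff ℝ 1 (fun x => F x i) := fun i =>
    (EuclideanSpace.proj i : E d →L[ℝ] ℝ).contDiff.comp hF
  have hfd : ∀ i x, fderiv ℝ (fun x => F x i) x (EuclideanSpace.single i 1)
      = (fderiv ℝ F x (EuclideanSpace.single i 1)) i := by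
    intro i x
    have h1 := ((EuclideanSpace.proj i : E d →L[ℝ] ℝ).hasFDerivAt.comp x
      ((hF.differentiable one_ne_zero) x).hasFDerivAt).fderiv
    have h2 : fderiv ℝ (fun x => F x i) x = _ := h1
    rw [h2]; rfl
  have c1 : ∀ i, Continuous fun x => fderiv ℝ h x (EuclideanSpace.single i 1) := fun i =>
    (hh.continuous_fderiv one_ne_zero).clm_apply continuous_const
  have s1 : ∀ i, HasCompactSupport fun x => fderiv ℝ h x (EuclideanSpace.single i 1) := fun i =>
    hc.fderiv_apply (𝕜 := ℝ) _
  have c2 : ∀ i, Continuous fun x => fderiv ℝ (fun x => F x i) x (EuclideanSpace.single i 1) :=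
    fun i => ((hFi i).continuous_fderiv one_ne_zero).clm_apply continuous_const
  have i1 : ∀ i, Integrable (fun x => F x i * fderiv ℝ h x (EuclideanSpace.single i 1)) :=
    fun i => ((hFi i).continuous.mul (c1 i)).integrable_of_hasCompactSupport (s1 i).mul_left
  have i2 : ∀ i, Integrable
      (fun x => fderiv ℝ (fun x => F x i) x (EuclideanSpace.single i 1) * h x) :=
    fun i => ((c2 i).mul hh.continuous).integrable_of_hasCompactSupport hc.mul_left
  simp_rw [key]
  rw [integral_finsetSum _ fun i _ => i1 i]
  unfold divergence
  simp_rw [Finset.mul_sum]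
  rw [integral_finsetSum, ← Finset.sum_neg_distrib]
  · refine Finset.sum_congr rfl fun i _ => ?_
    rw [integral_mul_fderiv_eq_neg_fderiv_mul_of_integrable (i2 i) (i1 i)
      (((hFi i).continuous.mul hh.continuous).integrable_of_hasCompactSupport hc.mul_left)
      (fun x _ => ((hFi i).differentiable one_ne_zero) x) (fun x _ => hdh x)]
    simp_rw [hfd, mul_comm]
  · intro i _
    have := i2 i
    simp_rw [hfd] at this
    simpa only [mul_comm] using this

/-- A continuously differentiable function with zero gradient is constant. -/
theorem eq_of_gradient_eq_zero {f : E d → ℝ} (hf : ContDiff ℝ 1 f)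
    (h : ∀ x, gradient f x = 0) (x y : E d) : f x = f y := by
  refine is_const_of_fderiv_eq_zero (𝕜 := ℝ) (hf.differentiable one_ne_zero) (fun z => ?_) x y
  rw [← norm_eq_zero, ← norm_gradient, h, norm_zero]

/-- Smooth cutoff functions equal to `1` on large balls, with small gradient. -/
theorem exists_cutoff (d : ℕ) : ∃ (K : ℝ) (χ : ℕ → E d → ℝ), 0 ≤ K ∧ (∀ n, IsTest (χ n)) ∧
    (∀ n x, 0 ≤ χ n x ∧ χ n x ≤ 1) ∧ (∀ (n : ℕ) x, ‖x‖ ≤ n + 1 → χ n x = 1) ∧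
    (∀ (n : ℕ) x, ‖gradient (χ n) x‖ ≤ K / (n + 1)) := by
  let f : ContDiffBump (0 : E d) := ⟨1, 2, one_pos, one_lt_two⟩
  have hf : IsTest (f : E d → ℝ) := ⟨f.contDiff, f.hasCompactSupport⟩
  obtain ⟨K, hK⟩ := (hasCompactSupport_gradient hf.2).exists_bound_of_continuous
    (continuous_gradient hf.contDiff_one)
  have hK0 : 0 ≤ K := (norm_nonneg _).trans (hK 0)
  have hn : ∀ n : ℕ, (0 : ℝ) < n + 1 := fun n => by positivity
  -- The `n`-th cutoff is a dilation by `n + 1` of one fixed bump equal to `1` on the unit ball; the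
  -- dilation divides the gradient bound `K` by `n + 1`.
  have ht : ∀ n : ℕ, IsTest fun x : E d => f ((n + 1 : ℝ)⁻¹ • x) := fun n =>
    ⟨f.contDiff.comp (contDiff_const_smul _), f.hasCompactSupport.comp_smul (by positivity)⟩
  refine ⟨K, fun n x => f ((n + 1 : ℝ)⁻¹ • x), hK0, ht, fun n x => ⟨f.nonneg, f.le_one⟩, ?_, ?_⟩
  · intro n x hx
    apply f.one_of_mem_closedBall
    rw [mem_closedBall_zero_iff, norm_smul, norm_inv, Real.norm_of_nonneg (hn n).le,
      inv_mul_le_iff₀ (hn n)]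
    change ‖x‖ ≤ (n + 1) * 1
    linarith
  · intro n x
    rw [norm_gradient]
    have := fderiv_comp_smul (𝕜 := ℝ) (f := (f : E d → ℝ)) (x := x) ((n + 1 : ℝ)⁻¹)
    rw [this, norm_smul, ← norm_gradient, norm_inv, Real.norm_of_nonneg (hn n).le,
      div_eq_inv_mul]
    gcongr
    exact hK _

end Spatial

/-! ### Functions on the slab `[0, T] × ℝᵈ` -/

section Slab

variable {d : ℕ} {T : ℝ}

/-- The slab `[0, T] × ℝᵈ`. -/
abbrev slab (d : ℕ) (T : ℝ) : Set (ℝ × E d) := Icc 0 T ×ˢ univ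

theorem measurableSet_slab : MeasurableSet (slab d T) :=
  measurableSet_Icc.prod MeasurableSet.univ

theorem mem_slab {t : ℝ} (ht : t ∈ Icc 0 T) (x : E d) : (t, x) ∈ slab d T := ⟨ht, mem_univ _⟩

theorem uniqueDiffOn_slab (hT : 0 < T) : UniqueDiffOn ℝ (slab d T) :=
  (uniqueDiffOn_Icc hT).prod uniqueDiffOn_univ

theorem volume_restrict_slab : (volume : Measure (ℝ × E d)).restrict (slab d T)
    = (volume.restrict (Icc 0 T)).prod volume := by
  rw [Measure.volume_eq_prod, ← Measure.prod_restrict, Measure.restrict_univ]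

theorem ae_ae_of_ae_slab {P : ℝ × E d → Prop} (h : ∀ᵐ p ∂volume.restrict (slab d T), P p) :
    ∀ᵐ t ∂volume.restrict (Icc 0 T), ∀ᵐ x, P (t, x) := by
  rw [volume_restrict_slab] at h
  exact Measure.ae_ae_of_ae_prod h

theorem ae_integrable_slice {F : Type*} [NormedAddCommGroup F] {f : ℝ × E d → F}
    (hf : IntegrableOn f (slab d T)) :
    ∀ᵐ t ∂volume.restrict (Icc 0 T), Integrable fun x => f (t, x) := by
  rw [IntegrableOn, volume_restrict_slab] at hf
  exact hf.prod_right_ae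

theorem setIntegral_slab {F : Type*} [NormedAddCommGroup F] [NormedSpace ℝ F] (hT : 0 ≤ T)
    {f : ℝ × E d → F} (hf : IntegrableOn f (slab d T)) :
    ∫ p in slab d T, f p = ∫ t in (0 : ℝ)..T, ∫ x, f (t, x) := by
  rw [IntegrableOn, volume_restrict_slab] at hf
  rw [volume_restrict_slab, integral_prod _ hf, intervalIntegral.integral_of_le hT,
    integral_Icc_eq_integral_Ioc]

theorem setIntegral_slab_symm {F : Type*} [NormedAddCommGroup F] [NormedSpace ℝ F] (hT : 0 ≤ T)
    {f : ℝ × E d → F} (hf : IntegrableOn f (slab d T)) :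
    ∫ p in slab d T, f p = ∫ x, ∫ t in (0 : ℝ)..T, f (t, x) := by
  rw [IntegrableOn, volume_restrict_slab] at hf
  rw [volume_restrict_slab, integral_prod_symm _ hf]
  simp_rw [intervalIntegral.integral_of_le hT, integral_Icc_eq_integral_Ioc]

theorem integrableOn_integral_slice {F : Type*} [NormedAddCommGroup F] [NormedSpace ℝ F]
    {f : ℝ × E d → F} (hf : IntegrableOn f (slab d T)) :
    IntegrableOn (fun t => ∫ x, f (t, x)) (Icc 0 T) := by
  rw [IntegrableOn, volume_restrict_slab] at hf
  exact hf.integral_prod_left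

/-- The integrand is continuous on the compact set `[0, T] × closedBall 0 R` and vanishes on the
rest of the slab. No regularity outside the slab enters, so one-sided time derivatives are covered.
-/
theorem integrableOn_slab_of_continuousOn {F : Type*} [NormedAddCommGroup F] {f : ℝ × E d → F}
    (hf : ContinuousOn f (slab d T)) (R : ℝ) (h : ∀ t ∈ Icc 0 T, ∀ x, R < ‖x‖ → f (t, x) = 0) :
    IntegrableOn f (slab d T) := by
  have hK : IsCompact (Icc 0 T ×ˢ Metric.closedBall (0 : E d) R) :=
    isCompact_Icc.prod (isCompact_closedBall _ _)
  refine ((hf.mono (prod_mono_right (subset_univ _))).integrableOn_compact hK)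
    |>.of_forall_sdiff_eq_zero measurableSet_slab ?_
  rintro ⟨t, x⟩ ⟨⟨ht, -⟩, hx⟩
  refine h t ht x ?_
  by_contra hR
  exact hx ⟨ht, by simpa using not_lt.1 hR⟩

theorem aestronglyMeasurable_slab {F : Type*} [NormedAddCommGroup F]
  [SecondCountableTopologyEither (ℝ × E d) F]
    {f : ℝ × E d → F} (hf : ContinuousOn f (slab d T)) :
    AEStronglyMeasurable f (volume.restrict (slab d T)) :=
  hf.aestronglyMeasurable measurableSet_slab

variable {θ : ℝ → E d → ℝ}

theorem continuousOn_slice (hθ : ContinuousOn (fun p : ℝ × E d => θ p.1 p.2) (slab d T))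
    {t : ℝ} (ht : t ∈ Icc 0 T) : Continuous (θ t) := by
  rw [← continuousOn_univ]
  exact hθ.comp (f := fun x : E d => (t, x)) (by fun_prop) (fun x _ => mem_slab ht x)

theorem contDiff_slice (hθ : ContDiffOn ℝ 1 (fun p : ℝ × E d => θ p.1 p.2) (slab d T))
    {t : ℝ} (ht : t ∈ Icc 0 T) : ContDiff ℝ 1 (θ t) := by
  rw [← contDiffOn_univ]
  exact hθ.comp (f := fun x : E d => (t, x)) (by fun_prop) (fun x _ => mem_slab ht x)

theorem contDiffOn_time_slice (hθ : ContDiffOn ℝ 1 (fun p : ℝ × E d => θ p.1 p.2) (slab d T))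
    (x : E d) : ContDiffOn ℝ 1 (fun s => θ s x) (Icc 0 T) :=
  hθ.comp (f := fun s : ℝ => (s, x)) (by fun_prop) (fun _ hs => mem_slab hs x)

theorem hasDerivWithinAt_time (hθ : ContDiffOn ℝ 1 (fun p : ℝ × E d => θ p.1 p.2) (slab d T))
    {t : ℝ} (ht : t ∈ Icc 0 T) (x : E d) :
    HasDerivWithinAt (fun s => θ s x) (timeDeriv T θ t x) (Icc 0 T) t :=
  ((contDiffOn_time_slice hθ x).differentiableOn one_ne_zero t ht).hasDerivWithinAt

theorem timeDeriv_eq (hT : 0 < T) {t : ℝ} (ht : t ∈ Icc 0 T) {x : E d} {a : ℝ}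
    (h : HasDerivWithinAt (fun s => θ s x) a (Icc 0 T) t) : timeDeriv T θ t x = a :=
  h.derivWithin (uniqueDiffOn_Icc hT t ht)

theorem timeDeriv_eq_fderivWithin (hT : 0 < T)
    (hθ : ContDiffOn ℝ 1 (fun p : ℝ × E d => θ p.1 p.2) (slab d T))
    {t : ℝ} (ht : t ∈ Icc 0 T) (x : E d) :
    timeDeriv T θ t x
      = fderivWithin ℝ (fun p : ℝ × E d => θ p.1 p.2) (slab d T) (t, x) (1, 0) := by
  refine timeDeriv_eq hT ht ?_
  have h1 := (hθ.differentiableOn one_ne_zero (t, x) (mem_slab ht x)).hasFDerivWithinAt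
  have h2 : HasDerivWithinAt (fun s : ℝ => (s, x)) (1, 0) (Icc 0 T) t :=
    (hasDerivWithinAt_id t _).prodMk (hasDerivWithinAt_const t _ x)
  exact h1.comp_hasDerivWithinAt t h2 (fun s hs => mem_slab hs x)

theorem fderiv_eq_fderivWithin (hθ : ContDiffOn ℝ 1 (fun p : ℝ × E d => θ p.1 p.2) (slab d T))
    {t : ℝ} (ht : t ∈ Icc 0 T) (x : E d) :
    fderiv ℝ (θ t) x = (fderivWithin ℝ (fun p : ℝ × E d => θ p.1 p.2) (slab d T) (t, x)).comp
      (ContinuousLinearMap.inr ℝ ℝ (E d)) := by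
  have h1 := (hθ.differentiableOn one_ne_zero (t, x) (mem_slab ht x)).hasFDerivWithinAt
  have h2 : HasFDerivWithinAt (fun y : E d => (t, y)) (ContinuousLinearMap.inr ℝ ℝ (E d)) univ x :=
    (hasFDerivAt_prodMk_right t x).hasFDerivWithinAt
  exact (hasFDerivWithinAt_univ.1
    (h1.comp (f := fun y : E d => (t, y)) x h2 (fun s _ => mem_slab ht s))).fderiv

theorem continuousOn_timeDeriv (hT : 0 < T)
    (hθ : ContDiffOn ℝ 1 (fun p : ℝ × E d => θ p.1 p.2) (slab d T)) :
    ContinuousOn (fun p : ℝ × E d => timeDeriv T θ p.1 p.2) (slab d T) := by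
  have h := hθ.continuousOn_fderivWithin (uniqueDiffOn_slab hT) le_rfl
  exact (h.clm_apply (continuousOn_const (c := ((1 : ℝ), (0 : E d))))).congr
    fun p hp => timeDeriv_eq_fderivWithin hT hθ hp.1 p.2

theorem continuousOn_gradient (hT : 0 < T)
    (hθ : ContDiffOn ℝ 1 (fun p : ℝ × E d => θ p.1 p.2) (slab d T)) :
    ContinuousOn (fun p : ℝ × E d => gradient (θ p.1) p.2) (slab d T) := by
  have h := hθ.continuousOn_fderivWithin (uniqueDiffOn_slab hT) le_rfl
  have h' := (InnerProductSpace.toDual ℝ (E d)).symm.continuous.comp_continuousOn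
    (h.clm_comp (continuousOn_const (c := ContinuousLinearMap.inr ℝ ℝ (E d))))
  refine h'.congr fun p hp => ?_
  rw [gradient_eq_comp_fderiv]
  exact congrArg _ (fderiv_eq_fderivWithin hθ hp.1 p.2)

/-- Reconciles the two time derivatives in use: potentials live on `[0, T]`, while `rho` is
differentiated relative to `[0, 1]`. Only the end point `T` makes this more than a formality. -/
theorem timeDeriv_restrict {S : ℝ} (hT : 0 < T) (hTS : T ≤ S)
    (hθ : ContDiffOn ℝ 1 (fun p : ℝ × E d => θ p.1 p.2) (slab d S))
    {t : ℝ} (ht : t ∈ Icc 0 T) (x : E d) : timeDeriv T θ t x = timeDeriv S θ t x :=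
  timeDeriv_eq hT ht
    ((hasDerivWithinAt_time hθ (Icc_subset_Icc_right hTS ht) x).mono (Icc_subset_Icc_right hTS))

theorem timeDeriv_mul (hT : 0 < T) {η : ℝ → E d → ℝ}
    (hθ : ContDiffOn ℝ 1 (fun p : ℝ × E d => θ p.1 p.2) (slab d T))
    (hη : ContDiffOn ℝ 1 (fun p : ℝ × E d => η p.1 p.2) (slab d T))
    {t : ℝ} (ht : t ∈ Icc 0 T) (x : E d) :
    timeDeriv T (fun s y => θ s y * η s y) t x
      = timeDeriv T θ t x * η t x + θ t x * timeDeriv T η t x :=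
  timeDeriv_eq hT ht ((hasDerivWithinAt_time hθ ht x).mul (hasDerivWithinAt_time hη ht x))

theorem timeDeriv_add (hT : 0 < T) {η : ℝ → E d → ℝ}
    (hθ : ContDiffOn ℝ 1 (fun p : ℝ × E d => θ p.1 p.2) (slab d T))
    (hη : ContDiffOn ℝ 1 (fun p : ℝ × E d => η p.1 p.2) (slab d T))
    {t : ℝ} (ht : t ∈ Icc 0 T) (x : E d) :
    timeDeriv T (fun s y => θ s y + η s y) t x = timeDeriv T θ t x + timeDeriv T η t x :=
  timeDeriv_eq hT ht ((hasDerivWithinAt_time hθ ht x).add (hasDerivWithinAt_time hη ht x))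

theorem timeDeriv_const_mul (hT : 0 < T) (c : ℝ)
    (hθ : ContDiffOn ℝ 1 (fun p : ℝ × E d => θ p.1 p.2) (slab d T))
    {t : ℝ} (ht : t ∈ Icc 0 T) (x : E d) :
    timeDeriv T (fun s y => c * θ s y) t x = c * timeDeriv T θ t x :=
  timeDeriv_eq hT ht ((hasDerivWithinAt_time hθ ht x).const_mul c)

theorem intervalIntegral_timeDeriv (hT : 0 < T)
    (hθ : ContDiffOn ℝ 1 (fun p : ℝ × E d => θ p.1 p.2) (slab d T)) (x : E d) :
    ∫ t in (0 : ℝ)..T, timeDeriv T θ t x = θ T x - θ 0 x := by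
  have hc : ContinuousOn (fun t => timeDeriv T θ t x) (Icc 0 T) :=
    (continuousOn_timeDeriv hT hθ).comp (f := fun s : ℝ => (s, x)) (by fun_prop)
      (fun _ hs => mem_slab hs x)
  refine intervalIntegral.integral_eq_sub_of_hasDeriv_right_of_le hT.le
    (contDiffOn_time_slice hθ x).continuousOn (fun t ht => ?_) ?_
  · exact ((hasDerivWithinAt_time hθ (Ioo_subset_Icc_self ht) x).hasDerivAt
      (Icc_mem_nhds ht.1 ht.2)).hasDerivWithinAt
  · exact (hc.mono (by rw [uIcc_of_le hT.le])).intervalIntegrable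

/-- The fundamental theorem of calculus in time, integrated over space. -/
theorem setIntegral_timeDeriv (hT : 0 < T)
    (hθ : ContDiffOn ℝ 1 (fun p : ℝ × E d => θ p.1 p.2) (slab d T))
    (hi : IntegrableOn (fun p : ℝ × E d => timeDeriv T θ p.1 p.2) (slab d T)) :
    ∫ p in slab d T, timeDeriv T θ p.1 p.2 = ∫ x, (θ T x - θ 0 x) := by
  rw [setIntegral_slab_symm hT.le hi]
  simp_rw [intervalIntegral_timeDeriv hT hθ]

end Slab

/-! ### The path of densities -/

section Density

variable {d : ℕ} {U : ℝ → E d → ℝ}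

theorem contDiffOn_exp_neg (hU : IsPotentialPath U) :
    ContDiffOn ℝ 1 (fun p : ℝ × E d => Real.exp (-U p.1 p.2)) (slab d 1) :=
  Real.contDiff_exp.comp_contDiffOn hU.contDiffOn.neg

theorem timeDeriv_exp_neg (hU : IsPotentialPath U) {t : ℝ} (ht : t ∈ Icc (0 : ℝ) 1) (x : E d) :
    timeDeriv 1 (fun s y => Real.exp (-U s y)) t x
      = -(timeDeriv 1 U t x) * Real.exp (-U t x) := by
  refine timeDeriv_eq one_pos ht ?_
  have := (hasDerivWithinAt_time hU.contDiffOn ht x).fun_neg.exp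
  rwa [mul_comm] at this

theorem partitionFn_pos (hU : IsPotentialPath U) {t : ℝ} (ht : t ∈ Icc (0 : ℝ) 1) :
    0 < partitionFn U t :=
  integral_exp_pos (hU.integrable t ht)

/-- Dominated convergence for difference quotients: by the mean value inequality on the convex set
`[0, 1]`, the bound `g` on the time derivative also bounds every slope. -/
theorem hasDerivWithinAt_partitionFn (hU : IsPotentialPath U) {t : ℝ} (ht : t ∈ Icc (0 : ℝ) 1) :
    HasDerivWithinAt (partitionFn U) (∫ x, timeDeriv 1 (fun s y => Real.exp (-U s y)) t x)
      (Icc 0 1) t := by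
  obtain ⟨g, hg, hb⟩ := hU.dominated
  have hd : ∀ x : E d, ∀ s ∈ Icc (0 : ℝ) 1, HasDerivWithinAt (fun s => Real.exp (-U s x))
      (timeDeriv 1 (fun s y => Real.exp (-U s y)) s x) (Icc 0 1) s := fun x s hs =>
    hasDerivWithinAt_time (θ := fun s y => Real.exp (-U s y)) (contDiffOn_exp_neg hU) hs x
  have hbd : ∀ x : E d, ∀ s ∈ Icc (0 : ℝ) 1,
      ‖timeDeriv 1 (fun s y => Real.exp (-U s y)) s x‖ ≤ g x := by
    intro x s hs
    rw [timeDeriv_exp_neg hU hs, norm_mul, norm_neg, Real.norm_eq_abs, Real.norm_eq_abs,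
      Real.abs_exp]
    exact hb s hs x
  rw [hasDerivWithinAt_iff_tendsto_slope]
  have hmem : ∀ᶠ s in 𝓝[Icc (0 : ℝ) 1 \ {t}] t, s ∈ Icc (0 : ℝ) 1 ∧ s ≠ t :=
    eventually_nhdsWithin_of_forall fun s hs => hs
  have hslope : ∀ᶠ s in 𝓝[Icc (0 : ℝ) 1 \ {t}] t,
      ∫ x, slope (fun s => Real.exp (-U s x)) t s = slope (partitionFn U) t s := by
    filter_upwards [hmem] with s hs
    simp_rw [slope_def_field, partitionFn]
    rw [integral_div, integral_sub (hU.integrable s hs.1) (hU.integrable t ht)]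
  refine Tendsto.congr' hslope (tendsto_integral_filter_of_dominated_convergence g ?_ ?_ hg ?_)
  · filter_upwards [hmem] with s hs
    simp_rw [slope_def_field]
    exact (((hU.integrable s hs.1).sub (hU.integrable t ht)).div_const _).aestronglyMeasurable
  · filter_upwards [hmem] with s hs
    refine Eventually.of_forall fun x => ?_
    have := (convex_Icc (0 : ℝ) 1).norm_image_sub_le_of_norm_hasDerivWithin_le
      (hd x) (hbd x) ht hs.1
    rw [slope_def_field, norm_div, div_le_iff₀ (norm_pos_iff.2 (sub_ne_zero.2 hs.2))]
    exact this
  · refine Eventually.of_forall fun x => ?_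
    exact (hasDerivWithinAt_iff_tendsto_slope.1 (hd x t ht))

theorem contDiffOn_partitionFn (hU : IsPotentialPath U) :
    ContDiffOn ℝ 1 (partitionFn U) (Icc 0 1) := by
  obtain ⟨g, hg, hb⟩ := hU.dominated
  rw [show (1 : WithTop ℕ∞) = 0 + 1 by simp,
    contDiffOn_succ_iff_derivWithin (uniqueDiffOn_Icc one_pos)]
  refine ⟨fun t ht => (hasDerivWithinAt_partitionFn hU ht).differentiableWithinAt, by simp, ?_⟩
  rw [contDiffOn_zero]
  have hc := continuousOn_timeDeriv (θ := fun s y => Real.exp (-U s y)) one_pos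
    (contDiffOn_exp_neg hU)
  have : ContinuousOn (fun t => ∫ x, timeDeriv 1 (fun s y => Real.exp (-U s y)) t x)
      (Icc 0 1) := by
    refine continuousOn_of_dominated (bound := g) ?_ ?_ hg ?_
    · intro t ht
      exact (continuousOn_slice hc ht).aestronglyMeasurable
    · intro t ht
      refine Eventually.of_forall fun x => ?_
      rw [timeDeriv_exp_neg hU ht, norm_mul, norm_neg, Real.norm_eq_abs, Real.norm_eq_abs,
        Real.abs_exp]
      exact hb t ht x
    · refine Eventually.of_forall fun x => ?_
      exact hc.comp (f := fun s : ℝ => (s, x)) (by fun_prop) (fun _ hs => mem_slab hs x)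
  exact this.congr fun t ht =>
    (hasDerivWithinAt_partitionFn hU ht).derivWithin (uniqueDiffOn_Icc one_pos t ht)

theorem contDiffOn_rho (hU : IsPotentialPath U) :
    ContDiffOn ℝ 1 (fun p : ℝ × E d => rho U p.1 p.2) (slab d 1) := by
  have h1 : ContDiffOn ℝ 1 (fun p : ℝ × E d => partitionFn U p.1) (slab d 1) :=
    (contDiffOn_partitionFn hU).comp contDiff_fst.contDiffOn fun p hp => hp.1
  exact (h1.inv fun p hp => (partitionFn_pos hU hp.1).ne').mul (contDiffOn_exp_neg hU)

theorem rho_pos (hU : IsPotentialPath U) {t : ℝ} (ht : t ∈ Icc (0 : ℝ) 1) (x : E d) :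
    0 < rho U t x :=
  mul_pos (inv_pos.2 (partitionFn_pos hU ht)) (Real.exp_pos _)

theorem integrable_rho (hU : IsPotentialPath U) {t : ℝ} (ht : t ∈ Icc (0 : ℝ) 1) :
    Integrable (rho U t) :=
  (hU.integrable t ht).const_mul _

theorem integral_rho (hU : IsPotentialPath U) {t : ℝ} (ht : t ∈ Icc (0 : ℝ) 1) :
    ∫ x, rho U t x = 1 := by
  unfold rho
  rw [integral_const_mul]
  exact inv_mul_cancel₀ (partitionFn_pos hU ht).ne'

/-- The mean of `∂_t U_t` for the density `ρ_t`. -/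
def meanRate (U : ℝ → E d → ℝ) (t : ℝ) : ℝ := ∫ x, timeDeriv 1 U t x * rho U t x

theorem integrable_timeDeriv_mul_rho (hU : IsPotentialPath U) {t : ℝ} (ht : t ∈ Icc (0 : ℝ) 1) :
    Integrable fun x => timeDeriv 1 U t x * rho U t x := by
  obtain ⟨g, hg, hb⟩ := hU.dominated
  have hc := continuousOn_slice (continuousOn_timeDeriv one_pos hU.contDiffOn) ht
  have hr := (contDiff_slice (contDiffOn_rho hU) ht).continuous
  refine (hg.const_mul (partitionFn U t)⁻¹).mono' (hc.mul hr).aestronglyMeasurable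
    (Eventually.of_forall fun x => ?_)
  have hZ := inv_pos.2 (partitionFn_pos hU ht)
  unfold rho
  rw [norm_mul, norm_mul, Real.norm_eq_abs, Real.norm_eq_abs, Real.norm_eq_abs, Real.abs_exp,
    abs_of_pos hZ, mul_left_comm]
  exact mul_le_mul_of_nonneg_left (hb t ht x) hZ.le

theorem integral_timeDeriv_exp_neg (hU : IsPotentialPath U) {t : ℝ} (ht : t ∈ Icc (0 : ℝ) 1) :
    ∫ x, timeDeriv 1 (fun s y => Real.exp (-U s y)) t x = -(meanRate U t * partitionFn U t) := by
  have hZ := partitionFn_pos hU ht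
  rw [meanRate, ← integral_mul_const, ← integral_neg]
  refine integral_congr_ae (Eventually.of_forall fun x => ?_)
  rw [timeDeriv_exp_neg hU ht]
  simp only [rho]
  field_simp

/-- The quotient rule, with `Z' = -meanRate · Z`. It exhibits `∂_t ρ_t` as the density times the
centred rate, from which integrability, zero mean and square integrability are read off. -/
theorem timeDeriv_rho (hU : IsPotentialPath U) {t : ℝ} (ht : t ∈ Icc (0 : ℝ) 1) (x : E d) :
    timeDeriv 1 (rho U) t x = (meanRate U t - timeDeriv 1 U t x) * rho U t x := by
  refine timeDeriv_eq one_pos ht ?_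
  have hZ := partitionFn_pos hU ht
  have h1 := (hasDerivWithinAt_partitionFn hU ht).inv hZ.ne'
  have h2 := hasDerivWithinAt_time (θ := fun s y => Real.exp (-U s y)) (contDiffOn_exp_neg hU) ht x
  have h3 := h1.mul h2
  rw [integral_timeDeriv_exp_neg hU ht, timeDeriv_exp_neg hU ht] at h3
  have h4 : (meanRate U t - timeDeriv 1 U t x) * rho U t x
      = - -(meanRate U t * partitionFn U t) / partitionFn U t ^ 2 * Real.exp (-U t x)
        + (partitionFn U)⁻¹ t * (-timeDeriv 1 U t x * Real.exp (-U t x)) := by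
    simp only [rho, Pi.inv_apply]
    field_simp
    ring
  rw [h4]
  exact h3

theorem integrable_timeDeriv_rho (hU : IsPotentialPath U) {t : ℝ} (ht : t ∈ Icc (0 : ℝ) 1) :
    Integrable fun x => timeDeriv 1 (rho U) t x := by
  simp_rw [timeDeriv_rho hU ht, sub_mul]
  exact ((integrable_rho hU ht).const_mul _).sub (integrable_timeDeriv_mul_rho hU ht)

/-- Conservation of mass. This is the solvability condition of the transport equation: the
right-hand side annihilates constants. -/
theorem integral_timeDeriv_rho (hU : IsPotentialPath U) {t : ℝ} (ht : t ∈ Icc (0 : ℝ) 1) :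
    ∫ x, timeDeriv 1 (rho U) t x = 0 := by
  simp_rw [timeDeriv_rho hU ht, sub_mul]
  rw [integral_sub ((integrable_rho hU ht).const_mul _) (integrable_timeDeriv_mul_rho hU ht),
    integral_const_mul, integral_rho hU ht, meanRate, mul_one, sub_self]

theorem continuousOn_meanRate (hU : IsPotentialPath U) : ContinuousOn (meanRate U) (Icc 0 1) := by
  have h := contDiffOn_partitionFn hU
  have hd := h.continuousOn_derivWithin (uniqueDiffOn_Icc one_pos) le_rfl
  refine (hd.neg.div h.continuousOn fun t ht => (partitionFn_pos hU ht).ne').congr fun t ht => ?_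
  have hZ := partitionFn_pos hU ht
  change _ = -derivWithin (partitionFn U) (Icc 0 1) t / partitionFn U t
  rw [(hasDerivWithinAt_partitionFn hU ht).derivWithin (uniqueDiffOn_Icc one_pos t ht),
    integral_timeDeriv_exp_neg hU ht]
  field_simp

variable {T : ℝ}

theorem Icc_subset_unit (hT : T ∈ Ioc (0 : ℝ) 1) : Icc 0 T ⊆ Icc 0 1 := Icc_subset_Icc_right hT.2

theorem slab_subset_unit (hT : T ∈ Ioc (0 : ℝ) 1) : slab d T ⊆ slab d 1 :=
  prod_mono_left (Icc_subset_unit hT)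

theorem contDiffOn_rho' (hU : IsPotentialPath U) (hT : T ∈ Ioc (0 : ℝ) 1) :
    ContDiffOn ℝ 1 (fun p : ℝ × E d => rho U p.1 p.2) (slab d T) :=
  (contDiffOn_rho hU).mono (slab_subset_unit hT)

theorem continuousOn_rho (hU : IsPotentialPath U) (hT : T ∈ Ioc (0 : ℝ) 1) :
    ContinuousOn (fun p : ℝ × E d => rho U p.1 p.2) (slab d T) :=
  (contDiffOn_rho' hU hT).continuousOn

theorem continuousOn_timeDeriv_rho (hU : IsPotentialPath U) (hT : T ∈ Ioc (0 : ℝ) 1) :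
    ContinuousOn (fun p : ℝ × E d => timeDeriv 1 (rho U) p.1 p.2) (slab d T) :=
  (continuousOn_timeDeriv one_pos (contDiffOn_rho hU)).mono (slab_subset_unit hT)

theorem rho_pos' (hU : IsPotentialPath U) (hT : T ∈ Ioc (0 : ℝ) 1) {t : ℝ} (ht : t ∈ Icc 0 T)
    (x : E d) : 0 < rho U t x :=
  rho_pos hU (Icc_subset_unit hT ht) x

theorem continuous_rho (hU : IsPotentialPath U) {t : ℝ} (ht : t ∈ Icc (0 : ℝ) 1) :
    Continuous (rho U t) :=
  (contDiff_slice (contDiffOn_rho hU) ht).continuous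

theorem continuous_timeDeriv_rho (hU : IsPotentialPath U) {t : ℝ} (ht : t ∈ Icc (0 : ℝ) 1) :
    Continuous (timeDeriv 1 (rho U) t) :=
  continuousOn_slice (continuousOn_timeDeriv one_pos (contDiffOn_rho hU)) ht

theorem integrableOn_rho (hU : IsPotentialPath U) (hT : T ∈ Ioc (0 : ℝ) 1) :
    IntegrableOn (fun p : ℝ × E d => rho U p.1 p.2) (slab d T) := by
  have hm := aestronglyMeasurable_slab (continuousOn_rho hU hT)
  rw [IntegrableOn, volume_restrict_slab]
  rw [volume_restrict_slab] at hm
  rw [integrable_prod_iff hm]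
  have ha : ∀ᵐ t ∂volume.restrict (Icc 0 T), t ∈ Icc 0 T := ae_restrict_mem measurableSet_Icc
  refine ⟨ha.mono fun t ht => integrable_rho hU (Icc_subset_unit hT ht), ?_⟩
  refine (integrable_const (1 : ℝ)).congr (ha.mono fun t ht => ?_)
  have : ∀ x : E d, ‖rho U t x‖ = rho U t x := fun x =>
    Real.norm_of_nonneg (rho_pos' hU hT ht x).le
  simp_rw [this]
  exact (integral_rho hU (Icc_subset_unit hT ht)).symm

/-- The logarithmic derivative in time of the density. -/
def logRate (U : ℝ → E d → ℝ) (t : ℝ) (x : E d) : ℝ := timeDeriv 1 (rho U) t x / rho U t x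

theorem logRate_mul_rho (hU : IsPotentialPath U) {t : ℝ} (ht : t ∈ Icc (0 : ℝ) 1) (x : E d) :
    logRate U t x * rho U t x = timeDeriv 1 (rho U) t x :=
  div_mul_cancel₀ _ (rho_pos hU ht x).ne'

theorem logRate_eq (hU : IsPotentialPath U) {t : ℝ} (ht : t ∈ Icc (0 : ℝ) 1) (x : E d) :
    logRate U t x = meanRate U t - timeDeriv 1 U t x := by
  rw [logRate, timeDeriv_rho hU ht, mul_div_cancel_right₀ _ (rho_pos hU ht x).ne']

theorem continuousOn_logRate (hU : IsPotentialPath U) (hT : T ∈ Ioc (0 : ℝ) 1) :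
    ContinuousOn (fun p : ℝ × E d => logRate U p.1 p.2) (slab d T) :=
  (continuousOn_timeDeriv_rho hU hT).div (continuousOn_rho hU hT)
    fun p hp => (rho_pos' hU hT hp.1 p.2).ne'

/-- From `(m - u)² ≤ 2m² + 2u²`. It transfers the square integrability of `∂_t U_t` to `∂_t log
ρ_t`, the form in which it is used. -/
theorem logRate_sq_mul_rho_le (hU : IsPotentialPath U) {t : ℝ} (ht : t ∈ Icc (0 : ℝ) 1)
    (x : E d) : ‖logRate U t x ^ 2 * rho U t x‖
      ≤ 2 * (meanRate U t ^ 2 * rho U t x) + 2 * (timeDeriv 1 U t x ^ 2 * rho U t x) := by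
  have hr := rho_pos hU ht x
  rw [Real.norm_of_nonneg (by positivity), logRate_eq hU ht]
  nlinarith [mul_nonneg (sq_nonneg (meanRate U t + timeDeriv 1 U t x)) hr.le]

theorem integrable_logRate_sq (hU : IsPotentialPath U) (hT : T ∈ Ioc (0 : ℝ) 1)
    (hS : SquareIntegrableRate U T) {t : ℝ} (ht : t ∈ Icc 0 T) :
    Integrable fun x => logRate U t x ^ 2 * rho U t x := by
  have ht1 := Icc_subset_unit hT ht
  refine ((((integrable_rho hU ht1).const_mul _).const_mul 2).add
    ((hS.1 t ht).const_mul 2)).mono' ?_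
    (Eventually.of_forall fun x => logRate_sq_mul_rho_le hU ht1 x)
  exact (((continuousOn_slice (continuousOn_logRate hU hT) ht).pow 2).mul
    (continuous_rho hU ht1)).aestronglyMeasurable

theorem integrableOn_logRate_sq (hU : IsPotentialPath U) (hT : T ∈ Ioc (0 : ℝ) 1)
    (hS : SquareIntegrableRate U T) :
    IntegrableOn (fun p : ℝ × E d => logRate U p.1 p.2 ^ 2 * rho U p.1 p.2) (slab d T) := by
  have hm : ContinuousOn (meanRate U) (Icc 0 T) :=
    (continuousOn_meanRate hU).mono (Icc_subset_unit hT)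
  -- The mean rate is continuous in time, hence bounded by `K` on `[0, T]`; its contribution is then
  -- at most a multiple of the integrable density.
  obtain ⟨K, hK⟩ := isCompact_Icc.exists_bound_of_continuousOn hm
  have h1 := (((integrableOn_rho (d := d) hU hT).integrable.const_mul (K ^ 2)).const_mul 2).add
    (hS.2.integrable.const_mul 2)
  refine h1.mono' (aestronglyMeasurable_slab
    (((continuousOn_logRate hU hT).pow 2).mul (continuousOn_rho hU hT))) ?_
  filter_upwards [ae_restrict_mem measurableSet_slab] with p hp
  refine (logRate_sq_mul_rho_le hU (Icc_subset_unit hT hp.1) p.2).trans ?_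
  have hr := rho_pos' hU hT hp.1 p.2
  have h2 : meanRate U p.1 ^ 2 ≤ K ^ 2 := sq_le_sq.2 ((hK p.1 hp.1).trans (le_abs_self K))
  simp only [Pi.add_apply]
  gcongr

end Density

/-! ### Weighted square integrable functions -/

section Weighted

variable {α F : Type*} [MeasurableSpace α] {μ : Measure α} [NormedAddCommGroup F]
  [InnerProductSpace ℝ F] {w : α → ℝ} {u v : α → F}

/-- The pointwise bound `|⟪u, v⟫| ≤ ‖u‖² + ‖v‖²` suffices. Weighted `L²` is handled through such
integrals, so the same lemmas serve the slab and the time slices. -/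
theorem integrable_inner_mul (hw : AEStronglyMeasurable w μ) (hw0 : ∀ᵐ p ∂μ, 0 ≤ w p)
    (hu : AEStronglyMeasurable u μ) (hv : AEStronglyMeasurable v μ)
    (hu2 : Integrable (fun p => ‖u p‖ ^ 2 * w p) μ)
    (hv2 : Integrable (fun p => ‖v p‖ ^ 2 * w p) μ) :
    Integrable (fun p => inner ℝ (u p) (v p) * w p) μ := by
  refine (hu2.add hv2).mono' ((hu.inner hv).mul hw) ?_
  filter_upwards [hw0] with p hp
  rw [norm_mul, Real.norm_of_nonneg hp]
  simp only [Pi.add_apply]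
  rw [← add_mul]
  refine mul_le_mul_of_nonneg_right ((norm_inner_le_norm _ _).trans ?_) hp
  nlinarith [sq_nonneg (‖u p‖ - ‖v p‖), sq_nonneg (‖u p‖), sq_nonneg (‖v p‖)]

theorem integrable_sub_sq_mul (hw : AEStronglyMeasurable w μ) (hw0 : ∀ᵐ p ∂μ, 0 ≤ w p)
    (hu : AEStronglyMeasurable u μ) (hv : AEStronglyMeasurable v μ)
    (hu2 : Integrable (fun p => ‖u p‖ ^ 2 * w p) μ)
    (hv2 : Integrable (fun p => ‖v p‖ ^ 2 * w p) μ) :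
    Integrable (fun p => ‖u p - v p‖ ^ 2 * w p) μ := by
  have := (hu2.sub ((integrable_inner_mul hw hw0 hu hv hu2 hv2).const_mul 2)).add hv2
  refine this.congr (Eventually.of_forall fun p => ?_)
  simp only [Pi.add_apply, Pi.sub_apply]
  rw [norm_sub_sq_real]
  ring

theorem integral_sub_sq_mul (hw : AEStronglyMeasurable w μ) (hw0 : ∀ᵐ p ∂μ, 0 ≤ w p)
    (hu : AEStronglyMeasurable u μ) (hv : AEStronglyMeasurable v μ)
    (hu2 : Integrable (fun p => ‖u p‖ ^ 2 * w p) μ)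
    (hv2 : Integrable (fun p => ‖v p‖ ^ 2 * w p) μ) :
    ∫ p, ‖u p - v p‖ ^ 2 * w p ∂μ = ∫ p, ‖u p‖ ^ 2 * w p ∂μ
      - 2 * ∫ p, inner ℝ (u p) (v p) * w p ∂μ + ∫ p, ‖v p‖ ^ 2 * w p ∂μ := by
  have h := (integrable_inner_mul hw hw0 hu hv hu2 hv2).const_mul 2
  rw [← integral_const_mul, ← integral_sub hu2 h]
  refine Eq.trans ?_ (integral_add (hu2.sub h) hv2)
  refine integral_congr_ae (Eventually.of_forall fun p => ?_)
  simp only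
  rw [norm_sub_sq_real]
  ring

end Weighted

/-! ### The action-matching functional as a quadratic functional -/

section Action

variable {d : ℕ} {U : ℝ → E d → ℝ} {T : ℝ}

/-- A square integrable velocity field that solves the transport equation, tested against
continuously differentiable functions with compact support. -/
structure IsWeakVelocity (U : ℝ → E d → ℝ) (T : ℝ) (b : ℝ → E d → E d) : Prop where
  aesm : AEStronglyMeasurable (fun p : ℝ × E d => b p.1 p.2) (volume.restrict (slab d T))
  sq : IntegrableOn (fun p : ℝ × E d => ‖b p.1 p.2‖ ^ 2 * rho U p.1 p.2) (slab d T)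
  weak : ∀ᵐ t ∂volume.restrict (Icc 0 T), ∀ h : E d → ℝ, ContDiff ℝ 1 h → HasCompactSupport h →
    ∫ x, inner ℝ (b t x) (gradient h x) * rho U t x = ∫ x, h x * timeDeriv 1 (rho U) t x

theorem ae_rho_nonneg (hU : IsPotentialPath U) (hT : T ∈ Ioc (0 : ℝ) 1) :
    ∀ᵐ p ∂(volume : Measure (ℝ × E d)).restrict (slab d T), 0 ≤ rho U p.1 p.2 :=
  (ae_restrict_mem measurableSet_slab).mono fun p hp => (rho_pos' hU hT hp.1 p.2).le

theorem aestronglyMeasurable_rho (hU : IsPotentialPath U) (hT : T ∈ Ioc (0 : ℝ) 1) :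
    AEStronglyMeasurable (fun p : ℝ × E d => rho U p.1 p.2) (volume.restrict (slab d T)) :=
  aestronglyMeasurable_slab (continuousOn_rho hU hT)

theorem gradient_eq_zero_of_norm_gt {f : E d → ℝ} {R : ℝ} (h : ∀ x, R < ‖x‖ → f x = 0) {x : E d}
    (hx : R < ‖x‖) : gradient f x = 0 := by
  have : f =ᶠ[𝓝 x] fun _ => 0 := by
    filter_upwards [(isOpen_lt continuous_const continuous_norm).mem_nhds hx] with y hy
    exact h y hy
  rw [this.gradient_eq, gradient_fun_const]

theorem hasCompactSupport_of_norm_gt {f : E d → ℝ} {R : ℝ} (h : ∀ x, R < ‖x‖ → f x = 0) :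
    HasCompactSupport f :=
  HasCompactSupport.intro (isCompact_closedBall 0 R) fun x hx => h x (by simpa using hx)

/-- Integration by parts in time against the density. -/
theorem setIntegral_timeDeriv_mul_rho (hU : IsPotentialPath U) (hT : T ∈ Ioc (0 : ℝ) 1)
    {θ : ℝ → E d → ℝ} (hθ : ContDiffOn ℝ 1 (fun p : ℝ × E d => θ p.1 p.2) (slab d T))
    (i1 : IntegrableOn (fun p : ℝ × E d => timeDeriv T θ p.1 p.2 * rho U p.1 p.2) (slab d T))
    (i2 : IntegrableOn (fun p : ℝ × E d => θ p.1 p.2 * timeDeriv 1 (rho U) p.1 p.2)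
      (slab d T)) :
    (∫ p in slab d T, timeDeriv T θ p.1 p.2 * rho U p.1 p.2)
      + ∫ p in slab d T, θ p.1 p.2 * timeDeriv 1 (rho U) p.1 p.2
      = ∫ x, (θ T x * rho U T x - θ 0 x * rho U 0 x) := by
  have hρ := contDiffOn_rho' (d := d) hU hT
  have hprod : ContDiffOn ℝ 1 (fun p : ℝ × E d => θ p.1 p.2 * rho U p.1 p.2) (slab d T) :=
    hθ.mul hρ
  have e1 : ∀ p ∈ slab d T, timeDeriv T (fun s y => θ s y * rho U s y) p.1 p.2
      = timeDeriv T θ p.1 p.2 * rho U p.1 p.2 + θ p.1 p.2 * timeDeriv 1 (rho U) p.1 p.2 := by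
    intro p hp
    rw [timeDeriv_mul hT.1 hθ hρ hp.1,
      timeDeriv_restrict hT.1 hT.2 (contDiffOn_rho hU) hp.1]
  have i5 : IntegrableOn (fun p : ℝ × E d => timeDeriv T (fun s y => θ s y * rho U s y) p.1 p.2)
      (slab d T) := (integrableOn_congr_fun e1 measurableSet_slab).2 (i1.add i2)
  have h1 := setIntegral_timeDeriv hT.1 hprod i5
  rwa [setIntegral_congr_fun measurableSet_slab e1, integral_add i1 i2] at h1

/-- The transport equation tested against functions of time and space with bounded support. -/
theorem IsWeakVelocity.integral_of_bounded_support {b : ℝ → E d → E d} (hb : IsWeakVelocity U T b)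
    (hU : IsPotentialPath U) (hT : T ∈ Ioc (0 : ℝ) 1) {θ : ℝ → E d → ℝ}
    (hθ : ContDiffOn ℝ 1 (fun p : ℝ × E d => θ p.1 p.2) (slab d T)) {R : ℝ}
    (hR : ∀ t ∈ Icc 0 T, ∀ x, R < ‖x‖ → θ t x = 0) :
    ∫ p in slab d T, (inner ℝ (b p.1 p.2) (gradient (θ p.1) p.2) + timeDeriv T θ p.1 p.2)
      * rho U p.1 p.2 = ∫ x, (θ T x * rho U T x - θ 0 x * rho U 0 x) := by
  have hρ := contDiffOn_rho' (d := d) hU hT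
  have hgθ := continuousOn_gradient hT.1 hθ
  have htθ := continuousOn_timeDeriv hT.1 hθ
  have hR' : ∀ t ∈ Icc 0 T, ∀ x, R < ‖x‖ → timeDeriv T θ t x = 0 := fun t ht x hx =>
    timeDeriv_eq hT.1 ht ((hasDerivWithinAt_const t (Icc 0 T) (0 : ℝ)).congr
      (fun s hs => hR s hs x hx) (hR t ht x hx))
  have i1 : IntegrableOn (fun p : ℝ × E d => timeDeriv T θ p.1 p.2 * rho U p.1 p.2) (slab d T) :=
    integrableOn_slab_of_continuousOn (htθ.mul hρ.continuousOn) R fun t ht x hx => by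
      simp [hR' t ht x hx]
  have i2 : IntegrableOn (fun p : ℝ × E d => θ p.1 p.2 * timeDeriv 1 (rho U) p.1 p.2)
      (slab d T) :=
    integrableOn_slab_of_continuousOn (hθ.continuousOn.mul (continuousOn_timeDeriv_rho hU hT)) R
      fun t ht x hx => by simp [hR t ht x hx]
  have i3 : IntegrableOn (fun p : ℝ × E d => ‖gradient (θ p.1) p.2‖ ^ 2 * rho U p.1 p.2)
      (slab d T) :=
    integrableOn_slab_of_continuousOn ((hgθ.norm.pow 2).mul hρ.continuousOn) R
      fun t ht x hx => by simp [gradient_eq_zero_of_norm_gt (hR t ht) hx]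
  have i4 : IntegrableOn (fun p : ℝ × E d => inner ℝ (b p.1 p.2) (gradient (θ p.1) p.2)
      * rho U p.1 p.2) (slab d T) :=
    integrable_inner_mul (aestronglyMeasurable_rho hU hT) (ae_rho_nonneg hU hT) hb.aesm
      (aestronglyMeasurable_slab hgθ) hb.sq i3
  have h1 := setIntegral_timeDeriv_mul_rho hU hT hθ i1 i2
  -- At almost every time the slice `θ t` is a compactly supported `C¹` function, so the equation
  -- applies slice by slice; integration by parts in time does the rest.
  have h2 : ∫ p in slab d T, θ p.1 p.2 * timeDeriv 1 (rho U) p.1 p.2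
      = ∫ p in slab d T, inner ℝ (b p.1 p.2) (gradient (θ p.1) p.2) * rho U p.1 p.2 := by
    rw [setIntegral_slab hT.1.le i2, setIntegral_slab hT.1.le i4,
      intervalIntegral.integral_of_le hT.1.le, intervalIntegral.integral_of_le hT.1.le,
      ← integral_Icc_eq_integral_Ioc, ← integral_Icc_eq_integral_Ioc]
    refine integral_congr_ae ?_
    filter_upwards [hb.weak, ae_restrict_mem measurableSet_Icc] with t ht htm
    exact (ht _ (contDiff_slice hθ htm) (hasCompactSupport_of_norm_gt (hR t htm))).symm
  simp_rw [add_mul]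
  rw [integral_add i4 i1, ← h1, h2, add_comm]

/-- A smooth bounded truncation of the identity. -/
def truncation (n : ℕ) (s : ℝ) : ℝ := s / (1 + (s / (n + 1)) ^ 2)

/-- The derivative of `truncation`. -/
def truncationDeriv (n : ℕ) (s : ℝ) : ℝ := (1 - (s / (n + 1)) ^ 2) / (1 + (s / (n + 1)) ^ 2) ^ 2

theorem hasDerivAt_truncation (n : ℕ) (s : ℝ) :
    HasDerivAt (truncation n) (truncationDeriv n s) s := by
  have h0 : (1 + (s / (n + 1)) ^ 2 : ℝ) ≠ 0 := by positivity
  have hn : ((n : ℝ) + 1) ≠ 0 := by positivity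
  have h := (hasDerivAt_id s).div ((((hasDerivAt_id s).div_const ((n : ℝ) + 1)).pow 2).const_add 1)
    h0
  refine h.congr_deriv ?_
  simp only [truncationDeriv, id]
  congr 1
  simp
  field_simp
  ring

theorem contDiff_truncation (n : ℕ) : ContDiff ℝ 1 (truncation n) := by
  unfold truncation
  refine contDiff_id.div (by fun_prop) fun s => by positivity

theorem abs_truncationDeriv_le (n : ℕ) (s : ℝ) : |truncationDeriv n s| ≤ 1 := by
  have h : (0 : ℝ) < (1 + (s / (n + 1)) ^ 2) ^ 2 := by positivity
  rw [truncationDeriv, abs_div, abs_of_pos h, div_le_one h, abs_le]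
  constructor <;> nlinarith [sq_nonneg (s / ((n : ℝ) + 1)), sq_nonneg ((s / ((n : ℝ) + 1)) ^ 2)]

theorem abs_truncation_le_abs (n : ℕ) (s : ℝ) : |truncation n s| ≤ |s| := by
  rw [truncation, abs_div, abs_of_pos (by positivity : (0 : ℝ) < 1 + (s / (n + 1)) ^ 2)]
  exact div_le_self (abs_nonneg _) (by nlinarith [sq_nonneg (s / ((n : ℝ) + 1))])

/-- With `q = |s| / (n + 1)` the claim is `q ≤ 1 + q²`. -/
theorem abs_truncation_le (n : ℕ) (s : ℝ) : |truncation n s| ≤ n + 1 := by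
  have hn : (0 : ℝ) < n + 1 := by positivity
  rw [truncation, abs_div, abs_of_pos (by positivity : (0 : ℝ) < 1 + (s / (n + 1)) ^ 2),
    div_le_iff₀ (by positivity)]
  have h : |s| = (n + 1) * |s / (n + 1)| := by
    rw [abs_div, abs_of_pos hn]; field_simp
  rw [h, ← sq_abs (s / ((n : ℝ) + 1))]
  refine mul_le_mul_of_nonneg_left ?_ hn.le
  nlinarith [sq_nonneg (|s / ((n : ℝ) + 1)| - 1)]

theorem tendsto_div_succ (s : ℝ) : Tendsto (fun n : ℕ => s / ((n : ℝ) + 1)) atTop (𝓝 0) := by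
  simpa using (tendsto_one_div_add_atTop_nhds_zero_nat (𝕜 := ℝ)).const_mul s |>.congr
    fun n => by rw [mul_one_div]

theorem tendsto_truncation (s : ℝ) : Tendsto (fun n => truncation n s) atTop (𝓝 s) := by
  have h := (((tendsto_div_succ s).pow 2).const_add 1)
  have h' := (tendsto_const_nhds (x := s)).div h (by norm_num)
  rw [zero_pow two_ne_zero, add_zero, div_one] at h'
  exact h'

theorem tendsto_truncationDeriv (s : ℝ) :
    Tendsto (fun n => truncationDeriv n s) atTop (𝓝 1) := by
  have h := ((tendsto_div_succ s).pow 2)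
  have h' := (h.const_sub 1).div ((h.const_add 1).pow 2) (by norm_num)
  rw [zero_pow two_ne_zero, add_zero, sub_zero, one_pow, div_one] at h'
  exact h'

/-- The transport equation tested against admissible potentials. -/
theorem IsWeakVelocity.integral_of_admissible {b : ℝ → E d → E d} (hb : IsWeakVelocity U T b)
    (hU : IsPotentialPath U) (hT : T ∈ Ioc (0 : ℝ) 1) {ξ : ℝ → E d → ℝ}
    (hξ : Admissible U T ξ) :
    ∫ p in slab d T, (inner ℝ (b p.1 p.2) (gradient (ξ p.1) p.2) + timeDeriv T ξ p.1 p.2)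
      * rho U p.1 p.2 = ∫ x, (ξ T x * rho U T x - ξ 0 x * rho U 0 x) := by
  obtain ⟨K, χ, hK0, hχt, hχ01, hχ1, hχg⟩ := exists_cutoff d
  have h0T : (0 : ℝ) ∈ Icc 0 T := ⟨le_rfl, hT.1.le⟩
  have hTT : T ∈ Icc 0 T := ⟨hT.1.le, le_rfl⟩
  have hξc := hξ.contDiffOn
  have hgξ := continuousOn_gradient hT.1 hξc
  have htξ := continuousOn_timeDeriv hT.1 hξc
  have hρm := aestronglyMeasurable_rho (d := d) hU hT
  -- The cutoff radius grows like the square of the truncation height: `|truncation n| ≤ n + 1`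
  -- against a cutoff gradient of at most `K / (n + 1)²` leaves an error `K / (n + 1)`.
  let m : ℕ → ℕ := fun n => (n + 1) ^ 2
  let θ : ℕ → ℝ → E d → ℝ := fun n t x => χ (m n) x * truncation n (ξ t x)
  have hθ : ∀ n, ContDiffOn ℝ 1 (fun p : ℝ × E d => θ n p.1 p.2) (slab d T) := fun n =>
    ((hχt (m n)).contDiff_one.comp contDiff_snd).contDiffOn.mul
      ((contDiff_truncation n).comp_contDiffOn hξc)
  have hsupp : ∀ n, ∃ R, ∀ x, R < ‖x‖ → χ (m n) x = 0 := by
    intro n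
    obtain ⟨R, hR⟩ := (hχt (m n)).2.isCompact.isBounded.subset_closedBall (0 : E d)
    refine ⟨R, fun x hx => image_eq_zero_of_notMem_tsupport fun h => ?_⟩
    have := hR h
    rw [mem_closedBall_zero_iff] at this
    exact absurd this (not_le.2 hx)
  have hid : ∀ n, ∫ p in slab d T, (inner ℝ (b p.1 p.2) (gradient (θ n p.1) p.2)
      + timeDeriv T (θ n) p.1 p.2) * rho U p.1 p.2
      = ∫ x, (θ n T x * rho U T x - θ n 0 x * rho U 0 x) := by
    intro n
    obtain ⟨R, hR⟩ := hsupp n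
    exact hb.integral_of_bounded_support hU hT (hθ n) (R := R) fun t _ x hx => by
      simp [θ, hR x hx]
  have hgθ : ∀ n, ∀ p ∈ slab d T, gradient (θ n p.1) p.2
      = χ (m n) p.2 • truncationDeriv n (ξ p.1 p.2) • gradient (ξ p.1) p.2
        + truncation n (ξ p.1 p.2) • gradient (χ (m n)) p.2 := by
    intro n p hp
    have hd := (contDiff_slice hξc hp.1).differentiable one_ne_zero p.2
    have h1 := gradient_mul (((hχt (m n)).contDiff_one.differentiable one_ne_zero) p.2)
      (((contDiff_truncation n).comp (contDiff_slice hξc hp.1)).differentiable one_ne_zero p.2)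
    have h2 : gradient (truncation n ∘ ξ p.1) p.2 = _ :=
      gradient_comp (hasDerivAt_truncation n (ξ p.1 p.2)) hd
    rw [h2] at h1
    exact h1
  have htθ : ∀ n, ∀ p ∈ slab d T, timeDeriv T (θ n) p.1 p.2
      = χ (m n) p.2 * (truncationDeriv n (ξ p.1 p.2) * timeDeriv T ξ p.1 p.2) := by
    intro n p hp
    exact timeDeriv_eq hT.1 hp.1 (((hasDerivAt_truncation n (ξ p.1 p.2)).comp_hasDerivWithinAt p.1
      (hasDerivWithinAt_time hξc hp.1 p.2)).const_mul _)
  have hχabs : ∀ n x, |χ n x| ≤ 1 := fun n x => abs_le.2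
    ⟨by linarith [(hχ01 n x).1], (hχ01 n x).2⟩
  have hm : ∀ n : ℕ, ((m n : ℕ) : ℝ) = ((n : ℝ) + 1) ^ 2 := fun n => by simp [m]
  have hχlim : ∀ x, ∀ᶠ n in atTop, χ (m n) x = 1 := by
    intro x
    filter_upwards [eventually_ge_atTop ⌈‖x‖⌉₊] with n hn
    refine hχ1 _ x ?_
    rw [hm]
    have : ‖x‖ ≤ n := (Nat.le_ceil _).trans (by exact_mod_cast hn)
    nlinarith [norm_nonneg x]
  have hχlim' : ∀ x, Tendsto (fun n => χ (m n) x) atTop (𝓝 1) := fun x =>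
    tendsto_const_nhds.congr' ((hχlim x).mono fun n hn => hn.symm)
  have hFχ : ∀ (n : ℕ) (s : ℝ) (x : E d), ‖truncation n s • gradient (χ (m n)) x‖
      ≤ K / (n + 1) := by
    intro n s x
    have hn : (0 : ℝ) < n + 1 := by positivity
    rw [norm_smul, Real.norm_eq_abs]
    calc |truncation n s| * ‖gradient (χ (m n)) x‖ ≤ (n + 1) * (K / ((n : ℝ) + 1) ^ 2) := by
          refine mul_le_mul (abs_truncation_le n s) ((hχg (m n) x).trans ?_) (norm_nonneg _) hn.le
          rw [hm]
          gcongr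
          linarith
      _ = K / (n + 1) := by field_simp
  have hFχ' : ∀ (s : ℝ) (x : E d),
      Tendsto (fun n => truncation n s • gradient (χ (m n)) x) atTop (𝓝 0) := fun s x =>
    squeeze_zero_norm (fun n => hFχ n s x) (tendsto_div_succ K)
  have hib : IntegrableOn (fun p : ℝ × E d => inner ℝ (b p.1 p.2) (gradient (ξ p.1) p.2)
      * rho U p.1 p.2) (slab d T) :=
    integrable_inner_mul hρm (ae_rho_nonneg hU hT) hb.aesm (aestronglyMeasurable_slab hgξ)
      hb.sq hξ.gradient_sq
  have hLHS : Tendsto (fun n => ∫ p in slab d T, (inner ℝ (b p.1 p.2) (gradient (θ n p.1) p.2)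
      + timeDeriv T (θ n) p.1 p.2) * rho U p.1 p.2) atTop
      (𝓝 (∫ p in slab d T, (inner ℝ (b p.1 p.2) (gradient (ξ p.1) p.2) + timeDeriv T ξ p.1 p.2)
      * rho U p.1 p.2)) := by
    -- The first two terms dominate the contributions in which derivatives fall on `ξ`, since the
    -- cutoff and `truncationDeriv` are at most `1` in absolute value. The last one dominates the
    -- cutoff gradient through `K ‖b‖ ≤ K (‖b‖² + 1)`.
    refine tendsto_integral_of_dominated_convergence (fun p => (‖inner ℝ (b p.1 p.2)
      (gradient (ξ p.1) p.2) * rho U p.1 p.2‖ + ‖timeDeriv T ξ p.1 p.2 * rho U p.1 p.2‖)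
      + K * (‖b p.1 p.2‖ ^ 2 * rho U p.1 p.2 + rho U p.1 p.2)) ?_ ?_ ?_ ?_
    · intro n
      exact ((hb.aesm.inner (aestronglyMeasurable_slab (continuousOn_gradient hT.1 (hθ n)))).add
        (aestronglyMeasurable_slab (continuousOn_timeDeriv hT.1 (hθ n)))).mul hρm
    · exact (hib.norm.add hξ.timeDeriv.norm).add ((hb.sq.add (integrableOn_rho hU hT)).const_mul K)
    · intro n
      filter_upwards [ae_restrict_mem measurableSet_slab] with p hp
      have hρ := rho_pos' hU hT hp.1 p.2
      rw [hgθ n p hp, htθ n p hp]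
      simp only [norm_mul _ (rho U p.1 p.2), Real.norm_of_nonneg hρ.le]
      rw [← add_mul, ← add_one_mul, ← mul_assoc (χ (m n) p.2), ← mul_assoc K, ← add_mul]
      refine mul_le_mul_of_nonneg_right ?_ hρ.le
      have hc : ‖χ (m n) p.2 * truncationDeriv n (ξ p.1 p.2)‖ ≤ 1 := by
        rw [norm_mul]
        exact mul_le_one₀ (hχabs _ _) (norm_nonneg _) (abs_truncationDeriv_le _ _)
      have hg : ‖truncation n (ξ p.1 p.2) • gradient (χ (m n)) p.2‖ ≤ K :=
        (hFχ n _ _).trans (div_le_self hK0 (by linarith [(Nat.cast_nonneg n : (0 : ℝ) ≤ n)]))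
      rw [inner_add_right, smul_smul, inner_smul_right, add_right_comm]
      refine (norm_add_le _ _).trans (add_le_add ((norm_add_le _ _).trans (add_le_add ?_ ?_)) ?_)
      · rw [norm_mul]
        exact mul_le_of_le_one_left (norm_nonneg _) hc
      · rw [norm_mul]
        exact mul_le_of_le_one_left (norm_nonneg _) hc
      · refine (norm_inner_le_norm _ _).trans ?_
        rw [mul_comm K]
        refine mul_le_mul ?_ hg (norm_nonneg _) (by positivity)
        nlinarith [sq_nonneg (‖b p.1 p.2‖ - 1), sq_nonneg (‖b p.1 p.2‖)]
    · filter_upwards [ae_restrict_mem measurableSet_slab] with p hp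
      refine Tendsto.mul_const _ ?_
      have hD := tendsto_truncationDeriv (ξ p.1 p.2)
      have h1 : Tendsto (fun n => gradient (θ n p.1) p.2) atTop (𝓝 (gradient (ξ p.1) p.2)) := by
        simp_rw [hgθ _ p hp]
        simpa using ((hχlim' p.2).smul (hD.smul_const (gradient (ξ p.1) p.2))).add
          (hFχ' (ξ p.1 p.2) p.2)
      have h2 : Tendsto (fun n => timeDeriv T (θ n) p.1 p.2) atTop (𝓝 (timeDeriv T ξ p.1 p.2)) := by
        simp_rw [htθ _ p hp]
        simpa using (hχlim' p.2).mul (hD.mul_const (timeDeriv T ξ p.1 p.2))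
      exact (tendsto_const_nhds.inner h1).add h2
  have hend : ∀ t ∈ Icc 0 T, ∀ n x, ‖θ n t x * rho U t x‖ ≤ ‖ξ t x * rho U t x‖ := by
    intro t ht n x
    rw [norm_mul, norm_mul (ξ t x)]
    refine mul_le_mul_of_nonneg_right ?_ (norm_nonneg _)
    rw [Real.norm_eq_abs, Real.norm_eq_abs, abs_mul]
    exact (mul_le_of_le_one_left (abs_nonneg _) (hχabs _ _)).trans (abs_truncation_le_abs _ _)
  have hRHS : Tendsto (fun n => ∫ x, (θ n T x * rho U T x - θ n 0 x * rho U 0 x)) atTop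
      (𝓝 (∫ x, (ξ T x * rho U T x - ξ 0 x * rho U 0 x))) := by
    refine tendsto_integral_of_dominated_convergence
      (fun x => ‖ξ T x * rho U T x‖ + ‖ξ 0 x * rho U 0 x‖) ?_ ?_ ?_ ?_
    · intro n
      have hc : ∀ t ∈ Icc 0 T, Continuous fun x => θ n t x * rho U t x := fun t ht =>
        (contDiff_slice (hθ n) ht).continuous.mul (continuous_rho hU (Icc_subset_unit hT ht))
      exact ((hc T hTT).sub (hc 0 h0T)).aestronglyMeasurable
    · exact hξ.final.norm.add hξ.initial.norm
    · intro n
      exact Eventually.of_forall fun x => (norm_sub_le _ _).trans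
        (add_le_add (hend T hTT n x) (hend 0 h0T n x))
    · refine Eventually.of_forall fun x => ?_
      have h1 : ∀ t, Tendsto (fun n => θ n t x) atTop (𝓝 (ξ t x)) := fun t => by
        simpa using (hχlim' x).mul (tendsto_truncation (ξ t x))
      exact ((h1 T).mul_const _).sub ((h1 0).mul_const _)
  simp_rw [hid] at hLHS
  exact tendsto_nhds_unique hLHS hRHS

theorem integrableOn_half_sq_add_timeDeriv {ξ : ℝ → E d → ℝ} (hξ : Admissible U T ξ) :
    IntegrableOn (fun p : ℝ × E d => (1 / 2 * ‖gradient (ξ p.1) p.2‖ ^ 2 + timeDeriv T ξ p.1 p.2)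
      * rho U p.1 p.2) (slab d T) := by
  simp_rw [add_mul, mul_assoc]
  exact (hξ.gradient_sq.const_mul _).add hξ.timeDeriv

theorem actionLoss_eq (hT : T ∈ Ioc (0 : ℝ) 1) {ξ : ℝ → E d → ℝ} (hξ : Admissible U T ξ) :
    actionLoss U T ξ = 1 / 2 * (∫ p in slab d T, ‖gradient (ξ p.1) p.2‖ ^ 2 * rho U p.1 p.2)
      + (∫ p in slab d T, timeDeriv T ξ p.1 p.2 * rho U p.1 p.2)
      + ∫ x, (ξ 0 x * rho U 0 x - ξ T x * rho U T x) := by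
  have h := setIntegral_slab hT.1.le (integrableOn_half_sq_add_timeDeriv hξ)
  simp only [actionLoss] at h ⊢
  rw [← h, ← integral_const_mul, ← integral_add (hξ.gradient_sq.const_mul _) hξ.timeDeriv]
  simp_rw [add_mul, mul_assoc]

/-- Completing the square in the action-matching functional. -/
theorem IsWeakVelocity.actionLoss_eq {b : ℝ → E d → E d} (hb : IsWeakVelocity U T b)
    (hU : IsPotentialPath U) (hT : T ∈ Ioc (0 : ℝ) 1) {ξ : ℝ → E d → ℝ}
    (hξ : Admissible U T ξ) :
    actionLoss U T ξ
      = 1 / 2 * (∫ p in slab d T, ‖gradient (ξ p.1) p.2 - b p.1 p.2‖ ^ 2 * rho U p.1 p.2)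
        - 1 / 2 * ∫ p in slab d T, ‖b p.1 p.2‖ ^ 2 * rho U p.1 p.2 := by
  have hgξ := aestronglyMeasurable_slab (continuousOn_gradient hT.1 hξ.contDiffOn)
  have hρm := aestronglyMeasurable_rho (d := d) hU hT
  have hρ0 := ae_rho_nonneg (d := d) hU hT
  have h1 := hb.integral_of_admissible hU hT hξ
  have hi := integrable_inner_mul hρm hρ0 hb.aesm hgξ hb.sq hξ.gradient_sq
  simp_rw [add_mul] at h1
  rw [integral_add hi hξ.timeDeriv, integral_sub hξ.final hξ.initial] at h1
  -- The tested equation turns the time derivative and the end-point terms into `-∫∫ ⟪b, ∇ξ⟫ ρ`, the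
  -- cross term of the square.
  rw [ActionMatching.actionLoss_eq hT hξ, integral_sub hξ.initial hξ.final,
    integral_sub_sq_mul hρm hρ0 hgξ hb.aesm hξ.gradient_sq hb.sq]
  simp_rw [real_inner_comm] at h1 ⊢
  linarith

end Action

/-! ### Minimizers among the classical potentials -/

section Classical

variable {d : ℕ} {U : ℝ → E d → ℝ} {T : ℝ}

theorem integral_inner_gradient_rho (hU : IsPotentialPath U) {t : ℝ} (ht : t ∈ Icc (0 : ℝ) 1)
    {b : E d → E d} (hb : ContDiff ℝ 1 b) {h : E d → ℝ} (hh : ContDiff ℝ 1 h)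
    (hc : HasCompactSupport h) :
    ∫ x, inner ℝ (b x) (gradient h x) * rho U t x
      = -∫ x, h x * divergence (fun y => rho U t y • b y) x := by
  have h1 : ContDiff ℝ 1 fun y => rho U t y • b y :=
    (contDiff_slice (contDiffOn_rho hU) ht).smul hb
  rw [← integral_inner_gradient h1 hh hc]
  simp_rw [inner_smul_left, conj_trivial, mul_comm]

/-- The pointwise equation is multiplied by a test function and integrated by parts; `φ_t` of class
`C²` makes `ρ_t ∇φ_t` a `C¹` field. -/
theorem isWeakVelocity_of_solvesTransport (hU : IsPotentialPath U) (hT : T ∈ Ioc (0 : ℝ) 1)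
    {φ : ℝ → E d → ℝ} (hφ : Admissible U T φ)
    (h : ∀ t ∈ Icc 0 T, SolvesTransport U t (gradient (φ t))) :
    IsWeakVelocity U T fun t => gradient (φ t) where
  aesm := aestronglyMeasurable_slab (continuousOn_gradient hT.1 hφ.contDiffOn)
  sq := hφ.gradient_sq
  weak := by
    filter_upwards [ae_restrict_mem measurableSet_Icc] with t ht f hf hc
    rw [integral_inner_gradient_rho hU (Icc_subset_unit hT ht)
      (contDiff_gradient (hφ.contDiff t ht)) hf hc, ← integral_neg]
    refine integral_congr_ae (Eventually.of_forall fun x => ?_)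
    simp only
    rw [h t ht x]
    ring

theorem Admissible.add {φ η : ℝ → E d → ℝ} (hU : IsPotentialPath U) (hT : T ∈ Ioc (0 : ℝ) 1)
    (hφ : Admissible U T φ) (hη : Admissible U T η) :
    Admissible U T fun t x => φ t x + η t x where
  contDiffOn := hφ.contDiffOn.add hη.contDiffOn
  contDiff t ht := (hφ.contDiff t ht).add (hη.contDiff t ht)
  gradient_sq := by
    -- The sum of gradients is written as a difference with `-∇η`, to use the weighted square bound
    -- for differences.
    have h := integrable_sub_sq_mul (u := fun p : ℝ × E d => gradient (φ p.1) p.2)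
      (v := fun p : ℝ × E d => -gradient (η p.1) p.2) (aestronglyMeasurable_rho hU hT)
      (ae_rho_nonneg hU hT)
      (aestronglyMeasurable_slab (continuousOn_gradient hT.1 hφ.contDiffOn))
      (aestronglyMeasurable_slab (continuousOn_gradient hT.1 hη.contDiffOn)).neg
      hφ.gradient_sq (by simpa only [norm_neg, IntegrableOn] using hη.gradient_sq)
    refine (integrableOn_congr_fun (fun p hp => ?_) measurableSet_slab).2 h
    rw [sub_neg_eq_add, gradient_add
      ((contDiff_slice hφ.contDiffOn hp.1).differentiable one_ne_zero _)
      ((contDiff_slice hη.contDiffOn hp.1).differentiable one_ne_zero _)]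
  timeDeriv := by
    refine (integrableOn_congr_fun (fun p hp => ?_) measurableSet_slab).2
      (hφ.timeDeriv.add hη.timeDeriv)
    rw [timeDeriv_add hT.1 hφ.contDiffOn hη.contDiffOn hp.1, add_mul, Pi.add_apply]
  initial := by
    simp_rw [add_mul]
    exact hφ.initial.add hη.initial
  final := by
    simp_rw [add_mul]
    exact hφ.final.add hη.final

theorem gradient_const_mul_slice {η : ℝ → E d → ℝ} (hη : Admissible U T η) (c : ℝ) {t : ℝ}
    (ht : t ∈ Icc 0 T) (x : E d) : gradient (fun y => c * η t y) x = c • gradient (η t) x :=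
  gradient_const_mul c ((contDiff_slice hη.contDiffOn ht).differentiable one_ne_zero _)

theorem Admissible.const_mul {η : ℝ → E d → ℝ} (hT : T ∈ Ioc (0 : ℝ) 1)
    (hη : Admissible U T η) (c : ℝ) : Admissible U T fun t x => c * η t x where
  contDiffOn := contDiffOn_const.mul hη.contDiffOn
  contDiff t ht := contDiff_const.mul (hη.contDiff t ht)
  gradient_sq := by
    refine (integrableOn_congr_fun (fun p hp => ?_) measurableSet_slab).2
      (hη.gradient_sq.const_mul (c ^ 2))
    rw [gradient_const_mul_slice hη c hp.1, norm_smul, mul_pow, Real.norm_eq_abs, sq_abs,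
      mul_assoc]
  timeDeriv := by
    refine (integrableOn_congr_fun (fun p hp => ?_) measurableSet_slab).2
      (hη.timeDeriv.const_mul c)
    rw [timeDeriv_const_mul hT.1 c hη.contDiffOn hp.1, mul_assoc]
  initial := by
    simp_rw [mul_assoc]
    exact hη.initial.const_mul c
  final := by
    simp_rw [mul_assoc]
    exact hη.final.const_mul c

/-- The expansion of the action-matching functional along a line. -/
theorem actionLoss_add_const_mul (hU : IsPotentialPath U) (hT : T ∈ Ioc (0 : ℝ) 1)
    {φ η : ℝ → E d → ℝ} (hφ : Admissible U T φ) (hη : Admissible U T η) (ε : ℝ) :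
    actionLoss U T (fun t x => φ t x + ε * η t x) = actionLoss U T φ
      + ε * ((∫ p in slab d T, inner ℝ (gradient (φ p.1) p.2) (gradient (η p.1) p.2)
          * rho U p.1 p.2)
        + (∫ p in slab d T, timeDeriv T η p.1 p.2 * rho U p.1 p.2)
        + ∫ x, (η 0 x * rho U 0 x - η T x * rho U T x))
      + ε ^ 2 * (1 / 2 * ∫ p in slab d T, ‖gradient (η p.1) p.2‖ ^ 2 * rho U p.1 p.2) := by
  have hεη := hη.const_mul hT ε
  have hsum := hφ.add hU hT hεη
  have i1 := integrable_inner_mul (aestronglyMeasurable_rho hU hT) (ae_rho_nonneg hU hT)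
      (aestronglyMeasurable_slab (continuousOn_gradient hT.1 hφ.contDiffOn))
      (aestronglyMeasurable_slab (continuousOn_gradient hT.1 hη.contDiffOn))
      hφ.gradient_sq hη.gradient_sq
  rw [actionLoss_eq hT hsum, actionLoss_eq hT hφ]
  have e1 : ∫ p in slab d T, ‖gradient (fun x => φ p.1 x + ε * η p.1 x) p.2‖ ^ 2 * rho U p.1 p.2
      = (∫ p in slab d T, ‖gradient (φ p.1) p.2‖ ^ 2 * rho U p.1 p.2)
        + ε * 2 * (∫ p in slab d T, inner ℝ (gradient (φ p.1) p.2) (gradient (η p.1) p.2)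
          * rho U p.1 p.2)
        + ε ^ 2 * ∫ p in slab d T, ‖gradient (η p.1) p.2‖ ^ 2 * rho U p.1 p.2 := by
    rw [← integral_const_mul, ← integral_const_mul,
      ← integral_add hφ.gradient_sq (i1.const_mul _)]
    refine Eq.trans ?_ (integral_add (hφ.gradient_sq.add (i1.const_mul _))
      (hη.gradient_sq.const_mul _))
    refine setIntegral_congr_fun measurableSet_slab fun p hp => ?_
    rw [gradient_add ((contDiff_slice hφ.contDiffOn hp.1).differentiable one_ne_zero _)
      ((contDiff_slice (θ := fun t x => ε * η t x) hεη.contDiffOn hp.1).differentiable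
        one_ne_zero _), gradient_const_mul_slice hη ε hp.1, norm_add_sq_real, norm_smul, inner_smul_right,
      Real.norm_eq_abs, mul_pow, sq_abs]
    ring
  have e2 : ∫ p in slab d T, timeDeriv T (fun t x => φ t x + ε * η t x) p.1 p.2 * rho U p.1 p.2
      = (∫ p in slab d T, timeDeriv T φ p.1 p.2 * rho U p.1 p.2)
        + ε * ∫ p in slab d T, timeDeriv T η p.1 p.2 * rho U p.1 p.2 := by
    rw [← integral_const_mul, ← integral_add hφ.timeDeriv (hη.timeDeriv.const_mul _)]
    refine setIntegral_congr_fun measurableSet_slab fun p hp => ?_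
    rw [timeDeriv_add hT.1 hφ.contDiffOn hεη.contDiffOn hp.1,
      timeDeriv_const_mul hT.1 ε hη.contDiffOn hp.1]
    ring
  have e3 : ∫ x, ((φ 0 x + ε * η 0 x) * rho U 0 x - (φ T x + ε * η T x) * rho U T x)
      = (∫ x, (φ 0 x * rho U 0 x - φ T x * rho U T x))
        + ε * ∫ x, (η 0 x * rho U 0 x - η T x * rho U T x) := by
    rw [← integral_const_mul]
    refine Eq.trans ?_ (integral_add (hφ.initial.sub hφ.final)
      ((hη.initial.sub hη.final).const_mul ε))
    refine integral_congr_ae (Eventually.of_forall fun x => ?_)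
    simp only
    ring
  rw [e1, e2, e3]
  ring

/-- Test functions of time and space. -/
def IsSpaceTimeTest (η : ℝ → E d → ℝ) : Prop :=
  ContDiff ℝ (⊤ : ℕ∞) (fun p : ℝ × E d => η p.1 p.2) ∧
    HasCompactSupport fun p : ℝ × E d => η p.1 p.2

theorem IsSpaceTimeTest.contDiff_one {η : ℝ → E d → ℝ} (h : IsSpaceTimeTest η) :
    ContDiff ℝ 1 (fun p : ℝ × E d => η p.1 p.2) :=
  h.1.of_le (by exact_mod_cast le_top)

theorem IsSpaceTimeTest.exists_radius {η : ℝ → E d → ℝ} (h : IsSpaceTimeTest η) :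
    ∃ R, ∀ t x, R < ‖x‖ → η t x = 0 := by
  obtain ⟨R, hR⟩ := h.2.isCompact.isBounded.subset_closedBall (0 : ℝ × E d)
  refine ⟨R, fun t x hx => ?_⟩
  by_contra h0
  have h1 := hR (subset_tsupport _ (show (t, x) ∈ Function.support _ from h0))
  rw [mem_closedBall_zero_iff] at h1
  exact absurd ((norm_snd_le (t, x)).trans h1) (not_le.2 hx)

theorem IsSpaceTimeTest.isTest {η : ℝ → E d → ℝ} (h : IsSpaceTimeTest η) (t : ℝ) :
    IsTest (η t) := by
  obtain ⟨R, hR⟩ := h.exists_radius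
  exact ⟨h.1.comp (f := fun x : E d => (t, x)) (contDiff_prodMk_right t),
    hasCompactSupport_of_norm_gt (hR t)⟩

theorem IsSpaceTimeTest.mul {c : ℝ → ℝ} {h : E d → ℝ} (hc : ContDiff ℝ (⊤ : ℕ∞) c)
    (hcs : HasCompactSupport c) (hh : IsTest h) : IsSpaceTimeTest fun t x => c t * h x := by
  refine ⟨(hc.comp contDiff_fst).mul (hh.1.comp contDiff_snd), ?_⟩
  refine HasCompactSupport.intro (hcs.isCompact.prod hh.2.isCompact) fun p hp => ?_
  by_cases h1 : p.1 ∈ tsupport c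
  · exact mul_eq_zero_of_right _ (image_eq_zero_of_notMem_tsupport fun h2 => hp ⟨h1, h2⟩)
  · exact mul_eq_zero_of_left (image_eq_zero_of_notMem_tsupport h1) _

theorem timeDeriv_eq_zero_of_norm_gt (hT : 0 < T) {θ : ℝ → E d → ℝ} {R : ℝ}
    (hR : ∀ t ∈ Icc 0 T, ∀ x, R < ‖x‖ → θ t x = 0) {t : ℝ} (ht : t ∈ Icc 0 T) {x : E d}
    (hx : R < ‖x‖) : timeDeriv T θ t x = 0 :=
  timeDeriv_eq hT ht ((hasDerivWithinAt_const t (Icc 0 T) (0 : ℝ)).congr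
    (fun s hs => hR s hs x hx) (hR t ht x hx))

/-- The support is compact in `ℝ × ℝᵈ`, not inside the open slab: values at times `0` and `T` are
unrestricted. Their end-point terms cancel in the Euler–Lagrange equation. -/
theorem IsSpaceTimeTest.admissible {η : ℝ → E d → ℝ} (h : IsSpaceTimeTest η)
    (hU : IsPotentialPath U) (hT : T ∈ Ioc (0 : ℝ) 1) : Admissible U T η := by
  obtain ⟨R, hR⟩ := h.exists_radius
  have hc : ContDiffOn ℝ 1 (fun p : ℝ × E d => η p.1 p.2) (slab d T) := h.contDiff_one.contDiffOn
  have hρ := continuousOn_rho (d := d) hU hT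
  have hend : ∀ t ∈ Icc 0 T, Integrable fun x => η t x * rho U t x := fun t ht =>
    ((contDiff_slice hc ht).continuous.mul
      (continuous_rho hU (Icc_subset_unit hT ht))).integrable_of_hasCompactSupport
      (h.isTest t).2.mul_right
  refine ⟨hc, fun t _ => (h.isTest t).contDiff (n := 2), ?_, ?_, hend 0 ⟨le_rfl, hT.1.le⟩,
    hend T ⟨hT.1.le, le_rfl⟩⟩
  · exact integrableOn_slab_of_continuousOn
      (((continuousOn_gradient hT.1 hc).norm.pow 2).mul hρ) R
      fun t ht x hx => by simp [gradient_eq_zero_of_norm_gt (hR t) hx]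
  · exact integrableOn_slab_of_continuousOn ((continuousOn_timeDeriv hT.1 hc).mul hρ) R
      fun t ht x hx => by
        simp [timeDeriv_eq_zero_of_norm_gt hT.1 (fun t _ => hR t) ht hx]

theorem IsSpaceTimeTest.integrableOn_mul {η : ℝ → E d → ℝ} (h : IsSpaceTimeTest η)
    {f : ℝ × E d → ℝ} (hf : ContinuousOn f (slab d T)) :
    IntegrableOn (fun p : ℝ × E d => η p.1 p.2 * f p) (slab d T) := by
  obtain ⟨R, hR⟩ := h.exists_radius
  exact integrableOn_slab_of_continuousOn (h.contDiff_one.continuous.continuousOn.mul hf) R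
    fun t _ x hx => by simp [hR t x hx]

/-- The Euler–Lagrange equation of the action-matching functional, tested in time and space. -/
theorem IsMinimizer.eulerLagrange (hU : IsPotentialPath U) (hT : T ∈ Ioc (0 : ℝ) 1)
    {φ η : ℝ → E d → ℝ} (hφ : IsMinimizer U T φ) (hη : IsSpaceTimeTest η) :
    ∫ p in slab d T, inner ℝ (gradient (φ p.1) p.2) (gradient (η p.1) p.2) * rho U p.1 p.2
      = ∫ p in slab d T, η p.1 p.2 * timeDeriv 1 (rho U) p.1 p.2 := by
  have hηa := hη.admissible hU hT
  have h1 := setIntegral_timeDeriv_mul_rho hU hT hηa.contDiffOn hηa.timeDeriv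
    (hη.integrableOn_mul (continuousOn_timeDeriv_rho hU hT))
  -- The increment of the functional is a quadratic in `ε`, nonnegative for all real `ε` and without
  -- constant term. Its discriminant is the square of the linear coefficient, which must therefore
  -- vanish.
  have hq : ∀ ε : ℝ, 0 ≤ (1 / 2 * ∫ p in slab d T, ‖gradient (η p.1) p.2‖ ^ 2 * rho U p.1 p.2)
      * (ε * ε) + ((∫ p in slab d T, inner ℝ (gradient (φ p.1) p.2) (gradient (η p.1) p.2)
          * rho U p.1 p.2)
        + (∫ p in slab d T, timeDeriv T η p.1 p.2 * rho U p.1 p.2)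
        + ∫ x, (η 0 x * rho U 0 x - η T x * rho U T x)) * ε + 0 := by
    intro ε
    have h2 := hφ.2 _ (hφ.1.add hU hT (hηa.const_mul hT ε))
    rw [actionLoss_add_const_mul hU hT hφ.1 hηa ε] at h2
    linarith
  have h3 := discrim_le_zero hq
  rw [discrim, mul_zero, sub_zero] at h3
  have h4 := pow_eq_zero_iff two_ne_zero |>.1 (le_antisymm h3 (sq_nonneg _))
  rw [integral_sub hηa.final hηa.initial] at h1
  rw [integral_sub hηa.initial hηa.final] at h4
  linarith

/-- The fundamental lemma of the calculus of variations, applied to `a` extended by zero. Continuity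
upgrades the conclusion from almost every time to all of `[0, T]`, end points included. -/
theorem eq_zero_of_forall_integral_mul_eq_zero {a : ℝ → ℝ} (hT : 0 < T)
    (ha : ContinuousOn a (Icc 0 T))
    (h : ∀ c : ℝ → ℝ, ContDiff ℝ (⊤ : ℕ∞) c → HasCompactSupport c →
      ∫ t in Icc 0 T, c t * a t = 0) : ∀ t ∈ Icc 0 T, a t = 0 := by
  have hi : IntegrableOn a (Icc 0 T) := ha.integrableOn_compact isCompact_Icc
  have h1 := ae_eq_zero_of_integral_contDiff_smul_eq_zero (μ := volume)
    ((integrable_indicator_iff measurableSet_Icc).2 hi).locallyIntegrable fun c hc hcs => by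
      have := h c hc hcs
      rw [← integral_indicator measurableSet_Icc] at this
      refine (integral_congr_ae (Eventually.of_forall fun t => ?_)).trans this
      by_cases ht : t ∈ Icc 0 T <;> simp only [indicator, ht, if_true, if_false, smul_eq_mul,
        mul_zero]
  have h2 : a =ᵐ[volume.restrict (Icc 0 T)] fun _ => 0 := by
    rw [Filter.EventuallyEq, ae_restrict_iff' measurableSet_Icc]
    filter_upwards [h1] with t ht htm
    simpa [htm] using ht
  exact Measure.eqOn_Icc_of_ae_eq volume hT.ne h2 ha continuousOn_const

/-- The Euler–Lagrange equation is tested with products `c(t) h(x)`: varying `c` isolates each time,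
then varying `h` isolates each point. -/
theorem IsMinimizer.solvesTransport (hU : IsPotentialPath U) (hT : T ∈ Ioc (0 : ℝ) 1)
    {φ : ℝ → E d → ℝ} (hφ : IsMinimizer U T φ) {t : ℝ} (ht : t ∈ Icc 0 T) :
    SolvesTransport U t (gradient (φ t)) := by
  have hgφ := continuousOn_gradient hT.1 hφ.1.contDiffOn
  have hρ := continuousOn_rho (d := d) hU hT
  have hρt := continuousOn_timeDeriv_rho (d := d) hU hT
  have hweak : ∀ h : E d → ℝ, IsTest h → ∀ s ∈ Icc 0 T,
      ∫ x, inner ℝ (gradient (φ s) x) (gradient h x) * rho U s x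
        = ∫ x, h x * timeDeriv 1 (rho U) s x := by
    intro h hh s hs
    have c1 : ContinuousOn (fun p : ℝ × E d =>
        inner ℝ (gradient (φ p.1) p.2) (gradient h p.2) * rho U p.1 p.2) (slab d T) :=
      (hgφ.inner ((continuous_gradient hh.contDiff_one).comp
        continuous_snd).continuousOn).mul hρ
    have c2 : ContinuousOn (fun p : ℝ × E d => h p.2 * timeDeriv 1 (rho U) p.1 p.2) (slab d T) :=
      (hh.contDiff_one.continuous.comp continuous_snd).continuousOn.mul hρt
    -- Both sides of the weak equation depend continuously on time, because `h` has compact support;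
    -- this is what gives the equation at every time.
    have a1 := continuousOn_integral_of_compact_support (μ := volume)
      (f := fun t x => inner ℝ (gradient (φ t) x) (gradient h x) * rho U t x)
      (hasCompactSupport_gradient hh.2).isCompact c1 fun p x _ hx => by
        simp [image_eq_zero_of_notMem_tsupport hx]
    have a2 := continuousOn_integral_of_compact_support (μ := volume)
      (f := fun t x => h x * timeDeriv 1 (rho U) t x) hh.2.isCompact c2 fun p x _ hx => by
        simp [image_eq_zero_of_notMem_tsupport hx]
    refine sub_eq_zero.1 (eq_zero_of_forall_integral_mul_eq_zero hT.1 (a1.sub a2)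
      (fun c hc hcs => ?_) s hs)
    have hη := IsSpaceTimeTest.mul hc hcs hh
    have hηa := hη.admissible hU hT
    have i1 : IntegrableOn (fun p : ℝ × E d => inner ℝ (gradient (φ p.1) p.2)
        (gradient (fun y => c p.1 * h y) p.2) * rho U p.1 p.2) (slab d T) :=
      integrable_inner_mul (aestronglyMeasurable_rho hU hT) (ae_rho_nonneg hU hT)
        (aestronglyMeasurable_slab hgφ)
        (aestronglyMeasurable_slab
          (continuousOn_gradient (θ := fun t x => c t * h x) hT.1 hηa.contDiffOn))
        hφ.1.gradient_sq hηa.gradient_sq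
    have i2 : IntegrableOn (fun p : ℝ × E d => c p.1 * h p.2 * timeDeriv 1 (rho U) p.1 p.2)
        (slab d T) := hη.integrableOn_mul hρt
    have h1 := hφ.eulerLagrange hU hT hη
    rw [← sub_eq_zero, setIntegral_slab hT.1.le i1,
      setIntegral_slab hT.1.le i2,
      intervalIntegral.integral_of_le hT.1.le, intervalIntegral.integral_of_le hT.1.le,
      ← integral_Icc_eq_integral_Ioc, ← integral_Icc_eq_integral_Ioc,
      ← integral_sub (integrableOn_integral_slice i1)
        (integrableOn_integral_slice i2)] at h1
    refine Eq.trans (integral_congr_ae (Eventually.of_forall fun r => ?_)) h1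
    simp only [Pi.sub_apply]
    rw [mul_sub, ← integral_const_mul, ← integral_const_mul]
    congr 1
    · refine integral_congr_ae (Eventually.of_forall fun x => ?_)
      simp only
      rw [gradient_const_mul _ (hh.contDiff_one.differentiable one_ne_zero _), inner_smul_right]
      ring
    · refine integral_congr_ae (Eventually.of_forall fun x => ?_)
      simp only
      ring
  have ht1 := Icc_subset_unit hT ht
  have hb := contDiff_gradient (hφ.1.contDiff t ht)
  -- Here `C²` regularity in space is needed: the divergence is continuous, so its almost everywhere
  -- equality with `-∂_t ρ` holds at every point.
  have hdiv : Continuous (divergence fun y => rho U t y • gradient (φ t) y) :=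
    continuous_divergence ((contDiff_slice (contDiffOn_rho hU) ht1).smul hb)
  have hcont : Continuous fun x => divergence (fun y => rho U t y • gradient (φ t) y) x
      + timeDeriv 1 (rho U) t x := hdiv.add (continuous_timeDeriv_rho hU ht1)
  have h0 := ae_eq_zero_of_integral_contDiff_smul_eq_zero (μ := volume)
    hcont.locallyIntegrable fun h hh hc => by
      have h2 := hweak h ⟨hh, hc⟩ t ht
      have hhc : Continuous h := hh.continuous
      rw [integral_inner_gradient_rho hU ht1 hb (IsTest.contDiff_one ⟨hh, hc⟩) hc] at h2
      simp_rw [smul_eq_mul, mul_add]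
      refine (integral_add ((hhc.mul hdiv).integrable_of_hasCompactSupport hc.mul_right)
        ((hhc.mul (continuous_timeDeriv_rho hU ht1)).integrable_of_hasCompactSupport
          hc.mul_right)).trans ?_
      simp only [Pi.mul_apply]
      rw [← h2]
      exact add_neg_cancel _
  have h3 := (hcont.ae_eq_iff_eq volume continuous_const (g := fun _ => 0)).1 h0
  intro x
  exact eq_neg_of_add_eq_zero_left (congrFun h3 x)

/-- Necessity is the Euler–Lagrange equation. For sufficiency the square is completed with `b = ∇φ`:
it vanishes at `φ` and is nonnegative elsewhere. -/
theorem isMinimizer_iff_solvesTransport (hU : IsPotentialPath U) (hT : T ∈ Ioc (0 : ℝ) 1)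
    {φ : ℝ → E d → ℝ} (hφ : Admissible U T φ) :
    IsMinimizer U T φ ↔ ∀ t ∈ Icc 0 T, SolvesTransport U t (gradient (φ t)) := by
  refine ⟨fun h t ht => h.solvesTransport hU hT ht, fun h => ⟨hφ, fun ψ hψ => ?_⟩⟩
  have hb := isWeakVelocity_of_solvesTransport hU hT hφ h
  rw [hb.actionLoss_eq hU hT hφ, hb.actionLoss_eq hU hT hψ]
  have : 0 ≤ ∫ p in slab d T, ‖gradient (ψ p.1) p.2 - gradient (φ p.1) p.2‖ ^ 2
      * rho U p.1 p.2 :=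
    integral_nonneg_of_ae ((ae_rho_nonneg hU hT).mono fun p hp => mul_nonneg (sq_nonneg _) hp)
  simp only [sub_self, norm_zero, ne_eq, OfNat.ofNat_ne_zero, not_false_eq_true, zero_pow,
    zero_mul, integral_zero, mul_zero]
  linarith

theorem setIntegral_sq_mul_rho_eq_zero_iff {F : Type*} [NormedAddCommGroup F]
    (hU : IsPotentialPath U) (hT : T ∈ Ioc (0 : ℝ) 1) {v : ℝ × E d → F}
    (hv : IntegrableOn (fun p => ‖v p‖ ^ 2 * rho U p.1 p.2) (slab d T)) :
    ∫ p in slab d T, ‖v p‖ ^ 2 * rho U p.1 p.2 = 0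
      ↔ ∀ᵐ p ∂volume.restrict (slab d T), v p = 0 := by
  rw [integral_eq_zero_iff_of_nonneg_ae
    ((ae_rho_nonneg hU hT).mono fun p hp => mul_nonneg (sq_nonneg _) hp) hv]
  have hm : ∀ᵐ p ∂(volume : Measure (ℝ × E d)).restrict (slab d T), 0 < rho U p.1 p.2 :=
    (ae_restrict_mem measurableSet_slab).mono fun p hp => rho_pos' hU hT hp.1 p.2
  constructor
  · intro h
    filter_upwards [h, hm] with p hp hr
    simpa [hr.ne'] using hp
  · intro h
    filter_upwards [h] with p hp
    simp [hp]

/-- Lets almost everywhere identities between continuous functions be extended to the whole slab,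
including times `0` and `T`; a degenerate interval would not do. -/
theorem slab_subset_closure_interior (hT : 0 < T) : slab d T ⊆ closure (interior (slab d T)) := by
  rw [interior_prod_eq, interior_Icc, interior_univ, closure_prod_eq, closure_Ioo hT.ne,
    closure_univ]

theorem IsMinimizer.isMinimizer_iff (hU : IsPotentialPath U) (hT : T ∈ Ioc (0 : ℝ) 1)
    {φ ψ : ℝ → E d → ℝ} (hφ : IsMinimizer U T φ) (hψ : Admissible U T ψ) :
    IsMinimizer U T ψ ↔ ∃ c : ℝ → ℝ, ∀ t ∈ Icc 0 T, ∀ x, ψ t x = φ t x + c t := by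
  constructor
  · intro h
    have hb := isWeakVelocity_of_solvesTransport hU hT hφ.1
      ((isMinimizer_iff_solvesTransport hU hT hφ.1).1 hφ)
    have hle := h.2 φ hφ.1
    rw [hb.actionLoss_eq hU hT hφ.1, hb.actionLoss_eq hU hT hψ] at hle
    simp only [sub_self, norm_zero, ne_eq, OfNat.ofNat_ne_zero, not_false_eq_true, zero_pow,
      zero_mul, integral_zero, mul_zero] at hle
    have hcψ := continuousOn_gradient hT.1 hψ.contDiffOn
    have hcφ := continuousOn_gradient hT.1 hφ.1.contDiffOn
    have hint := integrable_sub_sq_mul (aestronglyMeasurable_rho hU hT) (ae_rho_nonneg hU hT)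
      (aestronglyMeasurable_slab hcψ) (aestronglyMeasurable_slab hcφ) hψ.gradient_sq
      hφ.1.gradient_sq
    have hnn : 0 ≤ ∫ p in slab d T, ‖gradient (ψ p.1) p.2 - gradient (φ p.1) p.2‖ ^ 2
        * rho U p.1 p.2 :=
      integral_nonneg_of_ae ((ae_rho_nonneg hU hT).mono fun p hp => mul_nonneg (sq_nonneg _) hp)
    have h0 := (setIntegral_sq_mul_rho_eq_zero_iff hU hT hint).1 (by linarith)
    have hEq : EqOn (fun p : ℝ × E d => gradient (ψ p.1) p.2 - gradient (φ p.1) p.2)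
        (fun _ => 0) (slab d T) :=
      Measure.eqOn_of_ae_eq h0 (hcψ.sub hcφ) continuousOn_const
        (slab_subset_closure_interior hT.1)
    refine ⟨fun t => ψ t 0 - φ t 0, fun t ht x => ?_⟩
    have hdψ := contDiff_slice hψ.contDiffOn ht
    have hdφ := contDiff_slice hφ.1.contDiffOn ht
    have := eq_of_gradient_eq_zero (hdψ.sub hdφ) (fun y => (gradient_sub
      (hdψ.differentiable one_ne_zero y) (hdφ.differentiable one_ne_zero y)).trans
      (hEq (mem_slab ht y))) x 0
    linarith
  · rintro ⟨c, hc⟩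
    rw [isMinimizer_iff_solvesTransport hU hT hψ]
    intro t ht
    have : ψ t = fun x => φ t x + c t := funext (hc t ht)
    rw [this, gradient_add_const]
    exact hφ.solvesTransport hU hT ht

end Classical

/-! ### Convergence in weighted `L²` spaces -/

section WeightedConvergence

variable {α F : Type*} [MeasurableSpace α] {μ : Measure α} [NormedAddCommGroup F]
  [InnerProductSpace ℝ F] {w : α → ℝ} {u v : α → F}

/-- Cauchy–Schwarz, from the discriminant of the nonnegative quadratic `s ↦ ∫ ‖s u - v‖² w`. -/
theorem sq_integral_inner_mul_le (hw : AEStronglyMeasurable w μ) (hw0 : ∀ᵐ p ∂μ, 0 ≤ w p)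
    (hu : AEStronglyMeasurable u μ) (hv : AEStronglyMeasurable v μ)
    (hu2 : Integrable (fun p => ‖u p‖ ^ 2 * w p) μ)
    (hv2 : Integrable (fun p => ‖v p‖ ^ 2 * w p) μ) :
    (∫ p, inner ℝ (u p) (v p) * w p ∂μ) ^ 2
      ≤ (∫ p, ‖u p‖ ^ 2 * w p ∂μ) * ∫ p, ‖v p‖ ^ 2 * w p ∂μ := by
  have hq : ∀ s : ℝ, 0 ≤ (∫ p, ‖u p‖ ^ 2 * w p ∂μ) * (s * s)
      + (-2 * ∫ p, inner ℝ (u p) (v p) * w p ∂μ) * s + ∫ p, ‖v p‖ ^ 2 * w p ∂μ := by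
    intro s
    have hs2 : Integrable (fun p => ‖s • u p‖ ^ 2 * w p) μ := by
      simpa only [norm_smul, mul_pow, mul_assoc] using hu2.const_mul (‖s‖ ^ 2)
    have h := integral_sub_sq_mul hw hw0 (hu.const_smul s) hv hs2 hv2
    have h0 : 0 ≤ ∫ p, ‖(s • u) p - v p‖ ^ 2 * w p ∂μ :=
      integral_nonneg_of_ae (hw0.mono fun p hp => mul_nonneg (sq_nonneg _) hp)
    rw [h] at h0
    simp only [Pi.smul_apply, norm_smul, mul_pow, inner_smul_left, conj_trivial, mul_assoc,
      integral_const_mul, Real.norm_eq_abs, sq_abs] at h0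
    linarith
  have h := discrim_le_zero hq
  rw [discrim] at h
  linarith

theorem tendsto_integral_inner_mul {un : ℕ → α → F} (hw : AEStronglyMeasurable w μ)
    (hw0 : ∀ᵐ p ∂μ, 0 ≤ w p) (hv : AEStronglyMeasurable v μ)
    (hun : ∀ n, AEStronglyMeasurable (un n) μ) (hu : AEStronglyMeasurable u μ)
    (hv2 : Integrable (fun p => ‖v p‖ ^ 2 * w p) μ)
    (hun2 : ∀ n, Integrable (fun p => ‖un n p‖ ^ 2 * w p) μ)
    (hu2 : Integrable (fun p => ‖u p‖ ^ 2 * w p) μ)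
    (h : Tendsto (fun n => ∫ p, ‖un n p - u p‖ ^ 2 * w p ∂μ) atTop (𝓝 0)) :
    Tendsto (fun n => ∫ p, inner ℝ (v p) (un n p) * w p ∂μ) atTop
      (𝓝 (∫ p, inner ℝ (v p) (u p) * w p ∂μ)) := by
  rw [tendsto_iff_norm_sub_tendsto_zero]
  have h1 : Tendsto (fun n => √((∫ p, ‖v p‖ ^ 2 * w p ∂μ)
      * ∫ p, ‖un n p - u p‖ ^ 2 * w p ∂μ)) atTop (𝓝 0) := by
    simpa using (h.const_mul (∫ p, ‖v p‖ ^ 2 * w p ∂μ)).sqrt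
  refine squeeze_zero (fun n => norm_nonneg _) (fun n => ?_) h1
  rw [← integral_sub (integrable_inner_mul hw hw0 hv (hun n) hv2 (hun2 n))
    (integrable_inner_mul hw hw0 hv hu hv2 hu2)]
  simp_rw [← sub_mul, ← inner_sub_right]
  refine Real.abs_le_sqrt ?_
  exact sq_integral_inner_mul_le hw hw0 hv ((hun n).sub hu) hv2
    (integrable_sub_sq_mul hw hw0 (hun n) hu (hun2 n) hu2)

theorem tendsto_integral_sq_mul {un : ℕ → α → F} (hw : AEStronglyMeasurable w μ)
    (hw0 : ∀ᵐ p ∂μ, 0 ≤ w p)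
    (hun : ∀ n, AEStronglyMeasurable (un n) μ) (hu : AEStronglyMeasurable u μ)
    (hun2 : ∀ n, Integrable (fun p => ‖un n p‖ ^ 2 * w p) μ)
    (hu2 : Integrable (fun p => ‖u p‖ ^ 2 * w p) μ)
    (h : Tendsto (fun n => ∫ p, ‖un n p - u p‖ ^ 2 * w p ∂μ) atTop (𝓝 0)) :
    Tendsto (fun n => ∫ p, ‖un n p‖ ^ 2 * w p ∂μ) atTop (𝓝 (∫ p, ‖u p‖ ^ 2 * w p ∂μ)) := by
  have h1 := tendsto_integral_inner_mul hw hw0 hu hun hu hu2 hun2 hu2 h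
  have h2 : ∀ n, ∫ p, ‖un n p‖ ^ 2 * w p ∂μ = (∫ p, ‖un n p - u p‖ ^ 2 * w p ∂μ)
      + 2 * (∫ p, inner ℝ (u p) (un n p) * w p ∂μ) - ∫ p, ‖u p‖ ^ 2 * w p ∂μ := by
    intro n
    rw [integral_sub_sq_mul hw hw0 (hun n) hu (hun2 n) hu2]
    simp_rw [real_inner_comm]
    ring
  simp_rw [h2]
  have h3 := (h.add (h1.const_mul 2)).sub_const (∫ p, ‖u p‖ ^ 2 * w p ∂μ)
  convert h3 using 2
  simp_rw [real_inner_self_eq_norm_sq]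
  ring

end WeightedConvergence

/-! ### Mollification -/

section Mollification

variable {d : ℕ} {F : Type*} [NormedAddCommGroup F]

/-- Jensen's inequality for the square, as Hölder's inequality against the constant `1` on a space
of mass one. -/
theorem sq_lintegral_le {α : Type*} [MeasurableSpace α] {ν : Measure α} [IsProbabilityMeasure ν]
    {k : α → ℝ≥0∞} (hk : AEMeasurable k ν) : (∫⁻ y, k y ∂ν) ^ 2 ≤ ∫⁻ y, k y ^ 2 ∂ν := by
  have h := ENNReal.lintegral_mul_le_Lp_mul_Lq ν Real.HolderConjugate.two_two hk
    (aemeasurable_const (b := 1))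
  simp only [Pi.mul_apply, mul_one, ENNReal.one_rpow, lintegral_const, measure_univ] at h
  calc (∫⁻ y, k y ∂ν) ^ 2 ≤ ((∫⁻ y, k y ^ (2 : ℝ) ∂ν) ^ (1 / 2 : ℝ)) ^ 2 := by gcongr
    _ = ∫⁻ y, k y ^ 2 ∂ν := by
      rw [← ENNReal.rpow_natCast, ← ENNReal.rpow_mul]
      simp

theorem lintegral_enorm_sq_eq {α : Type*} [MeasurableSpace α] {μ : Measure α} (f : α → F) :
    ∫⁻ x, ‖f x‖ₑ ^ 2 ∂μ = eLpNorm f 2 μ ^ 2 := by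
  rw [eLpNorm_eq_lintegral_rpow_enorm_toReal two_ne_zero ENNReal.ofNat_ne_top,
    ← ENNReal.rpow_natCast, ← ENNReal.rpow_mul]
  simp

/-- Translations act continuously on `L²`. The sign in `DomAddAct.mk (-y)` matches the translate `f
(x - y)` that occurs in a convolution. -/
theorem exists_eLpNorm_translate_sub_le {f : E d → F} (hf : MemLp f 2) {ε : ℝ≥0∞} (hε : 0 < ε) :
    ∃ δ > 0, ∀ y : E d, ‖y‖ < δ → eLpNorm (fun x => f (x - y) - f x) 2 ≤ ε := by
  have : Fact ((2 : ℝ≥0∞) ≠ ∞) := ⟨ENNReal.ofNat_ne_top⟩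
  have hc : Continuous fun y : (E d)ᵈᵃᵃ => y +ᵥ hf.toLp f :=
    continuous_id.vadd continuous_const
  have hc' : Continuous fun y : E d => DomAddAct.mk (-y) +ᵥ hf.toLp f :=
    hc.comp (DomAddAct.continuous_mk.comp continuous_neg)
  have h0 := hc'.tendsto 0
  rw [EMetric.tendsto_nhds] at h0
  have h1 := h0 ε hε
  rw [Metric.eventually_nhds_iff] at h1
  obtain ⟨δ, hδ, h⟩ := h1
  refine ⟨δ, hδ, fun y hy => ?_⟩
  have h2 := (h (by simpa using hy)).le
  simp only [neg_zero, DomAddAct.mk_zero, zero_vadd] at h2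
  rw [DomAddAct.mk_vadd_toLp, Lp.edist_toLp_toLp] at h2
  refine le_trans (le_of_eq ?_) h2
  congr 1
  ext x
  simp [sub_eq_neg_add]

variable [NormedSpace ℝ F]

/-- Mollifications of a square integrable function converge to it. -/
theorem exists_eLpNorm_convolution_sub_le [CompleteSpace F] {f : E d → F} (hf : MemLp f 2)
    {ε : ℝ≥0∞} (hε : 0 < ε) :
    ∃ δ > 0, ∀ φ : ContDiffBump (0 : E d), φ.rOut < δ →
      eLpNorm (φ.normed volume ⋆[ContinuousLinearMap.lsmul ℝ ℝ, volume] f - f) 2 ≤ ε := by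
  obtain ⟨δ, hδ, h⟩ := exists_eLpNorm_translate_sub_le hf hε
  refine ⟨δ, hδ, fun φ hφ => ?_⟩
  let g : E d → ℝ := φ.normed volume
  have hg0 : ∀ y, 0 ≤ g y := φ.nonneg_normed
  have hgc : Continuous g := φ.continuous_normed
  have hgi : Integrable g := φ.integrable_normed
  have hg1 : ∫ y, g y = 1 := φ.integral_normed
  have hgm : Measurable fun y => ENNReal.ofReal (g y) := hgc.measurable.ennreal_ofReal
  -- The mollifier is viewed as a probability measure, so that the convolution minus `f` is an
  -- average of the differences `f (x - y) - f x`. Jensen and Fubini bound its `L²` norm by that of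
  -- small translations.
  let ν : Measure (E d) := volume.withDensity fun y => ENNReal.ofReal (g y)
  have hν : IsProbabilityMeasure ν := ⟨by
    rw [withDensity_apply _ MeasurableSet.univ, Measure.restrict_univ,
      ← ofReal_integral_eq_lintegral_ofReal hgi (Eventually.of_forall hg0), hg1,
      ENNReal.ofReal_one]⟩
  have hac : ν ≪ volume := withDensity_absolutelyContinuous _ _
  have hint : ∀ k : E d → ℝ≥0∞, ∫⁻ y, k y ∂ν = ∫⁻ y, ENNReal.ofReal (g y) * k y := fun k =>
    lintegral_withDensity_eq_lintegral_mul_non_measurable _ hgm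
      (Eventually.of_forall fun _ => ENNReal.ofReal_lt_top) k
  have hsub : Measure.QuasiMeasurePreserving (fun p : E d × E d => p.1 - p.2)
      (volume.prod ν) volume :=
    (quasiMeasurePreserving_sub_of_right_invariant volume volume).mono_left
      (Measure.AbsolutelyContinuous.rfl.prod hac)
  have hkm : AEStronglyMeasurable (fun p : E d × E d => f (p.1 - p.2) - f p.1)
      (volume.prod ν) :=
    (hf.1.comp_quasiMeasurePreserving hsub).sub hf.1.comp_fst
  have hloc : LocallyIntegrable f := hf.locallyIntegrable one_le_two
  have hpt : ∀ x, ‖(g ⋆[ContinuousLinearMap.lsmul ℝ ℝ, volume] f - f) x‖ₑ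
      ≤ ∫⁻ y, ‖f (x - y) - f x‖ₑ ∂ν := by
    intro x
    have i1 : Integrable fun y => g y • f (x - y) :=
      (φ.hasCompactSupport_normed.convolutionExists_left (ContinuousLinearMap.lsmul ℝ ℝ)
        hgc hloc x).integrable
    have i2 : Integrable fun y => g y • f x := hgi.smul_const _
    rw [Pi.sub_apply, convolution_lsmul, hint]
    have e : (∫ y, g y • f (x - y)) - f x = ∫ y, g y • (f (x - y) - f x) := by
      simp_rw [smul_sub]
      rw [integral_sub i1 i2, integral_smul_const, hg1, one_smul]
    rw [e]
    refine (enorm_integral_le_lintegral_enorm _).trans (le_of_eq ?_)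
    refine lintegral_congr fun y => ?_
    rw [enorm_smul, Real.enorm_eq_ofReal (hg0 y)]
  have hfin : eLpNorm (g ⋆[ContinuousLinearMap.lsmul ℝ ℝ, volume] f - f) 2 volume ^ 2
      ≤ ε ^ 2 := by
    rw [← lintegral_enorm_sq_eq]
    calc ∫⁻ x, ‖(g ⋆[ContinuousLinearMap.lsmul ℝ ℝ, volume] f - f) x‖ₑ ^ 2
        ≤ ∫⁻ x, ∫⁻ y, ‖f (x - y) - f x‖ₑ ^ 2 ∂ν := by
          refine lintegral_mono_ae ?_
          filter_upwards [hkm.prodMk_left] with x hx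
          exact (pow_le_pow_left' (hpt x) 2).trans (sq_lintegral_le hx.enorm)
      _ = ∫⁻ y, (∫⁻ x, ‖f (x - y) - f x‖ₑ ^ 2) ∂ν :=
          lintegral_lintegral_swap (hkm.enorm.pow_const 2)
      _ ≤ ∫⁻ _, ε ^ 2 ∂ν := by
          refine lintegral_mono_ae ?_
          -- Only `y` in the support of the mollifier count for `ν`, and these satisfy `‖y‖ < δ`.
          rw [ae_withDensity_iff hgm]
          refine Eventually.of_forall fun y hy => ?_
          have hy' : y ∈ Function.support (φ.normed volume) := by
            intro h0
            exact hy (by simp [g, h0])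
          rw [φ.support_normed_eq, mem_ball_zero_iff] at hy'
          rw [lintegral_enorm_sq_eq]
          gcongr
          exact h y (hy'.trans hφ)
      _ = ε ^ 2 := by simp
  exact (ENNReal.pow_le_pow_left_iff two_ne_zero).1 hfin

end Mollification

/-! ### Weak gradients and weighted Sobolev spaces -/

section Sobolev

variable {d : ℕ} {F : Type*} [NormedAddCommGroup F]

theorem exists_lower_bound {w : E d → ℝ} (hw : Continuous w) (hw0 : ∀ x, 0 < w x) {K : Set (E d)}
    (hK : IsCompact K) : ∃ c > 0, ∀ x ∈ K, c ≤ w x := by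
  rcases K.eq_empty_or_nonempty with rfl | hne
  · exact ⟨1, one_pos, by simp⟩
  · obtain ⟨x, -, hx⟩ := hK.exists_isMinOn hne hw.continuousOn
    exact ⟨w x, hw0 x, fun y hy => hx hy⟩

/-- A continuous positive weight is bounded below by some `c > 0` on each compact set, and `‖u‖ ≤ 1
+ ‖u‖² ≤ 1 + c⁻¹ ‖u‖² w` there. -/
theorem locallyIntegrable_of_weighted {w : E d → ℝ} (hw : Continuous w) (hw0 : ∀ x, 0 < w x)
    {u : E d → F} (hu : AEStronglyMeasurable u)
    (hu2 : Integrable fun x => ‖u x‖ ^ 2 * w x) : LocallyIntegrable u := by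
  rw [locallyIntegrable_iff]
  intro K hK
  obtain ⟨c, hc, hcK⟩ := exists_lower_bound hw hw0 hK
  have h1 : IntegrableOn (fun _ : E d => (1 : ℝ)) K := integrableOn_const hK.measure_lt_top.ne
  refine (h1.integrable.add (hu2.integrableOn.integrable.const_mul c⁻¹)).mono' hu.restrict ?_
  filter_upwards [ae_restrict_mem hK.measurableSet] with x hx
  have h2 : ‖u x‖ ^ 2 ≤ c⁻¹ * (‖u x‖ ^ 2 * w x) := by
    rw [le_inv_mul_iff₀ hc, mul_comm]
    exact mul_le_mul_of_nonneg_left (hcK x hx) (sq_nonneg _)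
  simp only [Pi.add_apply]
  nlinarith [sq_nonneg (‖u x‖ - 1)]

theorem memLp_two_of_weighted {w : E d → ℝ} (hw : Continuous w) (hw0 : ∀ x, 0 < w x)
    {u : E d → F} (hu : AEStronglyMeasurable u)
    (hu2 : Integrable fun x => ‖u x‖ ^ 2 * w x) {R : ℝ} (hR : ∀ x, R < ‖x‖ → u x = 0) :
    MemLp u 2 := by
  rw [memLp_two_iff_integrable_sq_norm hu]
  obtain ⟨c, hc, hcK⟩ := exists_lower_bound hw hw0 (isCompact_closedBall (0 : E d) R)
  refine (hu2.const_mul c⁻¹).mono' (hu.norm.pow 2) (Eventually.of_forall fun x => ?_)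
  rw [Real.norm_of_nonneg (sq_nonneg _), le_inv_mul_iff₀ hc, mul_comm]
  by_cases hx : R < ‖x‖
  · simp [hR x hx]
  · exact mul_le_mul_of_nonneg_left (hcK x (by simpa using hx)) (sq_nonneg _)

/-- The converse comparison: for bounded support an upper bound of the weight on one ball turns
unweighted into weighted convergence. -/
theorem integral_sq_mul_le_of_eLpNorm_le {w : E d → ℝ} (hw : Continuous w) (hw0 : ∀ x, 0 < w x)
    {M : ℝ} {u : E d → F} (hu : AEStronglyMeasurable u) {ε : ℝ} (hε : 0 ≤ ε)
    (h : eLpNorm u 2 volume ≤ ENNReal.ofReal ε) {R : ℝ} (hR : ∀ x, R < ‖x‖ → u x = 0)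
    (hM : ∀ x, ‖x‖ ≤ R → w x ≤ M) : ∫ x, ‖u x‖ ^ 2 * w x ≤ |M| * ε ^ 2 := by
  rw [integral_eq_lintegral_of_nonneg_ae
    (Eventually.of_forall fun x => mul_nonneg (sq_nonneg _) (hw0 x).le)
    ((hu.norm.pow 2).mul hw.aestronglyMeasurable)]
  refine ENNReal.toReal_le_of_le_ofReal (by positivity) ?_
  calc ∫⁻ x, ENNReal.ofReal (‖u x‖ ^ 2 * w x)
      ≤ ∫⁻ x, ENNReal.ofReal |M| * ‖u x‖ₑ ^ 2 := by
        refine lintegral_mono fun x => ?_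
        rw [← ofReal_norm, ← ENNReal.ofReal_pow (norm_nonneg _),
          ← ENNReal.ofReal_mul (abs_nonneg _), mul_comm]
        refine ENNReal.ofReal_le_ofReal ?_
        by_cases hx : R < ‖x‖
        · simp [hR x hx]
        · exact mul_le_mul_of_nonneg_right ((hM x (not_lt.1 hx)).trans (le_abs_self M))
            (sq_nonneg _)
    _ = ENNReal.ofReal |M| * eLpNorm u 2 volume ^ 2 := by
        rw [lintegral_const_mul' _ _ ENNReal.ofReal_ne_top, lintegral_enorm_sq_eq]
    _ ≤ ENNReal.ofReal |M| * ENNReal.ofReal ε ^ 2 := by gcongr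
    _ = ENNReal.ofReal (|M| * ε ^ 2) := by
        rw [ENNReal.ofReal_mul (abs_nonneg _), ENNReal.ofReal_pow hε]

theorem IsTest.mul {η χ : E d → ℝ} (hη : IsTest η) (hχ : IsTest χ) :
    IsTest fun x => η x * χ x := ⟨hη.1.mul hχ.1, hη.2.mul_right⟩

theorem IsTest.differentiableAt {η : E d → ℝ} (hη : IsTest η) (x : E d) :
    DifferentiableAt ℝ η x := hη.contDiff_one.differentiable one_ne_zero x

theorem IsTest.const_sub {η : E d → ℝ} (hη : IsTest η) (z : E d) : IsTest fun y => η (z - y) :=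
  ⟨hη.1.comp (contDiff_const.sub contDiff_id),
    hη.2.comp_homeomorph (Homeomorph.subLeft z)⟩

/-- The Leibniz rule passes to weak gradients because `η χ` is again a test function: the weak
identity for `ηχ`, with the product rule for its gradient, rearranges to the claim. -/
theorem HasWeakGradient.cutoff {f : E d → ℝ} {g : E d → E d} (h : HasWeakGradient f g)
    {χ : E d → ℝ} (hχ : IsTest χ) :
    HasWeakGradient (fun x => χ x * f x) (fun x => χ x • g x + f x • gradient χ x) := by
  have hχc := hχ.contDiff_one.continuous
  have hgχ := continuous_gradient hχ.contDiff_one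
  have i0 : Integrable fun x => χ x * f x :=
    h.1.integrable_smul_left_of_hasCompactSupport hχc hχ.2
  have i1 : Integrable fun x => χ x • g x :=
    h.2.1.integrable_smul_left_of_hasCompactSupport hχc hχ.2
  have i2 : Integrable fun x => f x • gradient χ x :=
    h.1.integrable_smul_right_of_hasCompactSupport hgχ (hasCompactSupport_gradient hχ.2)
  refine ⟨i0.locallyIntegrable, (i1.add i2).locallyIntegrable, fun η hη => ?_⟩
  have hηc := hη.contDiff_one.continuous
  have j1 : Integrable fun x => (η x * χ x) • g x :=
    h.2.1.integrable_smul_left_of_hasCompactSupport (hηc.mul hχc) (hη.mul hχ).2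
  have j2 : Integrable fun x => f x • (η x • gradient χ x) :=
    h.1.integrable_smul_right_of_hasCompactSupport (hηc.smul hgχ) hη.2.smul_right
  have j3 : Integrable fun x => f x • (χ x • gradient η x) :=
    h.1.integrable_smul_right_of_hasCompactSupport
      (hχc.smul (continuous_gradient hη.contDiff_one)) hχ.2.smul_right
  have key := h.2.2 _ (hη.mul hχ)
  have e1 : ∀ x, f x • gradient (fun y => η y * χ y) x
      = f x • (η x • gradient χ x) + f x • (χ x • gradient η x) := fun x => by
    rw [gradient_mul (hη.differentiableAt x) (hχ.differentiableAt x), smul_add]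
  simp_rw [e1] at key
  rw [integral_add j2 j3] at key
  have e2 : ∀ x, (χ x * f x) • gradient η x = f x • (χ x • gradient η x) := fun x => by
    rw [smul_smul, mul_comm]
  have e3 : ∀ x, η x • (χ x • g x + f x • gradient χ x)
      = (η x * χ x) • g x + f x • (η x • gradient χ x) := fun x => by
    rw [smul_add, smul_smul, smul_comm (η x)]
  simp_rw [e2, e3]
  rw [integral_add j1 j2, ← sub_eq_zero]
  rw [← sub_eq_zero] at key
  rw [← key]
  abel

/-- The mollification of a function with compact support is a test function. -/
theorem isTest_convolution {f : E d → ℝ} (hf : LocallyIntegrable f) (hfs : HasCompactSupport f)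
    (φ : ContDiffBump (0 : E d)) :
    IsTest (φ.normed volume ⋆[ContinuousLinearMap.lsmul ℝ ℝ, volume] f) :=
  ⟨φ.hasCompactSupport_normed.contDiff_convolution_left _ φ.contDiff_normed hf,
    φ.hasCompactSupport_normed.convolution _ hfs⟩

/-- Differentiation falls on the mollifier; the weak identity with the test function `y ↦ χ (x - y)`
then moves it to `f`. Reflection changes the sign of the gradient, which cancels the sign of the
integration by parts. -/
theorem gradient_convolution {f : E d → ℝ} {g : E d → E d} (h : HasWeakGradient f g)
    (φ : ContDiffBump (0 : E d)) (x : E d) :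
    gradient (φ.normed volume ⋆[ContinuousLinearMap.lsmul ℝ ℝ, volume] f) x
      = (φ.normed volume ⋆[ContinuousLinearMap.lsmul ℝ ℝ, volume] g) x := by
  let χ : E d → ℝ := φ.normed volume
  have hχ : IsTest χ := ⟨φ.contDiff_normed, φ.hasCompactSupport_normed⟩
  have hd := hχ.2.hasFDerivAt_convolution_left (ContinuousLinearMap.lsmul ℝ ℝ) hχ.contDiff_one
    h.1 x
  have hex := ((hχ.2.fderiv ℝ).convolutionExists_left
    ((ContinuousLinearMap.lsmul ℝ ℝ : ℝ →L[ℝ] ℝ →L[ℝ] ℝ).precompL (E d))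
    (hχ.contDiff_one.continuous_fderiv one_ne_zero) h.1 x).integrable_swap
  have key := h.2.2 _ (hχ.const_sub x)
  simp_rw [gradient_const_sub hχ.contDiff_one, smul_neg, integral_neg, neg_inj] at key
  rw [convolution_lsmul_swap]
  change _ = ∫ t, χ (x - t) • g t
  rw [← key]
  have i1 : Integrable fun y => f y • gradient χ (x - y) :=
    h.1.integrable_smul_right_of_hasCompactSupport
      ((continuous_gradient hχ.contDiff_one).comp (continuous_const.sub continuous_id))
      ((hasCompactSupport_gradient hχ.2).comp_homeomorph (Homeomorph.subLeft x))
  refine ext_inner_right ℝ fun v => ?_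
  rw [inner_gradient_left, hd.fderiv, convolution_eq_swap,
    ContinuousLinearMap.integral_apply hex, real_inner_comm, ← integral_inner i1]
  refine integral_congr_ae (Eventually.of_forall fun y => ?_)
  simp only [inner_smul_right, inner_gradient_right, conj_trivial]
  simp [mul_comm]

theorem convolution_eq_zero_of_norm_gt [NormedSpace ℝ F] {f : E d → F} {R : ℝ}
    (hR : ∀ x, R < ‖x‖ → f x = 0) (φ : ContDiffBump (0 : E d)) (hφ : φ.rOut ≤ 1) {x : E d}
    (hx : R + 1 < ‖x‖) :
    (φ.normed volume ⋆[ContinuousLinearMap.lsmul ℝ ℝ, volume] f) x = 0 := by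
  rw [convolution_lsmul]
  refine integral_eq_zero_of_ae (Eventually.of_forall fun t => ?_)
  by_cases ht : t ∈ Function.support (φ.normed volume)
  · rw [φ.support_normed_eq, mem_ball_zero_iff] at ht
    have : R < ‖x - t‖ := by linarith [norm_sub_norm_le x t]
    simp [hR _ this]
  · simp [Function.notMem_support.1 ht]

/-- Approximation by test functions of a weakly differentiable function with bounded support. -/
theorem exists_isTest_approx_of_bounded_support {w : E d → ℝ} (hw : Continuous w)
    (hw0 : ∀ x, 0 < w x) {f : E d → ℝ} {g : E d → E d} (h : HasWeakGradient f g)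
    (hf2 : Integrable fun x => ‖f x‖ ^ 2 * w x) (hg2 : Integrable fun x => ‖g x‖ ^ 2 * w x)
    {R : ℝ} (hfR : ∀ x, R < ‖x‖ → f x = 0) (hgR : ∀ x, R < ‖x‖ → g x = 0) {ε : ℝ} (hε : 0 < ε) :
    ∃ η, IsTest η ∧ ∫ x, ‖η x - f x‖ ^ 2 * w x ≤ ε ∧
      ∫ x, ‖gradient η x - g x‖ ^ 2 * w x ≤ ε := by
  have hfm := h.1.aestronglyMeasurable
  have hgm := h.2.1.aestronglyMeasurable
  obtain ⟨M, hM⟩ := (isCompact_closedBall (0 : E d) (R + 1)).exists_bound_of_continuousOn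
    hw.continuousOn
  have hM' : ∀ x, ‖x‖ ≤ R + 1 → w x ≤ M := fun x hx =>
    (le_abs_self _).trans (hM x (by simpa using hx))
  obtain ⟨δ, hδ, hδε⟩ : ∃ δ > 0, |M| * δ ^ 2 ≤ ε := by
    refine ⟨√(ε / (|M| + 1)), Real.sqrt_pos.2 (by positivity), ?_⟩
    rw [Real.sq_sqrt (by positivity), mul_div_assoc', div_le_iff₀ (by positivity)]
    nlinarith [abs_nonneg M]
  have hδ' : (0 : ℝ≥0∞) < ENNReal.ofReal δ := ENNReal.ofReal_pos.2 hδ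
  obtain ⟨δ₁, hδ₁, h₁⟩ :=
    exists_eLpNorm_convolution_sub_le (memLp_two_of_weighted hw hw0 hfm hf2 hfR) hδ'
  obtain ⟨δ₂, hδ₂, h₂⟩ :=
    exists_eLpNorm_convolution_sub_le (memLp_two_of_weighted hw hw0 hgm hg2 hgR) hδ'
  -- Small enough for both mollification estimates, and at most `1`, so that supports stay in the
  -- ball of radius `R + 1` on which the weight is bounded by `M`.
  let r := min 1 (min δ₁ δ₂) / 2
  have hr : 0 < r := by positivity
  have hr1 : r < min 1 (min δ₁ δ₂) := half_lt_self (by positivity)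
  let φ : ContDiffBump (0 : E d) := ⟨r / 2, r, by positivity, by linarith⟩
  have hη := isTest_convolution h.1 (hasCompactSupport_of_norm_gt hfR) φ
  have hφ1 : φ.rOut ≤ 1 := hr1.le.trans (min_le_left _ _)
  have hηR : ∀ x, R + 1 < ‖x‖ →
      (φ.normed volume ⋆[ContinuousLinearMap.lsmul ℝ ℝ, volume] f) x = 0 := fun x hx =>
    convolution_eq_zero_of_norm_gt hfR φ hφ1 hx
  refine ⟨_, hη, ?_, ?_⟩
  · refine (integral_sq_mul_le_of_eLpNorm_le hw hw0
      (hη.contDiff_one.continuous.aestronglyMeasurable.sub hfm) hδ.le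
      (h₁ φ (hr1.trans_le ((min_le_right _ _).trans (min_le_left _ _)))) (R := R + 1)
      (fun x hx => ?_) hM').trans hδε
    rw [Pi.sub_apply, hηR x hx, hfR x (by linarith), sub_zero]
  · have e : gradient (φ.normed volume ⋆[ContinuousLinearMap.lsmul ℝ ℝ, volume] f)
        = φ.normed volume ⋆[ContinuousLinearMap.lsmul ℝ ℝ, volume] g :=
      funext fun x => gradient_convolution h φ x
    refine (integral_sq_mul_le_of_eLpNorm_le hw hw0
      ((continuous_gradient hη.contDiff_one).aestronglyMeasurable.sub hgm) hδ.le
      (by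
        rw [e]
        exact h₂ φ (hr1.trans_le ((min_le_right _ _).trans (min_le_right _ _)))) (R := R + 1)
      (fun x hx => ?_) hM').trans hδε
    rw [Pi.sub_apply, gradient_eq_zero_of_norm_gt hηR hx, hgR x (by linarith), sub_zero]

end Sobolev

/-! ### Density of test functions and closedness of weak gradients in weighted Sobolev spaces. -/

section Sobolev

variable {d : ℕ} {F : Type*} [NormedAddCommGroup F]

theorem integral_sub_sq_mul_le {α : Type*} [MeasurableSpace α] {μ : Measure α} {w : α → ℝ}
    (hw0 : ∀ᵐ p ∂μ, 0 ≤ w p) {a b c : α → F}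
    (h1 : Integrable (fun p => ‖a p - b p‖ ^ 2 * w p) μ)
    (h2 : Integrable (fun p => ‖b p - c p‖ ^ 2 * w p) μ) :
    ∫ p, ‖a p - c p‖ ^ 2 * w p ∂μ
      ≤ 2 * (∫ p, ‖a p - b p‖ ^ 2 * w p ∂μ) + 2 * ∫ p, ‖b p - c p‖ ^ 2 * w p ∂μ := by
  rw [← integral_const_mul, ← integral_const_mul,
    ← integral_add (h1.const_mul 2) (h2.const_mul 2)]
  refine integral_mono_of_nonneg (hw0.mono fun p hp => mul_nonneg (sq_nonneg _) hp)
    ((h1.const_mul 2).add (h2.const_mul 2)) ?_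
  filter_upwards [hw0] with p hp
  rw [← mul_assoc, ← mul_assoc, ← add_mul]
  refine mul_le_mul_of_nonneg_right ?_ hp
  have := norm_sub_le_norm_sub_add_norm_sub (a p) (b p) (c p)
  nlinarith [sq_nonneg (‖a p - b p‖ - ‖b p - c p‖), norm_nonneg (a p - c p)]

theorem integrable_sq_mul_of_hasCompactSupport {w : E d → ℝ} (hw : Continuous w) {u : E d → F}
    (hu : Continuous u) (hc : HasCompactSupport u) : Integrable fun x => ‖u x‖ ^ 2 * w x := by
  refine ((hu.norm.pow 2).mul hw).integrable_of_hasCompactSupport ?_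
  refine HasCompactSupport.intro hc.isCompact fun x hx => ?_
  simp [image_eq_zero_of_notMem_tsupport hx]

/-- Test functions are dense in the weighted Sobolev space. -/
theorem exists_isTest_approx {w : E d → ℝ} (hw : Continuous w) (hw0 : ∀ x, 0 < w x)
    {f : E d → ℝ} {g : E d → E d} (h : HasWeakGradient f g)
    (hf2 : Integrable fun x => ‖f x‖ ^ 2 * w x) (hg2 : Integrable fun x => ‖g x‖ ^ 2 * w x)
    {ε : ℝ} (hε : 0 < ε) :
    ∃ η, IsTest η ∧ ∫ x, ‖η x - f x‖ ^ 2 * w x ≤ ε ∧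
      ∫ x, ‖gradient η x - g x‖ ^ 2 * w x ≤ ε := by
  obtain ⟨K, χ, hK0, hχt, hχ01, hχ1, hχg⟩ := exists_cutoff d
  have hfm := h.1.aestronglyMeasurable
  have hgm := h.2.1.aestronglyMeasurable
  have hwm : AEStronglyMeasurable w := hw.aestronglyMeasurable
  have hw0' : ∀ᵐ x : E d, 0 ≤ w x := Eventually.of_forall fun x => (hw0 x).le
  have hχm : ∀ n, AEStronglyMeasurable (χ n) := fun n =>
    (hχt n).contDiff_one.continuous.aestronglyMeasurable
  have hgχm : ∀ n, AEStronglyMeasurable (gradient (χ n)) := fun n =>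
    (continuous_gradient (hχt n).contDiff_one).aestronglyMeasurable
  have hχlim : ∀ x : E d, ∀ᶠ n in atTop, χ n x = 1 := fun x => by
    filter_upwards [eventually_ge_atTop ⌈‖x‖⌉₊] with n hn
    refine hχ1 n x ?_
    have : ‖x‖ ≤ n := (Nat.le_ceil _).trans (by exact_mod_cast hn)
    linarith
  have hχlim' : ∀ x, Tendsto (fun n => χ n x) atTop (𝓝 1) := fun x =>
    tendsto_const_nhds.congr' ((hχlim x).mono fun n hn => hn.symm)
  have hgχlim : ∀ x, Tendsto (fun n => gradient (χ n) x) atTop (𝓝 0) := fun x =>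
    squeeze_zero_norm (fun n => hχg n x) (tendsto_div_succ K)
  have hgχK : ∀ n x, ‖gradient (χ n) x‖ ≤ K := fun n x =>
    (hχg n x).trans (div_le_self hK0 (by linarith [(Nat.cast_nonneg n : (0 : ℝ) ≤ n)]))
  have hχsub : ∀ n x, |χ n x - 1| ≤ 1 := fun n x => abs_le.2
    ⟨by linarith [(hχ01 n x).1], by linarith [(hχ01 n x).2]⟩
  let fn : ℕ → E d → ℝ := fun n x => χ n x * f x
  let gn : ℕ → E d → E d := fun n x => χ n x • g x + f x • gradient (χ n) x
  have hfnm : ∀ n, AEStronglyMeasurable (fn n) := fun n => (hχm n).mul hfm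
  have hgnm : ∀ n, AEStronglyMeasurable (gn n) := fun n =>
    ((hχm n).smul hgm).add (hfm.smul (hgχm n))
  have bf : ∀ n x, ‖fn n x - f x‖ ^ 2 * w x ≤ ‖f x‖ ^ 2 * w x := fun n x => by
    refine mul_le_mul_of_nonneg_right ?_ (hw0 x).le
    refine pow_le_pow_left₀ (norm_nonneg _) ?_ 2
    have : fn n x - f x = (χ n x - 1) * f x := by simp only [fn]; ring
    rw [this, norm_mul]
    exact mul_le_of_le_one_left (norm_nonneg _) (hχsub n x)
  have bg : ∀ n x, ‖gn n x - g x‖ ^ 2 * w x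
      ≤ 2 * (‖g x‖ ^ 2 * w x) + 2 * K ^ 2 * (‖f x‖ ^ 2 * w x) := fun n x => by
    rw [← mul_assoc, ← mul_assoc, ← add_mul]
    refine mul_le_mul_of_nonneg_right ?_ (hw0 x).le
    have : gn n x - g x = (χ n x - 1) • g x + f x • gradient (χ n) x := by
      simp only [gn]; rw [sub_smul, one_smul]; abel
    have h1 : ‖gn n x - g x‖ ≤ ‖g x‖ + K * ‖f x‖ := by
      rw [this]
      refine (norm_add_le _ _).trans (add_le_add ?_ ?_)
      · rw [norm_smul]
        exact mul_le_of_le_one_left (norm_nonneg _) (hχsub n x)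
      · rw [norm_smul, mul_comm]
        exact mul_le_mul_of_nonneg_right (hgχK n x) (norm_nonneg _)
    nlinarith [sq_nonneg (‖g x‖ - K * ‖f x‖), norm_nonneg (gn n x - g x),
      pow_le_pow_left₀ (norm_nonneg _) h1 2]
  have ig : Integrable fun x => 2 * (‖g x‖ ^ 2 * w x) + 2 * K ^ 2 * (‖f x‖ ^ 2 * w x) :=
    (hg2.const_mul 2).add (hf2.const_mul _)
  have nn : ∀ (v : E d → ℝ) (x : E d), ‖‖v x‖ ^ 2 * w x‖ = ‖v x‖ ^ 2 * w x := fun v x =>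
    Real.norm_of_nonneg (mul_nonneg (sq_nonneg _) (hw0 x).le)
  have nn' : ∀ (v : E d → E d) (x : E d), ‖‖v x‖ ^ 2 * w x‖ = ‖v x‖ ^ 2 * w x := fun v x =>
    Real.norm_of_nonneg (mul_nonneg (sq_nonneg _) (hw0 x).le)
  have mf : ∀ n, AEStronglyMeasurable fun x => ‖fn n x - f x‖ ^ 2 * w x := fun n =>
    (((hfnm n).sub hfm).norm.pow 2).mul hwm
  have mg : ∀ n, AEStronglyMeasurable fun x => ‖gn n x - g x‖ ^ 2 * w x := fun n =>
    (((hgnm n).sub hgm).norm.pow 2).mul hwm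
  have t1 : Tendsto (fun n => ∫ x, ‖fn n x - f x‖ ^ 2 * w x) atTop (𝓝 0) := by
    rw [← integral_zero (E d) ℝ]
    refine tendsto_integral_of_dominated_convergence _ mf hf2
      (fun n => Eventually.of_forall fun x =>
        (nn (fun x => fn n x - f x) x).le.trans (bf n x)) (Eventually.of_forall fun x => ?_)
    have := ((((hχlim' x).mul_const (f x)).sub_const (f x)).norm.pow 2).mul_const (w x)
    simpa using this
  have t2 : Tendsto (fun n => ∫ x, ‖gn n x - g x‖ ^ 2 * w x) atTop (𝓝 0) := by
    rw [← integral_zero (E d) ℝ]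
    refine tendsto_integral_of_dominated_convergence _ mg ig
      (fun n => Eventually.of_forall fun x =>
        (nn' (fun x => gn n x - g x) x).le.trans (bg n x)) (Eventually.of_forall fun x => ?_)
    have := (((((hχlim' x).smul_const (g x)).add
      ((hgχlim x).const_smul (f x))).sub_const (g x)).norm.pow 2).mul_const (w x)
    simpa using this
  -- Two errors of `ε / 4`, one from the cutoff and one from mollification, combine to `2 · ε / 4 +
  -- 2 · ε / 4 = ε`.
  obtain ⟨n, hn1, hn2⟩ := ((t1.eventually (ge_mem_nhds (by positivity : (0 : ℝ) < ε / 4))).and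
    (t2.eventually (ge_mem_nhds (by positivity : (0 : ℝ) < ε / 4)))).exists
  have i1 : Integrable fun x => ‖fn n x - f x‖ ^ 2 * w x :=
    hf2.mono' (mf n) (Eventually.of_forall fun x =>
      (nn (fun x => fn n x - f x) x).le.trans (bf n x))
  have i2 : Integrable fun x => ‖gn n x - g x‖ ^ 2 * w x :=
    ig.mono' (mg n) (Eventually.of_forall fun x =>
      (nn' (fun x => gn n x - g x) x).le.trans (bg n x))
  -- Integrability follows by writing `fn n` as `(fn n - f) - (-f)`, both terms being square
  -- integrable for the weight.
  have if2 : Integrable fun x => ‖fn n x‖ ^ 2 * w x := by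
    have h0 := integrable_sub_sq_mul (v := fun x => -f x) hwm hw0' ((hfnm n).sub hfm) hfm.neg i1
      (by simpa only [norm_neg] using hf2)
    simpa using h0
  have ig2 : Integrable fun x => ‖gn n x‖ ^ 2 * w x := by
    have h0 := integrable_sub_sq_mul (v := fun x => -g x) hwm hw0' ((hgnm n).sub hgm) hgm.neg i2
      (by simpa only [norm_neg] using hg2)
    simpa using h0
  obtain ⟨R, hR⟩ : ∃ R, ∀ x, R < ‖x‖ → χ n x = 0 := by
    obtain ⟨R, hR⟩ := (hχt n).2.isCompact.isBounded.subset_closedBall (0 : E d)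
    refine ⟨R, fun x hx => image_eq_zero_of_notMem_tsupport fun h => ?_⟩
    have := hR h
    rw [mem_closedBall_zero_iff] at this
    exact absurd this (not_le.2 hx)
  obtain ⟨η, hη, hη1, hη2⟩ := exists_isTest_approx_of_bounded_support hw hw0 (h.cutoff (hχt n))
    if2 ig2 (R := R) (fun x hx => by simp [hR x hx])
    (fun x hx => by simp [hR x hx, gradient_eq_zero_of_norm_gt hR hx])
    (by positivity : (0 : ℝ) < ε / 4)
  have iη := integrable_sub_sq_mul hwm hw0' hη.contDiff_one.continuous.aestronglyMeasurable
    (hfnm n) (integrable_sq_mul_of_hasCompactSupport hw hη.contDiff_one.continuous hη.2) if2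
  have igη := integrable_sub_sq_mul hwm hw0'
    (continuous_gradient hη.contDiff_one).aestronglyMeasurable
    (hgnm n) (integrable_sq_mul_of_hasCompactSupport hw (continuous_gradient hη.contDiff_one)
      (hasCompactSupport_gradient hη.2)) ig2
  refine ⟨η, hη, (integral_sub_sq_mul_le hw0' iη i1).trans ?_,
    (integral_sub_sq_mul_le hw0' igη i2).trans ?_⟩
  · simp only [fn] at hn1 ⊢
    linarith
  · simp only [gn] at hn2 ⊢
    linarith

theorem exists_seq_isTest_approx {w : E d → ℝ} (hw : Continuous w) (hw0 : ∀ x, 0 < w x)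
    {f : E d → ℝ} {g : E d → E d} (h : HasWeakGradient f g)
    (hf2 : Integrable fun x => ‖f x‖ ^ 2 * w x) (hg2 : Integrable fun x => ‖g x‖ ^ 2 * w x) :
    ∃ η : ℕ → E d → ℝ, (∀ n, IsTest (η n)) ∧
      Tendsto (fun n => ∫ x, ‖η n x - f x‖ ^ 2 * w x) atTop (𝓝 0) ∧
      Tendsto (fun n => ∫ x, ‖gradient (η n) x - g x‖ ^ 2 * w x) atTop (𝓝 0) := by
  choose η hη h1 h2 using fun n : ℕ =>
    exists_isTest_approx hw hw0 h hf2 hg2 (Nat.one_div_pos_of_nat (α := ℝ) (n := n))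
  exact ⟨η, hη,
    squeeze_zero (fun n => integral_nonneg fun x => mul_nonneg (sq_nonneg _) (hw0 x).le) h1
      tendsto_one_div_add_atTop_nhds_zero_nat,
    squeeze_zero (fun n => integral_nonneg fun x => mul_nonneg (sq_nonneg _) (hw0 x).le) h2
      tendsto_one_div_add_atTop_nhds_zero_nat⟩

theorem IsTest.integrable_sq_mul {w : E d → ℝ} (hw : Continuous w) {η : E d → ℝ}
    (hη : IsTest η) : Integrable fun x => ‖η x‖ ^ 2 * w x :=
  integrable_sq_mul_of_hasCompactSupport hw hη.contDiff_one.continuous hη.2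

theorem IsTest.integrable_gradient_sq_mul {w : E d → ℝ} (hw : Continuous w) {η : E d → ℝ}
    (hη : IsTest η) : Integrable fun x => ‖gradient η x‖ ^ 2 * w x :=
  integrable_sq_mul_of_hasCompactSupport hw (continuous_gradient hη.contDiff_one)
    (hasCompactSupport_gradient hη.2)

theorem IsTest.aesm {η : E d → ℝ} (hη : IsTest η) : AEStronglyMeasurable η :=
  hη.contDiff_one.continuous.aestronglyMeasurable

theorem IsTest.aesm_gradient {η : E d → ℝ} (hη : IsTest η) :
    AEStronglyMeasurable (gradient η) :=
  (continuous_gradient hη.contDiff_one).aestronglyMeasurable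

/-- A weak equation that holds for test functions holds on the weighted Sobolev space. -/
theorem integral_inner_weakGradient_eq {w : E d → ℝ} (hw : Continuous w) (hw0 : ∀ x, 0 < w x)
    {f : E d → ℝ} {g : E d → E d} (h : HasWeakGradient f g)
    (hf2 : Integrable fun x => ‖f x‖ ^ 2 * w x) (hg2 : Integrable fun x => ‖g x‖ ^ 2 * w x)
    {G : E d → E d} (hG : AEStronglyMeasurable G) (hG2 : Integrable fun x => ‖G x‖ ^ 2 * w x)
    {r : E d → ℝ} (hr : AEStronglyMeasurable r) (hr2 : Integrable fun x => ‖r x‖ ^ 2 * w x)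
    (heq : ∀ η, IsTest η → ∫ x, inner ℝ (G x) (gradient η x) * w x = ∫ x, η x * (r x * w x)) :
    ∫ x, inner ℝ (G x) (g x) * w x = ∫ x, f x * (r x * w x) := by
  obtain ⟨η, hη, h1, h2⟩ := exists_seq_isTest_approx hw hw0 h hf2 hg2
  have hwm : AEStronglyMeasurable w := hw.aestronglyMeasurable
  have hw0' : ∀ᵐ x : E d, 0 ≤ w x := Eventually.of_forall fun x => (hw0 x).le
  have l1 := tendsto_integral_inner_mul hwm hw0' hG (fun n => (hη n).aesm_gradient)
    h.2.1.aestronglyMeasurable hG2 (fun n => (hη n).integrable_gradient_sq_mul hw) hg2 h2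
  have l2 := tendsto_integral_inner_mul hwm hw0' hr (fun n => (hη n).aesm)
    h.1.aestronglyMeasurable hr2 (fun n => (hη n).integrable_sq_mul hw) hf2 h1
  simp only [RCLike.inner_apply, conj_trivial, mul_assoc] at l2
  simp_rw [heq _ (hη _)] at l1
  exact tendsto_nhds_unique l1 l2

theorem integrable_mul_of_sq {w : E d → ℝ} (hw : Continuous w) (hw0 : ∀ x, 0 < w x)
    (hwi : Integrable w) {f : E d → ℝ} (hf : AEStronglyMeasurable f)
    (hf2 : Integrable fun x => ‖f x‖ ^ 2 * w x) : Integrable fun x => f x * w x := by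
  have := integrable_inner_mul (u := fun _ : E d => (1 : ℝ)) (v := f) hw.aestronglyMeasurable
    (Eventually.of_forall fun x => (hw0 x).le) aestronglyMeasurable_const hf
    (by simpa using hwi) hf2
  simpa using this

/-- The variance as second moment minus squared mean: in this form it passes to limits in weighted
`L²`, although the mean varies along the sequence. -/
theorem integral_sub_mean_sq {w : E d → ℝ} (hw : Continuous w) (hw0 : ∀ x, 0 < w x)
    (hwi : Integrable w) (hw1 : ∫ x, w x = 1) {f : E d → ℝ} (hf : AEStronglyMeasurable f)
    (hf2 : Integrable fun x => ‖f x‖ ^ 2 * w x) :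
    ∫ x, (f x - ∫ y, f y * w y) ^ 2 * w x
      = (∫ x, ‖f x‖ ^ 2 * w x) - (∫ x, f x * w x) ^ 2 := by
  have h := integral_sub_sq_mul (u := f) (v := fun _ : E d => ∫ y, f y * w y)
    hw.aestronglyMeasurable (Eventually.of_forall fun x => (hw0 x).le) hf
    aestronglyMeasurable_const hf2 (hwi.const_mul _)
  simp only [RCLike.inner_apply, conj_trivial, mul_assoc, integral_const_mul, hw1,
    Real.norm_eq_abs, sq_abs] at h ⊢
  rw [h]
  ring

/-- The Poincaré inequality extends from test functions to the weighted Sobolev space. -/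
theorem poincare_of_hasWeakGradient {w : E d → ℝ} (hw : Continuous w) (hw0 : ∀ x, 0 < w x)
    (hwi : Integrable w) (hw1 : ∫ x, w x = 1) {C : ℝ}
    (hC : ∀ η, IsTest η → ∫ x, (η x - ∫ y, η y * w y) ^ 2 * w x
      ≤ C * ∫ x, ‖gradient η x‖ ^ 2 * w x)
    {f : E d → ℝ} {g : E d → E d} (h : HasWeakGradient f g)
    (hf2 : Integrable fun x => ‖f x‖ ^ 2 * w x) (hg2 : Integrable fun x => ‖g x‖ ^ 2 * w x) :
    ∫ x, (f x - ∫ y, f y * w y) ^ 2 * w x ≤ C * ∫ x, ‖g x‖ ^ 2 * w x := by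
  obtain ⟨η, hη, h1, h2⟩ := exists_seq_isTest_approx hw hw0 h hf2 hg2
  have hwm : AEStronglyMeasurable w := hw.aestronglyMeasurable
  have hw0' : ∀ᵐ x : E d, 0 ≤ w x := Eventually.of_forall fun x => (hw0 x).le
  have l1 := tendsto_integral_sq_mul hwm hw0' (fun n => (hη n).aesm_gradient)
    h.2.1.aestronglyMeasurable (fun n => (hη n).integrable_gradient_sq_mul hw) hg2 h2
  have l2 := tendsto_integral_sq_mul hwm hw0' (fun n => (hη n).aesm)
    h.1.aestronglyMeasurable (fun n => (hη n).integrable_sq_mul hw) hf2 h1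
  -- Convergence of the means is convergence of the pairings with the constant `1`, which is square
  -- integrable since the weight has finite mass.
  have l3 := tendsto_integral_inner_mul (v := fun _ : E d => (1 : ℝ)) hwm hw0'
    aestronglyMeasurable_const (fun n => (hη n).aesm) h.1.aestronglyMeasurable
    (by simpa using hwi) (fun n => (hη n).integrable_sq_mul hw) hf2 h1
  simp only [RCLike.inner_apply, conj_trivial, mul_one] at l3
  rw [integral_sub_mean_sq hw hw0 hwi hw1 h.1.aestronglyMeasurable hf2]
  refine le_of_tendsto_of_tendsto' (l2.sub (l3.pow 2)) (l1.const_mul C) fun n => ?_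
  rw [← integral_sub_mean_sq hw hw0 hwi hw1 (hη n).aesm ((hη n).integrable_sq_mul hw)]
  exact hC _ (hη n)

theorem hasWeakGradient_of_contDiff {f : E d → ℝ} (hf : ContDiff ℝ 1 f) :
    HasWeakGradient f (gradient f) :=
  ⟨hf.continuous.locallyIntegrable, (continuous_gradient hf).locallyIntegrable, fun _ hη =>
    integral_smul_gradient hf hη.contDiff_one hη.2⟩

theorem integral_gradient_eq_zero {η : E d → ℝ} (hη : IsTest η) : ∫ x, gradient η x = 0 := by
  have := integral_smul_gradient (contDiff_const (c := (1 : ℝ))) hη.contDiff_one hη.2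
  simpa [gradient_fun_const] using this

/-- Functions that differ by a constant have the same weak gradient. -/
theorem HasWeakGradient.ae_eq {f f' : E d → ℝ} {g g' : E d → E d} (h : HasWeakGradient f g)
    (h' : HasWeakGradient f' g') {c : ℝ} (hc : ∀ᵐ x, f x = f' x + c) : g =ᵐ[volume] g' := by
  refine ae_eq_of_integral_contDiff_smul_eq h.2.1 h'.2.1 fun η hη hηc => ?_
  have ht : IsTest η := ⟨hη, hηc⟩
  rw [← neg_inj, ← h.2.2 η ht, ← h'.2.2 η ht]
  have hgc := continuous_gradient ht.contDiff_one
  have e : ∫ x, f x • gradient η x = ∫ x, (f' x • gradient η x + c • gradient η x) :=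
    integral_congr_ae (hc.mono fun x hx => by simp only [hx, add_smul])
  have j1 : Integrable fun x => f' x • gradient η x :=
    h'.1.integrable_smul_right_of_hasCompactSupport hgc (hasCompactSupport_gradient hηc)
  have j2 : Integrable fun x => c • gradient η x :=
    (hgc.integrable_of_hasCompactSupport (hasCompactSupport_gradient hηc)).smul c
  rw [e, integral_add j1 j2, integral_smul, integral_gradient_eq_zero ht,
    smul_zero, add_zero]

theorem integral_mul_inner_gradient {f h : E d → ℝ} (hf : ContDiff ℝ 1 f) (hh : IsTest h)
    (v : E d) :
    ∫ x, f x * inner ℝ v (gradient h x) = -∫ x, h x * inner ℝ v (gradient f x) := by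
  have hp := integral_smul_gradient hf hh.contDiff_one hh.2
  have j1 : Integrable fun x => f x • gradient h x :=
    (hf.continuous.smul (continuous_gradient hh.contDiff_one)).integrable_of_hasCompactSupport
      (hasCompactSupport_gradient hh.2).smul_left
  have j2 : Integrable fun x => h x • gradient f x :=
    (hh.contDiff_one.continuous.smul (continuous_gradient hf)).integrable_of_hasCompactSupport
      hh.2.smul_right
  have := congrArg (fun y => inner ℝ v y) hp
  simp only [inner_neg_right] at this
  rw [← integral_inner j1, ← integral_inner j2] at this
  simpa only [inner_smul_right] using this

/-- Limits in the weighted Sobolev norm are weakly differentiable. -/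
theorem hasWeakGradient_of_tendsto {w : E d → ℝ} (hw : Continuous w) (hw0 : ∀ x, 0 < w x)
    {η : ℕ → E d → ℝ} {c : ℕ → ℝ} (hη : ∀ n, IsTest (η n))
    (hη2 : ∀ n, Integrable fun x => ‖η n x - c n‖ ^ 2 * w x)
    {f : E d → ℝ} {g : E d → E d} (hf : AEStronglyMeasurable f) (hg : AEStronglyMeasurable g)
    (hf2 : Integrable fun x => ‖f x‖ ^ 2 * w x) (hg2 : Integrable fun x => ‖g x‖ ^ 2 * w x)
    (h1 : Tendsto (fun n => ∫ x, ‖η n x - c n - f x‖ ^ 2 * w x) atTop (𝓝 0))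
    (h2 : Tendsto (fun n => ∫ x, ‖gradient (η n) x - g x‖ ^ 2 * w x) atTop (𝓝 0)) :
    HasWeakGradient f g := by
  have hfl := locallyIntegrable_of_weighted hw hw0 hf hf2
  have hgl := locallyIntegrable_of_weighted hw hw0 hg hg2
  refine ⟨hfl, hgl, fun h hh => ?_⟩
  have hwm : AEStronglyMeasurable w := hw.aestronglyMeasurable
  have hw0' : ∀ᵐ x : E d, 0 ≤ w x := Eventually.of_forall fun x => (hw0 x).le
  have hhc := hh.contDiff_one.continuous
  have hgh := continuous_gradient hh.contDiff_one
  have hwi : Continuous fun x => (w x)⁻¹ := hw.inv₀ fun x => (hw0 x).ne'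
  have i1 : Integrable fun x => f x • gradient h x :=
    hfl.integrable_smul_right_of_hasCompactSupport hgh (hasCompactSupport_gradient hh.2)
  have i2 : Integrable fun x => h x • g x :=
    hgl.integrable_smul_left_of_hasCompactSupport hhc hh.2
  refine ext_inner_left ℝ fun v => ?_
  rw [inner_neg_right, ← integral_inner i1, ← integral_inner i2]
  have hk : Continuous fun x => inner ℝ v (gradient h x) := continuous_const.inner hgh
  have hks : HasCompactSupport fun x => inner ℝ v (gradient h x) :=
    (hasCompactSupport_gradient hh.2).comp_left (g := fun y => inner ℝ v y) (inner_zero_right v)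
  -- Convergence is known in the weighted norm, while the weak gradient is defined without weight.
  -- Dividing the test function by `w`, which is continuous and positive, makes the weight cancel.
  have hc1 : Continuous fun x => (w x)⁻¹ * inner ℝ v (gradient h x) := hwi.mul hk
  have hc2 : Continuous fun x => (w x)⁻¹ • h x • v := hwi.smul (hhc.smul continuous_const)
  have hs1 : HasCompactSupport fun x => (w x)⁻¹ * inner ℝ v (gradient h x) := hks.mul_left
  have hs2 : HasCompactSupport fun x => (w x)⁻¹ • h x • v :=
    HasCompactSupport.intro hh.2.isCompact fun x hx => by
      simp only [image_eq_zero_of_notMem_tsupport hx, zero_smul, smul_zero]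
  have q1 := integrable_sq_mul_of_hasCompactSupport hw hc1 hs1
  have q2 := integrable_sq_mul_of_hasCompactSupport hw hc2 hs2
  have l1 := tendsto_integral_inner_mul (v := fun x => (w x)⁻¹ * inner ℝ v (gradient h x))
    (un := fun n x => η n x - c n) hwm hw0' hc1.aestronglyMeasurable
    (fun n => (hη n).aesm.sub aestronglyMeasurable_const) hf q1 hη2 hf2 h1
  have l2 := tendsto_integral_inner_mul (v := fun x => (w x)⁻¹ • h x • v)
    (un := fun n x => gradient (η n) x) hwm hw0' hc2.aestronglyMeasurable
    (fun n => (hη n).aesm_gradient) hg q2 (fun n => (hη n).integrable_gradient_sq_mul hw) hg2 h2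
  have s1 : ∀ a b x, inner ℝ ((w x)⁻¹ * a) b * w x = b * a := fun a b x => by
    have := (hw0 x).ne'
    simp only [RCLike.inner_apply, conj_trivial]
    field_simp
  have s2 : ∀ (b : E d) x, inner ℝ ((w x)⁻¹ • h x • v) b * w x = h x * inner ℝ v b := fun b x => by
    have := (hw0 x).ne'
    simp only [inner_smul_left, conj_trivial]
    field_simp
  simp_rw [s1] at l1
  simp_rw [s2] at l2
  have e : ∀ n, ∫ x, (η n x - c n) * inner ℝ v (gradient h x)
      = -∫ x, h x * inner ℝ v (gradient (η n) x) := by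
    intro n
    have hd : ContDiff ℝ 1 fun x => η n x - c n := (hη n).contDiff_one.sub contDiff_const
    rw [integral_mul_inner_gradient hd hh v]
    simp_rw [sub_eq_add_neg]
    rw [gradient_add_const]
  simp_rw [e] at l1
  simp only [inner_smul_right]
  exact tendsto_nhds_unique l1 l2.neg

end Sobolev

/-! ### Riesz representation in weighted `L²` spaces. -/

section Hilbert

/-- Riesz representation for the form `⟪r, B η⟫`, where `B` is bounded by `A`: the representing
vector is a limit of vectors `A ηₙ` along which `B ηₙ` converges as well. -/
theorem exists_seq_inner_eq {D H₁ H₂ : Type*} [AddCommGroup D] [Module ℝ D]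
    [NormedAddCommGroup H₁] [InnerProductSpace ℝ H₁] [CompleteSpace H₁]
    [NormedAddCommGroup H₂] [InnerProductSpace ℝ H₂] [CompleteSpace H₂]
    (A : D →ₗ[ℝ] H₁) (B : D →ₗ[ℝ] H₂) {K : ℝ} (hK : ∀ η, ‖B η‖ ≤ K * ‖A η‖) (r : H₂) :
    ∃ (g : H₁) (f : H₂) (η : ℕ → D), Tendsto (fun n => A (η n)) atTop (𝓝 g) ∧
      Tendsto (fun n => B (η n)) atTop (𝓝 f) ∧ ∀ ξ, inner ℝ g (A ξ) = inner ℝ r (B ξ) := by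
  let V := (LinearMap.range A).topologicalClosure
  have : CompleteSpace V := (LinearMap.range A).isClosed_topologicalClosure.completeSpace_coe
  let e : D →ₗ[ℝ] V := A.codRestrict V fun η =>
    (LinearMap.range A).le_topologicalClosure ⟨η, rfl⟩
  have he : DenseRange e := by
    intro v
    rw [Topology.IsInducing.subtypeVal.closure_eq_preimage_closure_image]
    have h1 : (Subtype.val '' range e : Set H₁) = (LinearMap.range A : Set H₁) :=
      (range_comp _ _).symm
    exact (congrArg closure h1).symm ▸ v.2
  have hB : ∃ C, ∀ x, ‖B x‖ ≤ C * ‖e x‖ := ⟨K, hK⟩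
  -- By the bound `hK`, `B` factors through `A` and extends continuously to the closure `V` of the
  -- range. The representing vector is the image of `r` under the adjoint, and density of the range
  -- supplies the sequence; continuity of `B'` makes `B ηₙ` converge.
  let B' : V →L[ℝ] H₂ := B.extendOfNorm e
  have hB' : ∀ η, B' (e η) = B η := fun η => LinearMap.extendOfNorm_eq he hB η
  let g : V := ContinuousLinearMap.adjoint B' r
  obtain ⟨u, hu, hug⟩ := mem_closure_iff_seq_limit.1 (he g)
  choose η hη using hu
  have hlim : Tendsto (fun n => e (η n)) atTop (𝓝 g) := by simpa only [hη] using hug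
  refine ⟨g, B' g, η, (continuous_subtype_val.tendsto g).comp hlim, ?_, fun ξ => ?_⟩
  · simpa only [Function.comp_def, hB'] using (B'.continuous.tendsto g).comp hlim
  · rw [← hB', ← ContinuousLinearMap.adjoint_inner_left]
    rfl

variable {α : Type*} [MeasurableSpace α] {μ : Measure α} {w : α → ℝ}

/-- Multiplication by `√w` identifies the weighted space with the unweighted `L²`, where
completeness and adjoints are at hand; `exists_eq_sqrt_smul` goes back. -/
theorem memLp_sqrt_smul {F : Type*} [NormedAddCommGroup F] [InnerProductSpace ℝ F] {u : α → F}
    (hw : AEStronglyMeasurable w μ) (hw0 : ∀ᵐ p ∂μ, 0 < w p)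
    (hu : AEStronglyMeasurable u μ) (hu2 : Integrable (fun p => ‖u p‖ ^ 2 * w p) μ) :
    MemLp (fun p => √(w p) • u p) 2 μ := by
  refine (memLp_two_iff_integrable_sq_norm
    ((Real.continuous_sqrt.comp_aestronglyMeasurable hw).smul hu)).2 (hu2.congr ?_)
  filter_upwards [hw0] with p hp
  simp only [Pi.smul_apply']
  rw [norm_smul, mul_pow, Real.norm_of_nonneg (Real.sqrt_nonneg _), Real.sq_sqrt hp.le, mul_comm]

/-- The map `η ↦ √w • A η` into the space of square integrable functions. -/
def sqrtSmulLp {F D : Type*} [NormedAddCommGroup F] [InnerProductSpace ℝ F] [AddCommGroup D]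
    [Module ℝ D] (A : D →ₗ[ℝ] α → F) (h : ∀ η, MemLp (fun p => √(w p) • A η p) 2 μ) :
    D →ₗ[ℝ] Lp F 2 μ where
  toFun η := (h η).toLp
  map_add' η ξ := by
    rw [← MemLp.toLp_add]
    refine MemLp.toLp_congr _ _ (Eventually.of_forall fun p => ?_)
    simp
  map_smul' c η := by
    rw [RingHom.id_apply, ← MemLp.toLp_const_smul]
    refine MemLp.toLp_congr _ _ (Eventually.of_forall fun p => ?_)
    simp [smul_comm c]

theorem inner_eq_integral_of_ae_eq {F : Type*} [NormedAddCommGroup F] [InnerProductSpace ℝ F]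
    (hw0 : ∀ᵐ p ∂μ, 0 < w p) {f g : Lp F 2 μ} {u v : α → F}
    (hf : f =ᵐ[μ] fun p => √(w p) • u p) (hg : g =ᵐ[μ] fun p => √(w p) • v p) :
    inner ℝ f g = ∫ p, inner ℝ (u p) (v p) * w p ∂μ := by
  rw [L2.inner_def]
  refine integral_congr_ae ?_
  filter_upwards [hf, hg, hw0] with p h1 h2 hp
  rw [h1, h2, real_inner_smul_left, real_inner_smul_right, ← mul_assoc, Real.mul_self_sqrt hp.le,
    mul_comm]

theorem exists_eq_sqrt_smul {F : Type*} [NormedAddCommGroup F] [InnerProductSpace ℝ F]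
    (hw : AEStronglyMeasurable w μ) (hw0 : ∀ᵐ p ∂μ, 0 < w p) (f : Lp F 2 μ) :
    ∃ u : α → F, AEStronglyMeasurable u μ ∧ Integrable (fun p => ‖u p‖ ^ 2 * w p) μ ∧
      f =ᵐ[μ] fun p => √(w p) • u p := by
  have hm := Lp.aestronglyMeasurable f
  have h1 := (memLp_two_iff_integrable_sq_norm hm).1 (Lp.memLp f)
  refine ⟨fun p => (√(w p))⁻¹ • f p, ?_, h1.congr ?_, ?_⟩
  · exact ((Real.continuous_sqrt.comp_aestronglyMeasurable hw).inv₀).smul hm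
  · filter_upwards [hw0] with p hp
    have := Real.sqrt_pos.2 hp
    rw [norm_smul, mul_pow, norm_inv, Real.norm_of_nonneg this.le, inv_pow, Real.sq_sqrt hp.le]
    field_simp
  · filter_upwards [hw0] with p hp
    rw [smul_inv_smul₀ (Real.sqrt_pos.2 hp).ne']

theorem tendsto_integral_sub_sq_mul_of_tendsto {F : Type*} [NormedAddCommGroup F]
    [InnerProductSpace ℝ F] (hw0 : ∀ᵐ p ∂μ, 0 < w p) {fn : ℕ → Lp F 2 μ} {f : Lp F 2 μ}
    {un : ℕ → α → F} {u : α → F} (hfn : ∀ n, fn n =ᵐ[μ] fun p => √(w p) • un n p)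
    (hf : f =ᵐ[μ] fun p => √(w p) • u p) (h : Tendsto fn atTop (𝓝 f)) :
    Tendsto (fun n => ∫ p, ‖un n p - u p‖ ^ 2 * w p ∂μ) atTop (𝓝 0) := by
  have h1 := (tendsto_iff_norm_sub_tendsto_zero.1 h).pow 2
  rw [zero_pow two_ne_zero] at h1
  refine h1.congr fun n => ?_
  have h2 : (fn n - f : Lp F 2 μ) =ᵐ[μ] fun p => √(w p) • (un n p - u p) := by
    filter_upwards [Lp.coeFn_sub (fn n) f, hfn n, hf] with p a b c
    rw [a, Pi.sub_apply, b, c, smul_sub]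
  rw [← real_inner_self_eq_norm_sq, inner_eq_integral_of_ae_eq hw0 h2 h2]
  simp_rw [real_inner_self_eq_norm_sq]

/-- Weighted form of `exists_seq_inner_eq`. -/
theorem exists_seq_integral_inner_eq {D F₁ F₂ : Type*} [AddCommGroup D] [Module ℝ D]
    [NormedAddCommGroup F₁] [InnerProductSpace ℝ F₁] [CompleteSpace F₁]
    [NormedAddCommGroup F₂] [InnerProductSpace ℝ F₂] [CompleteSpace F₂]
    (hw : AEStronglyMeasurable w μ) (hw0 : ∀ᵐ p ∂μ, 0 < w p)
    (A : D →ₗ[ℝ] α → F₁) (B : D →ₗ[ℝ] α → F₂)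
    (hA : ∀ η, AEStronglyMeasurable (A η) μ) (hB : ∀ η, AEStronglyMeasurable (B η) μ)
    (hA2 : ∀ η, Integrable (fun p => ‖A η p‖ ^ 2 * w p) μ)
    (hB2 : ∀ η, Integrable (fun p => ‖B η p‖ ^ 2 * w p) μ)
    {K : ℝ} (hK : ∀ η, ∫ p, ‖B η p‖ ^ 2 * w p ∂μ ≤ K * ∫ p, ‖A η p‖ ^ 2 * w p ∂μ)
    {r : α → F₂} (hr : AEStronglyMeasurable r μ) (hr2 : Integrable (fun p => ‖r p‖ ^ 2 * w p) μ) :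
    ∃ (g : α → F₁) (f : α → F₂) (η : ℕ → D),
      AEStronglyMeasurable g μ ∧ Integrable (fun p => ‖g p‖ ^ 2 * w p) μ ∧
      AEStronglyMeasurable f μ ∧ Integrable (fun p => ‖f p‖ ^ 2 * w p) μ ∧
      Tendsto (fun n => ∫ p, ‖A (η n) p - g p‖ ^ 2 * w p ∂μ) atTop (𝓝 0) ∧
      Tendsto (fun n => ∫ p, ‖B (η n) p - f p‖ ^ 2 * w p ∂μ) atTop (𝓝 0) ∧
      ∀ ξ, ∫ p, inner ℝ (g p) (A ξ p) * w p ∂μ = ∫ p, inner ℝ (r p) (B ξ p) * w p ∂μ := by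
  let A' := sqrtSmulLp A fun η => memLp_sqrt_smul hw hw0 (hA η) (hA2 η)
  let B' := sqrtSmulLp B fun η => memLp_sqrt_smul hw hw0 (hB η) (hB2 η)
  have hA' : ∀ η, A' η =ᵐ[μ] fun p => √(w p) • A η p := fun η =>
    (memLp_sqrt_smul hw hw0 (hA η) (hA2 η)).coeFn_toLp
  have hB' : ∀ η, B' η =ᵐ[μ] fun p => √(w p) • B η p := fun η =>
    (memLp_sqrt_smul hw hw0 (hB η) (hB2 η)).coeFn_toLp
  have nA : ∀ η, ‖A' η‖ ^ 2 = ∫ p, ‖A η p‖ ^ 2 * w p ∂μ := fun η => by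
    rw [← real_inner_self_eq_norm_sq, inner_eq_integral_of_ae_eq hw0 (hA' η) (hA' η)]
    simp_rw [real_inner_self_eq_norm_sq]
  have nB : ∀ η, ‖B' η‖ ^ 2 = ∫ p, ‖B η p‖ ^ 2 * w p ∂μ := fun η => by
    rw [← real_inner_self_eq_norm_sq, inner_eq_integral_of_ae_eq hw0 (hB' η) (hB' η)]
    simp_rw [real_inner_self_eq_norm_sq]
  have hr' := memLp_sqrt_smul hw hw0 hr hr2
  -- The bound relates squared norms, hence the square root; `max K 0` is used because the sign of
  -- `K` is not prescribed.
  obtain ⟨g, f, η, hg, hf, h⟩ := exists_seq_inner_eq A' B' (K := √(max K 0)) (fun η => by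
    refine abs_le_of_sq_le_sq' ?_ (by positivity) |>.2
    rw [mul_pow, Real.sq_sqrt (le_max_right _ _), nA, nB]
    refine (hK η).trans (mul_le_mul_of_nonneg_right (le_max_left _ _) ?_)
    rw [← nA]
    positivity) hr'.toLp
  obtain ⟨g', hg1, hg2, hg3⟩ := exists_eq_sqrt_smul hw hw0 g
  obtain ⟨f', hf1, hf2, hf3⟩ := exists_eq_sqrt_smul hw hw0 f
  refine ⟨g', f', η, hg1, hg2, hf1, hf2,
    tendsto_integral_sub_sq_mul_of_tendsto hw0 (fun n => hA' (η n)) hg3 hg,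
    tendsto_integral_sub_sq_mul_of_tendsto hw0 (fun n => hB' (η n)) hf3 hf, fun ξ => ?_⟩
  rw [← inner_eq_integral_of_ae_eq hw0 hg3 (hA' ξ), h,
    inner_eq_integral_of_ae_eq hw0 hr'.coeFn_toLp (hB' ξ)]

end Hilbert

/-! ### Solution of the weak transport equation at a fixed time. -/

section Existence

variable {d : ℕ} {U : ℝ → E d → ℝ} {T : ℝ}

/-- The space of test functions. -/
def testFunctions (d : ℕ) : Submodule ℝ (E d → ℝ) where
  carrier := {η | IsTest η}
  add_mem' h k := ⟨h.1.add k.1, h.2.add k.2⟩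
  zero_mem' := ⟨contDiff_const, HasCompactSupport.zero⟩
  smul_mem' _ _ h := ⟨contDiff_const.mul h.1, h.2.mul_left⟩

/-- The space of test functions of time and space. -/
def spaceTimeTestFunctions (d : ℕ) : Submodule ℝ (ℝ → E d → ℝ) where
  carrier := {η | IsSpaceTimeTest η}
  add_mem' h k := ⟨h.1.add k.1, h.2.add k.2⟩
  zero_mem' := ⟨contDiff_const, HasCompactSupport.zero⟩
  smul_mem' _ _ h := ⟨contDiff_const.mul h.1, h.2.mul_left⟩

theorem IsTest.gradient_add {η ξ : E d → ℝ} (hη : IsTest η) (hξ : IsTest ξ) (x : E d) :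
    gradient (η + ξ) x = gradient η x + gradient ξ x :=
  ActionMatching.gradient_add (hη.differentiableAt x) (hξ.differentiableAt x)

theorem IsTest.gradient_smul {η : E d → ℝ} (hη : IsTest η) (c : ℝ) (x : E d) :
    gradient (c • η) x = c • gradient η x :=
  gradient_const_mul c (hη.differentiableAt x)

/-- The gradient of test functions. -/
def gradientMap (d : ℕ) : testFunctions d →ₗ[ℝ] E d → E d where
  toFun η := gradient η.1
  map_add' η ξ := funext fun x => IsTest.gradient_add η.2 ξ.2 x
  map_smul' c η := funext fun x => IsTest.gradient_smul η.2 c x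

/-- The spatial gradient of test functions of time and space. -/
def spaceTimeGradientMap (d : ℕ) : spaceTimeTestFunctions d →ₗ[ℝ] ℝ × E d → E d where
  toFun η p := gradient (η.1 p.1) p.2
  map_add' η ξ := funext fun p =>
    IsTest.gradient_add (IsSpaceTimeTest.isTest η.2 p.1) (IsSpaceTimeTest.isTest ξ.2 p.1) p.2
  map_smul' c η := funext fun p =>
    IsTest.gradient_smul (IsSpaceTimeTest.isTest η.2 p.1) c p.2

theorem IsTest.integrable_mul {η w : E d → ℝ} (hη : IsTest η) (hw : Continuous w) :
    Integrable fun x => η x * w x :=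
  (hη.contDiff_one.continuous.mul hw).integrable_of_hasCompactSupport hη.2.mul_right

/-- Test functions, normalized to have mean zero. -/
def centerMap {w : E d → ℝ} (hw : Continuous w) : testFunctions d →ₗ[ℝ] E d → ℝ where
  toFun η x := η.1 x - ∫ y, η.1 y * w y
  map_add' η ξ := funext fun x => by
    have := integral_add (IsTest.integrable_mul η.2 hw) (IsTest.integrable_mul ξ.2 hw)
    simp only [Submodule.coe_add, Pi.add_apply, add_mul]
    rw [this]
    ring
  map_smul' c η := funext fun x => by
    simp only [Submodule.coe_smul, Pi.smul_apply, smul_eq_mul, mul_assoc, integral_const_mul,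
      RingHom.id_apply]
    ring

/-- Since `r` has mean zero, centring the test function does not change the pairing; the Poincaré
inequality controls only the centred one. -/
theorem integral_mul_sub_const {r η w : E d → ℝ} (hi : Integrable fun x => η x * (r x * w x))
    (hr : Integrable fun x => r x * w x) (hr0 : ∫ x, r x * w x = 0) (c : ℝ) :
    ∫ x, inner ℝ (r x) (η x - c) * w x = ∫ x, η x * (r x * w x) := by
  have h : ∀ x, inner ℝ (r x) (η x - c) * w x = η x * (r x * w x) - c * (r x * w x) := fun x => by
    simp only [RCLike.inner_apply, conj_trivial]
    ring
  simp_rw [h]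
  rw [integral_sub hi (hr.const_mul c), integral_const_mul, hr0, mul_zero, sub_zero]

/-- Solution of the weak transport equation for a density with a spectral gap. -/
theorem exists_weak_solution {w : E d → ℝ} (hw : Continuous w) (hw0 : ∀ x, 0 < w x)
    (hwi : Integrable w) {C : ℝ}
    (hC : ∀ η, IsTest η → ∫ x, (η x - ∫ y, η y * w y) ^ 2 * w x
      ≤ C * ∫ x, ‖gradient η x‖ ^ 2 * w x)
    {r : E d → ℝ} (hr : Continuous r) (hr2 : Integrable fun x => ‖r x‖ ^ 2 * w x)
    (hr1 : Integrable fun x => r x * w x) (hr0 : ∫ x, r x * w x = 0) :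
    ∃ f g, HasWeakGradient f g ∧
      ∀ η, IsTest η → ∫ x, inner ℝ (g x) (gradient η x) * w x = ∫ x, η x * (r x * w x) := by
  have hwm : AEStronglyMeasurable w := hw.aestronglyMeasurable
  have hw0' : ∀ᵐ x : E d, 0 ≤ w x := Eventually.of_forall fun x => (hw0 x).le
  have hB2 : ∀ η : testFunctions d, Integrable fun x => ‖centerMap hw η x‖ ^ 2 * w x := fun η =>
    integrable_sub_sq_mul hwm hw0' (IsTest.aesm η.2) aestronglyMeasurable_const
      (IsTest.integrable_sq_mul hw η.2) (hwi.const_mul _)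
  obtain ⟨g, f, η, hg, hg2, hf, hf2, h1, h2, h⟩ := exists_seq_integral_inner_eq hwm
    (Eventually.of_forall hw0) (gradientMap d) (centerMap hw) (fun η => IsTest.aesm_gradient η.2)
    (fun η => (IsTest.aesm η.2).sub aestronglyMeasurable_const)
    (fun η => IsTest.integrable_gradient_sq_mul hw η.2) hB2 (K := C) (fun η => by
      simp only [Real.norm_eq_abs, sq_abs]
      exact hC η.1 η.2) hr.aestronglyMeasurable hr2
  refine ⟨f, g, hasWeakGradient_of_tendsto hw hw0 (fun n => (η n).2) (fun n => hB2 (η n)) hf hg hf2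
    hg2 h2 h1, fun ξ hξ => (h ⟨ξ, hξ⟩).trans ?_⟩
  exact integral_mul_sub_const (hξ.integrable_mul (hr.mul hw)) hr1 hr0 _

/-- Serves the exceptional null set of times at which the solution on the slab gives no information.
Only square integrability at the given time is used. -/
theorem exists_weak_solution_at (hU : IsPotentialPath U) (hT : T ∈ Ioc (0 : ℝ) 1)
    (hgap : SpectralGap U T) (hS : SquareIntegrableRate U T) {t : ℝ} (ht : t ∈ Icc 0 T) :
    ∃ f g, HasWeakGradient f g ∧ SolvesTransportWeakly U t g := by
  obtain ⟨C, hC⟩ := hgap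
  have ht1 := Icc_subset_unit hT ht
  have e : (fun x => logRate U t x * rho U t x) = timeDeriv 1 (rho U) t :=
    funext (logRate_mul_rho hU ht1)
  obtain ⟨f, g, h1, h2⟩ := exists_weak_solution (continuous_rho hU ht1) (rho_pos hU ht1)
    (integrable_rho hU ht1) (hC t ht) (continuousOn_slice (continuousOn_logRate hU hT) ht)
    (by simpa using integrable_logRate_sq hU hT hS ht)
    (e ▸ integrable_timeDeriv_rho hU ht1)
    (by rw [e]; exact integral_timeDeriv_rho hU ht1)
  refine ⟨f, g, h1, fun η hη => (h2 η hη).trans ?_⟩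
  simp_rw [logRate_mul_rho hU ht1]

end Existence

/-! ### Solution of the weak transport equation on the slab. -/

section GlobalExistence

variable {d : ℕ} {U : ℝ → E d → ℝ} {T : ℝ}

theorem ae_slab_of_ae {P : ℝ → Prop} (h : ∀ᵐ t ∂volume.restrict (Icc 0 T), P t) :
    ∀ᵐ p ∂(volume : Measure (ℝ × E d)).restrict (slab d T), P p.1 := by
  rw [volume_restrict_slab]
  exact Measure.quasiMeasurePreserving_fst.ae h

/-- The mean of a function of time and space. -/
def spatialMean (U : ℝ → E d → ℝ) (η : ℝ → E d → ℝ) (t : ℝ) : ℝ := ∫ y, η t y * rho U t y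

theorem IsSpaceTimeTest.continuousOn_spatialMean {η : ℝ → E d → ℝ} (h : IsSpaceTimeTest η)
    (hU : IsPotentialPath U) (hT : T ∈ Ioc (0 : ℝ) 1) :
    ContinuousOn (spatialMean U η) (Icc 0 T) := by
  obtain ⟨R, hR⟩ := h.exists_radius
  refine continuousOn_integral_of_compact_support (isCompact_closedBall (0 : E d) R)
    (f := fun t y => η t y * rho U t y) ?_ fun t x _ hx => ?_
  · exact h.contDiff_one.continuous.continuousOn.mul (continuousOn_rho hU hT)
  · rw [hR t x (by simpa using hx), zero_mul]

theorem spatialMean_add (hU : IsPotentialPath U) {t : ℝ} (ht : t ∈ Icc (0 : ℝ) 1)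
    {η ξ : ℝ → E d → ℝ} (hη : IsTest (η t)) (hξ : IsTest (ξ t)) :
    spatialMean U (η + ξ) t = spatialMean U η t + spatialMean U ξ t := by
  have := integral_add (hη.integrable_mul (continuous_rho hU ht))
    (hξ.integrable_mul (continuous_rho hU ht))
  simp only [spatialMean, Pi.add_apply, add_mul]
  exact this

/-- Test functions, normalized to have mean zero at each time in `[0, T]`. -/
def spaceTimeCenterMap (hU : IsPotentialPath U) (hT : T ∈ Ioc (0 : ℝ) 1) :
    spaceTimeTestFunctions d →ₗ[ℝ] ℝ × E d → ℝ where
  -- Nothing is known of `rho` outside `[0, 1]`, where additivity of the mean could fail; the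
  -- indicator makes the map linear on all of `ℝ × ℝᵈ`.
  toFun η := (slab d T).indicator fun p => η.1 p.1 p.2 - spatialMean U η.1 p.1
  map_add' η ξ := by
    refine Eq.trans ?_ (indicator_add (slab d T) _ _)
    refine indicator_congr fun p hp => ?_
    rw [Submodule.coe_add, spatialMean_add hU (Icc_subset_unit hT hp.1)
      (IsSpaceTimeTest.isTest η.2 p.1) (IsSpaceTimeTest.isTest ξ.2 p.1)]
    simp only [Pi.add_apply]
    ring
  map_smul' c η := by
    refine Eq.trans ?_ (indicator_const_smul (slab d T) c _)
    refine indicator_congr fun p _ => ?_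
    simp only [spatialMean, Submodule.coe_smul, Pi.smul_apply, smul_eq_mul, mul_assoc,
      integral_const_mul]
    ring

theorem spaceTimeCenterMap_apply (hU : IsPotentialPath U) (hT : T ∈ Ioc (0 : ℝ) 1)
    (η : spaceTimeTestFunctions d) {p : ℝ × E d} (hp : p ∈ slab d T) :
    spaceTimeCenterMap hU hT η p = η.1 p.1 p.2 - spatialMean U η.1 p.1 :=
  indicator_of_mem hp fun p : ℝ × E d => η.1 p.1 p.2 - spatialMean U η.1 p.1

theorem IsSpaceTimeTest.continuousOn_center {η : ℝ → E d → ℝ} (h : IsSpaceTimeTest η)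
    (hU : IsPotentialPath U) (hT : T ∈ Ioc (0 : ℝ) 1) :
    ContinuousOn (fun p : ℝ × E d => η p.1 p.2 - spatialMean U η p.1) (slab d T) :=
  h.contDiff_one.continuous.continuousOn.sub
    ((h.continuousOn_spatialMean hU hT).comp continuousOn_fst fun _ hp => hp.1)

theorem IsSpaceTimeTest.integrableOn_center_sq {η : ℝ → E d → ℝ} (h : IsSpaceTimeTest η)
    (hU : IsPotentialPath U) (hT : T ∈ Ioc (0 : ℝ) 1) :
    IntegrableOn (fun p : ℝ × E d => ‖η p.1 p.2 - spatialMean U η p.1‖ ^ 2 * rho U p.1 p.2)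
      (slab d T) := by
  obtain ⟨K, hK⟩ := isCompact_Icc.exists_bound_of_continuousOn (h.continuousOn_spatialMean hU hT)
  obtain ⟨M, hM⟩ := h.contDiff_one.continuous.bounded_above_of_compact_support h.2
  refine ((integrableOn_rho (d := d) hU hT).integrable.const_mul ((M + K) ^ 2)).mono'
    (aestronglyMeasurable_slab (((h.continuousOn_center hU hT).norm.pow 2).mul
      (continuousOn_rho hU hT))) ?_
  filter_upwards [ae_restrict_mem measurableSet_slab] with p hp
  have hr := rho_pos' hU hT hp.1 p.2
  rw [Real.norm_of_nonneg (by positivity)]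
  have : ‖η p.1 p.2 - spatialMean U η p.1‖ ≤ M + K :=
    (norm_sub_le _ _).trans (add_le_add (hM p) (hK p.1 hp.1))
  gcongr

theorem IsSpaceTimeTest.integrableOn_gradient_sq {η : ℝ → E d → ℝ} (h : IsSpaceTimeTest η)
    (hU : IsPotentialPath U) (hT : T ∈ Ioc (0 : ℝ) 1) :
    IntegrableOn (fun p : ℝ × E d => ‖gradient (η p.1) p.2‖ ^ 2 * rho U p.1 p.2) (slab d T) :=
  (h.admissible hU hT).gradient_sq

theorem IsSpaceTimeTest.aesm_gradient {η : ℝ → E d → ℝ} (h : IsSpaceTimeTest η) (hT : 0 < T) :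
    AEStronglyMeasurable (fun p : ℝ × E d => gradient (η p.1) p.2) (volume.restrict (slab d T)) :=
  aestronglyMeasurable_slab (continuousOn_gradient hT h.contDiff_one.contDiffOn)

/-- The Poincaré inequality integrated in time. A constant common to all times is essential here. -/
theorem SpectralGap.integral_center_sq_le (hU : IsPotentialPath U) (hT : T ∈ Ioc (0 : ℝ) 1)
    {C : ℝ} (hC : ∀ t ∈ Icc 0 T, ∀ η : E d → ℝ, IsTest η →
      ∫ x, (η x - ∫ y, η y * rho U t y) ^ 2 * rho U t x
        ≤ C * ∫ x, ‖gradient η x‖ ^ 2 * rho U t x)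
    {η : ℝ → E d → ℝ} (h : IsSpaceTimeTest η) :
    ∫ p in slab d T, ‖η p.1 p.2 - spatialMean U η p.1‖ ^ 2 * rho U p.1 p.2
      ≤ C * ∫ p in slab d T, ‖gradient (η p.1) p.2‖ ^ 2 * rho U p.1 p.2 := by
  have h1 := h.integrableOn_center_sq hU hT
  have h2 := h.integrableOn_gradient_sq hU hT
  rw [setIntegral_slab hT.1.le h1, setIntegral_slab hT.1.le h2,
    ← intervalIntegral.integral_const_mul]
  refine intervalIntegral.integral_mono_on hT.1.le
    ((intervalIntegrable_iff_integrableOn_Icc_of_le hT.1.le).2 (integrableOn_integral_slice h1))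
    (((intervalIntegrable_iff_integrableOn_Icc_of_le hT.1.le).2
      (integrableOn_integral_slice h2)).const_mul C) fun t ht => ?_
  simp only [Real.norm_eq_abs, sq_abs]
  exact hC t ht (η t) (h.isTest t)

/-- Weak solution of the transport equation in the energy space, as a limit of test functions. -/
theorem exists_global_weak_solution (hU : IsPotentialPath U) (hT : T ∈ Ioc (0 : ℝ) 1)
    (hgap : SpectralGap U T) (hS : SquareIntegrableRate U T) :
    ∃ (φ : ℝ × E d → ℝ) (G : ℝ × E d → E d) (η : ℕ → ℝ → E d → ℝ),
      AEStronglyMeasurable φ (volume.restrict (slab d T)) ∧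
      AEStronglyMeasurable G (volume.restrict (slab d T)) ∧
      IntegrableOn (fun p => ‖φ p‖ ^ 2 * rho U p.1 p.2) (slab d T) ∧
      IntegrableOn (fun p => ‖G p‖ ^ 2 * rho U p.1 p.2) (slab d T) ∧
      (∀ n, IsSpaceTimeTest (η n)) ∧
      Tendsto (fun n => ∫ p in slab d T, ‖η n p.1 p.2 - spatialMean U (η n) p.1 - φ p‖ ^ 2
        * rho U p.1 p.2) atTop (𝓝 0) ∧
      Tendsto (fun n => ∫ p in slab d T, ‖gradient (η n p.1) p.2 - G p‖ ^ 2
        * rho U p.1 p.2) atTop (𝓝 0) ∧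
      ∀ ξ, IsSpaceTimeTest ξ → ∫ p in slab d T, inner ℝ (G p) (gradient (ξ p.1) p.2)
        * rho U p.1 p.2 = ∫ p in slab d T, ξ p.1 p.2 * timeDeriv 1 (rho U) p.1 p.2 := by
  obtain ⟨C, hC⟩ := hgap
  have hmem : ∀ᵐ p ∂(volume : Measure (ℝ × E d)).restrict (slab d T), p ∈ slab d T :=
    ae_restrict_mem measurableSet_slab
  have hr := aestronglyMeasurable_slab (continuousOn_logRate (d := d) hU hT)
  have hr2 : Integrable (fun p : ℝ × E d => ‖logRate U p.1 p.2‖ ^ 2 * rho U p.1 p.2)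
      (volume.restrict (slab d T)) := by
    simp only [Real.norm_eq_abs, sq_abs]
    exact integrableOn_logRate_sq hU hT hS
  have hB : ∀ η : spaceTimeTestFunctions d, spaceTimeCenterMap hU hT η
      =ᵐ[volume.restrict (slab d T)] fun p => η.1 p.1 p.2 - spatialMean U η.1 p.1 := fun η =>
    hmem.mono fun p hp => spaceTimeCenterMap_apply hU hT η hp
  have hB2 : ∀ η : spaceTimeTestFunctions d,
      (fun p => ‖spaceTimeCenterMap hU hT η p‖ ^ 2 * rho U p.1 p.2)
      =ᵐ[volume.restrict (slab d T)]
        fun p => ‖η.1 p.1 p.2 - spatialMean U η.1 p.1‖ ^ 2 * rho U p.1 p.2 := fun η =>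
    (hB η).mono fun p hp => by simp only [hp]
  obtain ⟨G, φ, η, hG, hG2, hφ, hφ2, h1, h2, h⟩ := exists_seq_integral_inner_eq
    (aestronglyMeasurable_rho (d := d) hU hT) (hmem.mono fun p hp => rho_pos' hU hT hp.1 p.2)
    (spaceTimeGradientMap d) (spaceTimeCenterMap hU hT)
    (fun η => IsSpaceTimeTest.aesm_gradient η.2 hT.1)
    (fun η => (aestronglyMeasurable_slab
      (IsSpaceTimeTest.continuousOn_center η.2 hU hT)).congr (hB η).symm)
    (fun η => IsSpaceTimeTest.integrableOn_gradient_sq η.2 hU hT)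
    (fun η => (IsSpaceTimeTest.integrableOn_center_sq η.2 hU hT).integrable.congr (hB2 η).symm)
    (K := C) (fun η => by
      rw [integral_congr_ae (hB2 η)]
      exact SpectralGap.integral_center_sq_le hU hT hC η.2) hr hr2
  refine ⟨φ, G, fun n => (η n).1, hφ, hG, hφ2, hG2, fun n => (η n).2, ?_, h1, fun ξ hξ => ?_⟩
  · refine h2.congr fun n => integral_congr_ae ?_
    exact (hB (η n)).mono fun p hp => by simp only [hp]
  refine (h ⟨ξ, hξ⟩).trans ?_
  -- The Riesz identity pairs `logRate` with the centred test function. At each time the mean drops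
  -- out, and `logRate · rho` is `∂_t ρ`.
  have e1 : ∫ p in slab d T, inner ℝ (logRate U p.1 p.2) (spaceTimeCenterMap hU hT ⟨ξ, hξ⟩ p)
      * rho U p.1 p.2 = ∫ p in slab d T, inner ℝ (logRate U p.1 p.2)
        (ξ p.1 p.2 - spatialMean U ξ p.1) * rho U p.1 p.2 :=
    integral_congr_ae ((hB ⟨ξ, hξ⟩).mono fun p hp => by simp only [hp])
  have i1 := integrable_inner_mul (aestronglyMeasurable_rho (d := d) hU hT) (ae_rho_nonneg hU hT)
    hr (aestronglyMeasurable_slab (hξ.continuousOn_center hU hT)) hr2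
    (hξ.integrableOn_center_sq hU hT)
  have i2 := hξ.integrableOn_mul (continuousOn_timeDeriv_rho hU hT)
  refine e1.trans ?_
  rw [setIntegral_slab hT.1.le i1, setIntegral_slab hT.1.le i2]
  refine intervalIntegral.integral_congr fun t ht => ?_
  rw [uIcc_of_le hT.1.le] at ht
  have ht1 := Icc_subset_unit hT ht
  have e : (fun x => logRate U t x * rho U t x) = timeDeriv 1 (rho U) t :=
    funext (logRate_mul_rho hU ht1)
  have e2 := integral_mul_sub_const (r := logRate U t) (η := ξ t) (w := rho U t)
    (by simp_rw [logRate_mul_rho hU ht1]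
        exact (hξ.isTest t).integrable_mul (continuous_timeDeriv_rho hU ht1))
    (e ▸ integrable_timeDeriv_rho hU ht1) (by rw [e]; exact integral_timeDeriv_rho hU ht1)
    (spatialMean U ξ t)
  simp_rw [logRate_mul_rho hU ht1] at e2
  exact e2

end GlobalExistence

/-! ### From the slab to almost every time. -/

section AlmostEveryTime

variable {d : ℕ} {U : ℝ → E d → ℝ} {T : ℝ}

/-- For nonnegative integrands, convergence on the slab is `L¹` convergence in time of the slice
integrals, hence convergence in measure, hence almost everywhere along a subsequence. -/
theorem exists_subseq_ae_tendsto_slice (hT : 0 < T) {f : ℕ → ℝ × E d → ℝ}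
    (hf : ∀ n, IntegrableOn (f n) (slab d T))
    (h0 : ∀ n, ∀ᵐ p ∂volume.restrict (slab d T), 0 ≤ f n p)
    (h : Tendsto (fun n => ∫ p in slab d T, f n p) atTop (𝓝 0)) :
    ∃ ns : ℕ → ℕ, StrictMono ns ∧ ∀ᵐ t ∂volume.restrict (Icc 0 T),
      Tendsto (fun n => ∫ x, f (ns n) (t, x)) atTop (𝓝 0) := by
  have hi := fun n => integrableOn_integral_slice (hf n)
  have hp : ∀ n, ∀ᵐ t ∂volume.restrict (Icc 0 T), 0 ≤ ∫ x, f n (t, x) := fun n =>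
    (ae_ae_of_ae_slab (h0 n)).mono fun t ht => integral_nonneg_of_ae ht
  refine (tendstoInMeasure_of_tendsto_eLpNorm (f := fun n t => ∫ x, f n (t, x))
    (g := fun _ => (0 : ℝ)) one_ne_zero (fun n => (hi n).aestronglyMeasurable)
    aestronglyMeasurable_const ?_).exists_seq_tendsto_ae
  have e : ∀ n, eLpNorm ((fun t => ∫ x, f n (t, x)) - fun _ => (0 : ℝ)) 1
      (volume.restrict (Icc 0 T)) = ENNReal.ofReal (∫ p in slab d T, f n p) := by
    intro n
    have e1 : ((fun t => ∫ x, f n (t, x)) - fun _ => (0 : ℝ)) = fun t => ∫ x, f n (t, x) := by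
      ext t
      simp
    rw [e1, eLpNorm_one_eq_lintegral_enorm, ← ofReal_integral_norm_eq_lintegral_enorm (hi n),
      setIntegral_slab hT.le (hf n), intervalIntegral.integral_of_le hT.le,
      ← integral_Icc_eq_integral_Ioc]
    congr 1
    exact integral_congr_ae ((hp n).mono fun t ht => Real.norm_of_nonneg ht)
  simp_rw [e]
  simpa using ENNReal.tendsto_ofReal h

theorem IsTest.exists_radius {h : E d → ℝ} (hh : IsTest h) : ∃ R, ∀ x, R < ‖x‖ → h x = 0 := by
  obtain ⟨R, hR⟩ := hh.2.isCompact.isBounded.subset_closedBall (0 : E d)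
  refine ⟨R, fun x hx => ?_⟩
  by_contra h0
  have := hR (subset_tsupport h h0)
  rw [mem_closedBall_zero_iff] at this
  linarith

/-- A countable set of test functions which is dense for the `C¹` norm. -/
theorem exists_countable_dense_isTest (d : ℕ) :
    ∃ S : Set (E d → ℝ), S.Countable ∧ (∀ h ∈ S, IsTest h) ∧
      ∀ h, IsTest h → ∀ ε > 0, ∃ k ∈ S, ∀ x, |h x - k x| ≤ ε ∧
        ‖gradient h x - gradient k x‖ ≤ ε := by
  let D : ℕ → Type := fun N => {h : E d → ℝ // IsTest h ∧ ∀ x, (N : ℝ) < ‖x‖ → h x = 0}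
  let J : ∀ N : ℕ, D N → C(Metric.closedBall (0 : E d) N, ℝ × E d) := fun N h =>
    ⟨fun x => (h.1 x, gradient h.1 x), (h.2.1.contDiff_one.continuous.prodMk
      (continuous_gradient h.2.1.contDiff_one)).comp continuous_subtype_val⟩
  have key : ∀ N : ℕ, ∃ s : Set (D N), s.Countable ∧
      ∀ h : D N, ∀ ε > 0, ∃ k ∈ s, dist (J N k) (J N h) < ε := by
    intro N
    -- Functions supported in a fixed ball carry the topology induced by `h ↦ (h, ∇h)` from
    -- continuous maps on a compact ball. That space is second countable, and the induced topology
    -- inherits this, whence a countable dense subset.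
    let _ : TopologicalSpace (D N) := TopologicalSpace.induced (J N) inferInstance
    have := TopologicalSpace.secondCountableTopology_induced (D N) _ (J N)
    obtain ⟨s, hs, hd⟩ := TopologicalSpace.exists_countable_dense (D N)
    refine ⟨s, hs, fun h ε hε => ?_⟩
    obtain ⟨k, hk, hks⟩ := hd.exists_mem_open
      (Metric.isOpen_ball.preimage (continuous_induced_dom (f := J N)))
      ⟨h, Metric.mem_ball_self hε⟩
    exact ⟨k, hk, hks⟩
  choose s hs hd using key
  refine ⟨⋃ N, Subtype.val '' s N, countable_iUnion fun N => (hs N).image _, ?_, ?_⟩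
  · rintro h hh
    obtain ⟨N, k, -, rfl⟩ := mem_iUnion.1 hh
    exact k.2.1
  intro h hh ε hε
  obtain ⟨R, hR⟩ := hh.exists_radius
  obtain ⟨N, hN⟩ := exists_nat_ge R
  have hN' : ∀ x, (N : ℝ) < ‖x‖ → h x = 0 := fun x hx => hR x (hN.trans_lt hx)
  obtain ⟨k, hk, hkd⟩ := hd N ⟨h, hh, hN'⟩ ε hε
  refine ⟨k.1, mem_iUnion.2 ⟨N, k, hk, rfl⟩, fun x => ?_⟩
  rcases le_or_gt ‖x‖ N with hx | hx
  · have h1 := (ContinuousMap.dist_apply_le_dist (f := J N k) (g := J N ⟨h, hh, hN'⟩)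
      ⟨x, mem_closedBall_zero_iff.2 hx⟩).trans hkd.le
    rw [Prod.dist_eq, max_le_iff, dist_comm, dist_comm (J N k _).2, Real.dist_eq, dist_eq_norm]
      at h1
    exact h1
  · rw [hN' x hx, k.2.2 x hx, gradient_eq_zero_of_norm_gt hN' hx,
      gradient_eq_zero_of_norm_gt k.2.2 hx]
    simp [hε.le]

/-- The weak transport equation holds for all test functions if it holds for a `C¹`-dense set. -/
theorem solvesTransportWeakly_of_dense (hU : IsPotentialPath U) {t : ℝ} (ht : t ∈ Icc (0 : ℝ) 1)
    {G : E d → E d} (hG : AEStronglyMeasurable G) (hG2 : Integrable fun x => ‖G x‖ ^ 2 * rho U t x)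
    {S : Set (E d → ℝ)} (hS : ∀ h ∈ S, IsTest h)
    (hd : ∀ h, IsTest h → ∀ ε > 0, ∃ k ∈ S, ∀ x, |h x - k x| ≤ ε ∧
      ‖gradient h x - gradient k x‖ ≤ ε)
    (h : ∀ k ∈ S, ∫ x, inner ℝ (G x) (gradient k x) * rho U t x
      = ∫ x, k x * timeDeriv 1 (rho U) t x) : SolvesTransportWeakly U t G := by
  intro η hη
  have hw := continuous_rho hU ht
  have hw0 := rho_pos hU ht
  have hi1 : Integrable fun x => ‖G x‖ * rho U t x :=
    integrable_mul_of_sq hw hw0 (integrable_rho hU ht) hG.norm (by simpa using hG2)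
  have hi2 := (integrable_timeDeriv_rho hU ht).norm
  have hI : ∀ k, IsTest k → Integrable fun x => inner ℝ (G x) (gradient k x) * rho U t x :=
    fun k hk => integrable_inner_mul hw.aestronglyMeasurable
      (Eventually.of_forall fun x => (hw0 x).le) hG hk.aesm_gradient hG2
      (hk.integrable_gradient_sq_mul hw)
  have hJ : ∀ k, IsTest k → Integrable fun x => k x * timeDeriv 1 (rho U) t x := fun k hk =>
    hk.integrable_mul (continuous_timeDeriv_rho hU ht)
  set M := (∫ x, ‖G x‖ * rho U t x) + ∫ x, ‖timeDeriv 1 (rho U) t x‖ with hM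
  have hM0 : 0 ≤ M := add_nonneg (integral_nonneg fun x => mul_nonneg (norm_nonneg _) (hw0 x).le)
    (integral_nonneg fun x => norm_nonneg _)
  rw [← sub_eq_zero, ← norm_eq_zero]
  refine le_antisymm (le_of_forall_pos_le_add fun δ hδ => ?_) (norm_nonneg _)
  -- Replacing `η` by `k` changes the difference of the two sides by at most `M` times their `C¹`
  -- distance; `M + 1` keeps the quotient defined when `M = 0`.
  obtain ⟨k, hk, hkd⟩ := hd η hη (δ / (M + 1)) (by positivity)
  have e1 : (∫ x, inner ℝ (G x) (gradient η x) * rho U t x)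
      - ∫ x, η x * timeDeriv 1 (rho U) t x
      = (∫ x, inner ℝ (G x) (gradient η x - gradient k x) * rho U t x)
        - ∫ x, (η x - k x) * timeDeriv 1 (rho U) t x := by
    simp_rw [inner_sub_right, sub_mul]
    rw [integral_sub (hI η hη) (hI k (hS k hk)), integral_sub (hJ η hη) (hJ k (hS k hk)), h k hk]
    ring
  have b1 : ‖∫ x, inner ℝ (G x) (gradient η x - gradient k x) * rho U t x‖
      ≤ δ / (M + 1) * ∫ x, ‖G x‖ * rho U t x := by
    rw [← integral_const_mul]
    refine norm_integral_le_of_norm_le (hi1.const_mul _) (Eventually.of_forall fun x => ?_)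
    rw [norm_mul, Real.norm_of_nonneg (hw0 x).le, ← mul_assoc]
    refine mul_le_mul_of_nonneg_right ((norm_inner_le_norm _ _).trans ?_) (hw0 x).le
    rw [mul_comm]
    exact mul_le_mul_of_nonneg_right (hkd x).2 (norm_nonneg _)
  have b2 : ‖∫ x, (η x - k x) * timeDeriv 1 (rho U) t x‖
      ≤ δ / (M + 1) * ∫ x, ‖timeDeriv 1 (rho U) t x‖ := by
    rw [← integral_const_mul]
    refine norm_integral_le_of_norm_le (hi2.const_mul _) (Eventually.of_forall fun x => ?_)
    rw [norm_mul]
    exact mul_le_mul_of_nonneg_right (hkd x).1 (norm_nonneg _)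
  rw [e1, zero_add]
  refine (norm_sub_le _ _).trans ((add_le_add b1 b2).trans ?_)
  rw [← mul_add, ← hM, div_mul_eq_mul_div, div_le_iff₀ (by positivity)]
  nlinarith

theorem ae_eq_zero_of_setIntegral_mul_eq_zero {a : ℝ → ℝ} (ha : IntegrableOn a (Icc 0 T))
    (h : ∀ c : ℝ → ℝ, ContDiff ℝ (⊤ : ℕ∞) c → HasCompactSupport c →
      ∫ t in Icc 0 T, c t * a t = 0) :
    ∀ᵐ t ∂volume.restrict (Icc 0 T), a t = 0 := by
  have key := ae_eq_zero_of_integral_contDiff_smul_eq_zero (μ := (volume : Measure ℝ))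
    ((integrable_indicator_iff measurableSet_Icc).2 ha).locallyIntegrable fun c hc hcs => by
      simp_rw [← indicator_smul_apply (Icc 0 T)]
      rw [integral_indicator measurableSet_Icc]
      exact h c hc hcs
  filter_upwards [ae_restrict_of_ae key, ae_restrict_mem measurableSet_Icc] with t h1 ht
  rwa [indicator_of_mem ht] at h1

theorem integrableOn_inner_gradient_mul_rho (hU : IsPotentialPath U) (hT : T ∈ Ioc (0 : ℝ) 1)
    {G : ℝ × E d → E d} (hG : AEStronglyMeasurable G (volume.restrict (slab d T)))
    (hG2 : IntegrableOn (fun p => ‖G p‖ ^ 2 * rho U p.1 p.2) (slab d T))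
    {h : E d → ℝ} (hh : IsTest h) :
    IntegrableOn (fun p : ℝ × E d => inner ℝ (G p) (gradient h p.2) * rho U p.1 p.2)
      (slab d T) := by
  obtain ⟨R, hR⟩ := hh.exists_radius
  have hgc : Continuous fun p : ℝ × E d => gradient h p.2 :=
    (continuous_gradient hh.contDiff_one).comp continuous_snd
  have i0 : IntegrableOn (fun p : ℝ × E d => ‖gradient h p.2‖ ^ 2 * rho U p.1 p.2) (slab d T) :=
    integrableOn_slab_of_continuousOn
      ((hgc.norm.pow 2).continuousOn.mul (continuousOn_rho hU hT)) R fun t _ x hx => by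
        simp only [gradient_eq_zero_of_norm_gt hR hx, norm_zero, ne_eq, OfNat.ofNat_ne_zero,
          not_false_eq_true, zero_pow, zero_mul]
  exact integrable_inner_mul (aestronglyMeasurable_rho hU hT) (ae_rho_nonneg hU hT) hG
    hgc.aestronglyMeasurable hG2 i0

theorem integrableOn_mul_timeDeriv_rho (hU : IsPotentialPath U) (hT : T ∈ Ioc (0 : ℝ) 1)
    {h : E d → ℝ} (hh : IsTest h) :
    IntegrableOn (fun p : ℝ × E d => h p.2 * timeDeriv 1 (rho U) p.1 p.2) (slab d T) := by
  obtain ⟨R, hR⟩ := hh.exists_radius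
  have hc : Continuous fun p : ℝ × E d => h p.2 := hh.contDiff_one.continuous.comp continuous_snd
  exact integrableOn_slab_of_continuousOn
    (hc.continuousOn.mul (continuousOn_timeDeriv_rho hU hT)) R
    fun t _ x hx => by simp only [hR x hx, zero_mul]

/-- Products `c(t) h(x)` localize the equation in time. The exceptional null set depends on `h`,
which is why a countable dense family of test functions is needed afterwards. -/
theorem ae_integral_inner_gradient_eq (hU : IsPotentialPath U) (hT : T ∈ Ioc (0 : ℝ) 1)
    {G : ℝ × E d → E d} (hG : AEStronglyMeasurable G (volume.restrict (slab d T)))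
    (hG2 : IntegrableOn (fun p => ‖G p‖ ^ 2 * rho U p.1 p.2) (slab d T))
    (heq : ∀ ξ, IsSpaceTimeTest ξ → ∫ p in slab d T, inner ℝ (G p) (gradient (ξ p.1) p.2)
        * rho U p.1 p.2 = ∫ p in slab d T, ξ p.1 p.2 * timeDeriv 1 (rho U) p.1 p.2)
    {h : E d → ℝ} (hh : IsTest h) :
    ∀ᵐ t ∂volume.restrict (Icc 0 T), ∫ x, inner ℝ (G (t, x)) (gradient h x) * rho U t x
      = ∫ x, h x * timeDeriv 1 (rho U) t x := by
  have i1 := integrableOn_inner_gradient_mul_rho hU hT hG hG2 hh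
  have i2 := integrableOn_mul_timeDeriv_rho hU hT hh
  have key := ae_eq_zero_of_setIntegral_mul_eq_zero (integrableOn_integral_slice (i1.sub i2))
    fun c hc hcs => by
      obtain ⟨ξ, hξ, hξe⟩ : ∃ ξ : ℝ → E d → ℝ, IsSpaceTimeTest ξ ∧ ∀ t, ξ t = fun x => c t * h x :=
        ⟨_, IsSpaceTimeTest.mul hc hcs hh, fun _ => rfl⟩
      have hg : ∀ t x, gradient (ξ t) x = c t • gradient h x := fun t x => by
        rw [hξe]
        exact gradient_const_mul _ (hh.differentiableAt _)
      have e : ∀ t, ∫ x, (inner ℝ (G (t, x)) (gradient (ξ t) x) * rho U t x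
          - ξ t x * timeDeriv 1 (rho U) t x)
          = c t * ∫ x, (inner ℝ (G (t, x)) (gradient h x) * rho U t x
            - h x * timeDeriv 1 (rho U) t x) := by
        intro t
        rw [← integral_const_mul]
        refine integral_congr_ae (Eventually.of_forall fun x => ?_)
        simp only [hg, congrFun (hξe t), inner_smul_right]
        ring
      have j1 : IntegrableOn (fun p : ℝ × E d => inner ℝ (G p) (gradient (ξ p.1) p.2)
          * rho U p.1 p.2) (slab d T) :=
        integrable_inner_mul (aestronglyMeasurable_rho hU hT)
          (ae_rho_nonneg hU hT) hG (hξ.aesm_gradient hT.1) hG2 (hξ.integrableOn_gradient_sq hU hT)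
      have j2 := hξ.integrableOn_mul (continuousOn_timeDeriv_rho hU hT)
      have h1 := (integral_sub j1 j2).trans (sub_eq_zero.2 (heq ξ hξ))
      have j3 : IntegrableOn (fun p : ℝ × E d => inner ℝ (G p) (gradient (ξ p.1) p.2)
          * rho U p.1 p.2 - ξ p.1 p.2 * timeDeriv 1 (rho U) p.1 p.2) (slab d T) := j1.sub j2
      rw [setIntegral_slab hT.1.le j3, intervalIntegral.integral_of_le hT.1.le,
        ← integral_Icc_eq_integral_Ioc] at h1
      simp only [e] at h1
      exact h1
  filter_upwards [key, ae_integrable_slice i1, ae_integrable_slice i2] with t h1 a1 a2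
  rw [← sub_eq_zero, ← integral_sub a1 a2]
  exact h1

end AlmostEveryTime

/-! ### The minimizer in the energy space. -/

section EnergySpace

variable {d : ℕ} {U : ℝ → E d → ℝ} {T : ℝ}

theorem ae_aestronglyMeasurable_slice {F : Type*} [TopologicalSpace F] {f : ℝ × E d → F}
    (hf : AEStronglyMeasurable f (volume.restrict (slab d T))) :
    ∀ᵐ t ∂volume.restrict (Icc 0 T), AEStronglyMeasurable fun x => f (t, x) := by
  rw [volume_restrict_slab] at hf
  exact hf.prodMk_left

/-- Two successive subsequences make both the centred functions and the gradients converge on almost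
every slice, and weak gradients are closed under such limits. On a slice, centring only subtracts a
constant. -/
theorem ae_hasWeakGradient_of_tendsto (hU : IsPotentialPath U) (hT : T ∈ Ioc (0 : ℝ) 1)
    {φ : ℝ × E d → ℝ} {G : ℝ × E d → E d} {η : ℕ → ℝ → E d → ℝ}
    (hφ : AEStronglyMeasurable φ (volume.restrict (slab d T)))
    (hG : AEStronglyMeasurable G (volume.restrict (slab d T)))
    (hφ2 : IntegrableOn (fun p => ‖φ p‖ ^ 2 * rho U p.1 p.2) (slab d T))
    (hG2 : IntegrableOn (fun p => ‖G p‖ ^ 2 * rho U p.1 p.2) (slab d T))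
    (hη : ∀ n, IsSpaceTimeTest (η n))
    (h1 : Tendsto (fun n => ∫ p in slab d T, ‖η n p.1 p.2 - spatialMean U (η n) p.1 - φ p‖ ^ 2
        * rho U p.1 p.2) atTop (𝓝 0))
    (h2 : Tendsto (fun n => ∫ p in slab d T, ‖gradient (η n p.1) p.2 - G p‖ ^ 2
        * rho U p.1 p.2) atTop (𝓝 0)) :
    ∀ᵐ t ∂volume.restrict (Icc 0 T),
      HasWeakGradient (fun x => φ (t, x)) (fun x => G (t, x)) := by
  have hρm := aestronglyMeasurable_rho (d := d) hU hT
  have hρ0 := ae_rho_nonneg (d := d) hU hT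
  have i1 : ∀ n, IntegrableOn (fun p : ℝ × E d => ‖η n p.1 p.2 - spatialMean U (η n) p.1 - φ p‖ ^ 2
      * rho U p.1 p.2) (slab d T) := fun n =>
    integrable_sub_sq_mul hρm hρ0 (aestronglyMeasurable_slab ((hη n).continuousOn_center hU hT)) hφ
      ((hη n).integrableOn_center_sq hU hT) hφ2
  have i2 : ∀ n, IntegrableOn (fun p : ℝ × E d => ‖gradient (η n p.1) p.2 - G p‖ ^ 2
      * rho U p.1 p.2) (slab d T) := fun n =>
    integrable_sub_sq_mul hρm hρ0 ((hη n).aesm_gradient hT.1) hG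
      ((hη n).integrableOn_gradient_sq hU hT) hG2
  obtain ⟨ns, hns, l1⟩ := exists_subseq_ae_tendsto_slice hT.1 i1
    (fun n => hρ0.mono fun p hp => by positivity) h1
  obtain ⟨ms, hms, l2⟩ := exists_subseq_ae_tendsto_slice hT.1 (fun n => i2 (ns n))
    (fun n => hρ0.mono fun p hp => by positivity) (h2.comp hns.tendsto_atTop)
  filter_upwards [l1, l2, ae_aestronglyMeasurable_slice hφ, ae_aestronglyMeasurable_slice hG,
    ae_integrable_slice hφ2, ae_integrable_slice hG2, ae_restrict_mem measurableSet_Icc,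
    ae_all_iff.2 fun n => ae_integrable_slice ((hη n).integrableOn_center_sq hU hT)]
    with t m1 m2 a1 a2 b1 b2 ht c1
  exact hasWeakGradient_of_tendsto (continuous_rho hU (Icc_subset_unit hT ht))
    (rho_pos' hU hT ht) (η := fun n => η (ns (ms n)) t)
    (c := fun n => spatialMean U (η (ns (ms n))) t) (fun n => (hη _).isTest t)
    (fun n => c1 _) a1 a2 b1 b2 (m1.comp hms.tendsto_atTop) m2

/-- The solution of the weak transport equation in the energy space. -/
theorem exists_finiteEnergy_solution (hU : IsPotentialPath U) (hT : T ∈ Ioc (0 : ℝ) 1)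
    (hgap : SpectralGap U T) (hS : SquareIntegrableRate U T) :
    ∃ φ G, FiniteEnergy U T φ G ∧
      (∀ t ∈ Icc 0 T, HasWeakGradient (φ t) (G t) ∧ SolvesTransportWeakly U t (G t)) ∧
      ∃ η : ℕ → ℝ → E d → ℝ, (∀ n, IsSpaceTimeTest (η n)) ∧
        Tendsto (fun n => ∫ p in slab d T, ‖gradient (η n p.1) p.2 - G p.1 p.2‖ ^ 2
          * rho U p.1 p.2) atTop (𝓝 0) := by
  obtain ⟨φ, G, η, hφ, hG, hφ2, hG2, hη, h1, h2, heq⟩ :=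
    exists_global_weak_solution hU hT hgap hS
  obtain ⟨S, hSc, hSt, hSd⟩ := exists_countable_dense_isTest d
  have hgrad := ae_hasWeakGradient_of_tendsto hU hT hφ hG hφ2 hG2 hη h1 h2
  have hdense := (ae_ball_iff hSc).2 fun k hk =>
    ae_integral_inner_gradient_eq hU hT hG hG2 heq (hSt k hk)
  have hgood : ∀ᵐ t ∂volume.restrict (Icc 0 T),
      HasWeakGradient (fun x => φ (t, x)) (fun x => G (t, x)) ∧
        SolvesTransportWeakly U t fun x => G (t, x) := by
    filter_upwards [hgrad, hdense, ae_aestronglyMeasurable_slice hG, ae_integrable_slice hG2,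
      ae_restrict_mem measurableSet_Icc] with t m1 m2 a1 a2 ht
    exact ⟨m1, solvesTransportWeakly_of_dense hU (Icc_subset_unit hT ht) a1 a2 hSt hSd m2⟩
  -- Good times keep the solution found on the slab; at each other time of `[0, T]` a solution for
  -- that time alone is chosen. The change affects only a null set of times, so measurability and
  -- the integrals survive.
  have hex : ∀ t, ∃ v : (E d → ℝ) × (E d → E d),
      (t ∈ Icc 0 T → HasWeakGradient v.1 v.2 ∧ SolvesTransportWeakly U t v.2) ∧
      ((HasWeakGradient (fun x => φ (t, x)) (fun x => G (t, x)) ∧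
        SolvesTransportWeakly U t fun x => G (t, x)) →
          v = (fun x => φ (t, x), fun x => G (t, x))) := by
    intro t
    by_cases h : HasWeakGradient (fun x => φ (t, x)) (fun x => G (t, x)) ∧
        SolvesTransportWeakly U t fun x => G (t, x)
    · exact ⟨(_, _), fun _ => h, fun _ => rfl⟩
    by_cases ht : t ∈ Icc 0 T
    · obtain ⟨f, g, h3⟩ := exists_weak_solution_at hU hT hgap hS ht
      exact ⟨(f, g), fun _ => h3, fun h4 => absurd h4 h⟩
    · exact ⟨(0, 0), fun h3 => absurd h3 ht, fun h4 => absurd h4 h⟩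
  choose v hv1 hv2 using hex
  have hae : ∀ᵐ p ∂(volume : Measure (ℝ × E d)).restrict (slab d T),
      v p.1 = (fun x => φ (p.1, x), fun x => G (p.1, x)) :=
    ae_slab_of_ae (hgood.mono fun t ht => hv2 t ht)
  have e1 : φ =ᵐ[volume.restrict (slab d T)] fun p => (v p.1).1 p.2 :=
    hae.mono fun p hp => by simp only [hp]
  have e2 : G =ᵐ[volume.restrict (slab d T)] fun p => (v p.1).2 p.2 :=
    hae.mono fun p hp => by simp only [hp]
  refine ⟨fun t => (v t).1, fun t => (v t).2, ⟨hφ.congr e1, hG.congr e2, ?_, ?_, ?_⟩,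
    hv1, η, hη, ?_⟩
  · refine hφ2.integrable.congr (e1.mono fun p hp => ?_)
    simp only [Real.norm_eq_abs, sq_abs, hp]
  · exact hG2.integrable.congr (e2.mono fun p hp => by simp only [hp])
  · exact (ae_restrict_mem measurableSet_Icc).mono fun t ht => (hv1 t ht).1
  · exact h2.congr fun n => integral_congr_ae (e2.mono fun p hp => by simp only [hp])

theorem integrableOn_norm_logRate_sq (hU : IsPotentialPath U) (hT : T ∈ Ioc (0 : ℝ) 1)
    (hS : SquareIntegrableRate U T) :
    IntegrableOn (fun p : ℝ × E d => ‖logRate U p.1 p.2‖ ^ 2 * rho U p.1 p.2) (slab d T) := by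
  simp only [Real.norm_eq_abs, sq_abs]
  exact integrableOn_logRate_sq hU hT hS

/-- Writing `∂_t ρ = logRate · ρ` makes this a pairing of two functions that are square integrable
for `ρ`. -/
theorem integrableOn_mul_timeDeriv_rho_of_sq (hU : IsPotentialPath U) (hT : T ∈ Ioc (0 : ℝ) 1)
    (hS : SquareIntegrableRate U T) {ψ : ℝ → E d → ℝ}
    (hψ : AEStronglyMeasurable (fun p : ℝ × E d => ψ p.1 p.2) (volume.restrict (slab d T)))
    (hψ2 : IntegrableOn (fun p : ℝ × E d => ψ p.1 p.2 ^ 2 * rho U p.1 p.2) (slab d T)) :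
    IntegrableOn (fun p : ℝ × E d => ψ p.1 p.2 * timeDeriv 1 (rho U) p.1 p.2) (slab d T) := by
  have hψ2' : IntegrableOn (fun p : ℝ × E d => ‖ψ p.1 p.2‖ ^ 2 * rho U p.1 p.2) (slab d T) := by
    simpa only [Real.norm_eq_abs, sq_abs] using hψ2
  have h := integrable_inner_mul (aestronglyMeasurable_rho (d := d) hU hT) (ae_rho_nonneg hU hT)
    (aestronglyMeasurable_slab (continuousOn_logRate hU hT)) hψ
    (integrableOn_norm_logRate_sq hU hT hS) hψ2'
  refine h.congr ?_
  filter_upwards [ae_restrict_mem measurableSet_slab] with p hp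
  simp only [RCLike.inner_apply, conj_trivial]
  rw [mul_assoc, logRate_mul_rho hU (Icc_subset_unit hT hp.1)]

theorem FiniteEnergy.energyLoss_eq_setIntegral (hU : IsPotentialPath U) (hT : T ∈ Ioc (0 : ℝ) 1)
    (hS : SquareIntegrableRate U T) {ψ : ℝ → E d → ℝ} {H : ℝ → E d → E d}
    (hψ : FiniteEnergy U T ψ H) :
    energyLoss U T ψ H = 1 / 2 * (∫ p in slab d T, ‖H p.1 p.2‖ ^ 2 * rho U p.1 p.2)
      - ∫ p in slab d T, ψ p.1 p.2 * timeDeriv 1 (rho U) p.1 p.2 := by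
  have i1 := hψ.gradient_sq.integrable.const_mul (1 / 2)
  have i2 := integrableOn_mul_timeDeriv_rho_of_sq hU hT hS hψ.aesm hψ.sq
  have h := setIntegral_slab hT.1.le (i1.sub i2)
  rw [← integral_const_mul, ← integral_sub i1 i2]
  simp only [energyLoss, mul_assoc]
  exact h.symm

/-- The weak transport equation tested against a weakly differentiable function. -/
theorem SolvesTransportWeakly.integral_inner_eq (hU : IsPotentialPath U) (hT : T ∈ Ioc (0 : ℝ) 1)
    (hS : SquareIntegrableRate U T) {t : ℝ} (ht : t ∈ Icc 0 T) {g : E d → E d}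
    (hg : SolvesTransportWeakly U t g) (hgm : AEStronglyMeasurable g)
    (hg2 : Integrable fun x => ‖g x‖ ^ 2 * rho U t x) {f : E d → ℝ} {h : E d → E d}
    (hfh : HasWeakGradient f h) (hf2 : Integrable fun x => ‖f x‖ ^ 2 * rho U t x)
    (hh2 : Integrable fun x => ‖h x‖ ^ 2 * rho U t x) :
    ∫ x, inner ℝ (g x) (h x) * rho U t x = ∫ x, f x * timeDeriv 1 (rho U) t x := by
  have ht1 := Icc_subset_unit hT ht
  have key := integral_inner_weakGradient_eq (continuous_rho hU ht1) (rho_pos hU ht1) hfh hf2 hh2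
    hgm hg2 (continuousOn_slice (continuousOn_logRate hU hT) ht).aestronglyMeasurable
    (by simpa only [Real.norm_eq_abs, sq_abs] using integrable_logRate_sq hU hT hS ht)
    (fun η hη => by
      simp_rw [logRate_mul_rho hU ht1]
      exact hg η hη)
  simp_rw [logRate_mul_rho hU ht1] at key
  exact key

/-- Completing the square in the functional of the energy space. -/
theorem FiniteEnergy.energyLoss_eq (hU : IsPotentialPath U) (hT : T ∈ Ioc (0 : ℝ) 1)
    (hS : SquareIntegrableRate U T) {ψ : ℝ → E d → ℝ} {H G : ℝ → E d → E d}
    (hψ : FiniteEnergy U T ψ H)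
    (hG : AEStronglyMeasurable (fun p : ℝ × E d => G p.1 p.2) (volume.restrict (slab d T)))
    (hG2 : IntegrableOn (fun p : ℝ × E d => ‖G p.1 p.2‖ ^ 2 * rho U p.1 p.2) (slab d T))
    (hGs : ∀ t ∈ Icc 0 T, SolvesTransportWeakly U t (G t)) :
    energyLoss U T ψ H
      = 1 / 2 * (∫ p in slab d T, ‖H p.1 p.2 - G p.1 p.2‖ ^ 2 * rho U p.1 p.2)
        - 1 / 2 * ∫ p in slab d T, ‖G p.1 p.2‖ ^ 2 * rho U p.1 p.2 := by
  have hρm := aestronglyMeasurable_rho (d := d) hU hT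
  have hρ0 := ae_rho_nonneg (d := d) hU hT
  have hψ2 : IntegrableOn (fun p : ℝ × E d => ‖ψ p.1 p.2‖ ^ 2 * rho U p.1 p.2) (slab d T) := by
    simpa only [Real.norm_eq_abs, sq_abs] using hψ.sq
  have i1 : IntegrableOn (fun p : ℝ × E d => inner ℝ (G p.1 p.2) (H p.1 p.2) * rho U p.1 p.2)
      (slab d T) :=
    integrable_inner_mul hρm hρ0 hG hψ.aesm_gradient hG2 hψ.gradient_sq
  have i2 := integrableOn_mul_timeDeriv_rho_of_sq hU hT hS hψ.aesm hψ.sq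
  -- At almost every time the weak equation may be tested against the competitor itself, by density
  -- of test functions; this turns the linear term into the cross term of the square.
  have e : ∫ p in slab d T, inner ℝ (G p.1 p.2) (H p.1 p.2) * rho U p.1 p.2
      = ∫ p in slab d T, ψ p.1 p.2 * timeDeriv 1 (rho U) p.1 p.2 := by
    rw [setIntegral_slab hT.1.le i1, setIntegral_slab hT.1.le i2,
      intervalIntegral.integral_of_le hT.1.le, intervalIntegral.integral_of_le hT.1.le,
      ← integral_Icc_eq_integral_Ioc, ← integral_Icc_eq_integral_Ioc]
    refine integral_congr_ae ?_
    filter_upwards [hψ.weakGradient, ae_aestronglyMeasurable_slice hG, ae_integrable_slice hG2,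
      ae_integrable_slice hψ2, ae_integrable_slice hψ.gradient_sq,
      ae_restrict_mem measurableSet_Icc] with t h1 h2 h3 h4 h5 ht
    exact (hGs t ht).integral_inner_eq hU hT hS ht h2 h3 h1 h4 h5
  rw [hψ.energyLoss_eq_setIntegral hU hT hS, ← e,
    integral_sub_sq_mul hρm hρ0 hψ.aesm_gradient hG hψ.gradient_sq hG2]
  simp_rw [real_inner_comm]
  ring

theorem Admissible.finiteEnergy (hT : T ∈ Ioc (0 : ℝ) 1) {ζ : ℝ → E d → ℝ}
    (hζ : Admissible U T ζ)
    (hζ2 : IntegrableOn (fun p : ℝ × E d => ζ p.1 p.2 ^ 2 * rho U p.1 p.2) (slab d T)) :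
    FiniteEnergy U T ζ fun t => gradient (ζ t) :=
  ⟨aestronglyMeasurable_slab hζ.contDiffOn.continuousOn,
    aestronglyMeasurable_slab (continuousOn_gradient hT.1 hζ.contDiffOn), hζ2, hζ.gradient_sq,
    (ae_restrict_mem measurableSet_Icc).mono fun _ ht =>
      hasWeakGradient_of_contDiff (contDiff_slice hζ.contDiffOn ht)⟩

/-- Integration by parts in time. Square integrability of `ζ` is what makes `ζ ∂_t ρ` integrable,
which admissibility alone does not provide. -/
theorem Admissible.energyLoss_eq (hU : IsPotentialPath U) (hT : T ∈ Ioc (0 : ℝ) 1)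
    (hS : SquareIntegrableRate U T) {ζ : ℝ → E d → ℝ} (hζ : Admissible U T ζ)
    (hζ2 : IntegrableOn (fun p : ℝ × E d => ζ p.1 p.2 ^ 2 * rho U p.1 p.2) (slab d T)) :
    energyLoss U T ζ (fun t => gradient (ζ t)) = actionLoss U T ζ := by
  have hF := hζ.finiteEnergy hT hζ2
  have h1 := setIntegral_timeDeriv_mul_rho hU hT hζ.contDiffOn hζ.timeDeriv
    (integrableOn_mul_timeDeriv_rho_of_sq hU hT hS hF.aesm hζ2)
  rw [hF.energyLoss_eq_setIntegral hU hT hS, actionLoss_eq hT hζ, integral_sub hζ.initial hζ.final]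
  rw [integral_sub hζ.final hζ.initial] at h1
  linarith

/-- Enlarges the test class from `C^∞` to `C¹` with compact support, so that the square can also be
completed for classical potentials. -/
theorem isWeakVelocity_of_solvesTransportWeakly (hU : IsPotentialPath U)
    (hT : T ∈ Ioc (0 : ℝ) 1) (hS : SquareIntegrableRate U T) {G : ℝ → E d → E d}
    (hG : AEStronglyMeasurable (fun p : ℝ × E d => G p.1 p.2) (volume.restrict (slab d T)))
    (hG2 : IntegrableOn (fun p : ℝ × E d => ‖G p.1 p.2‖ ^ 2 * rho U p.1 p.2) (slab d T))
    (hGs : ∀ t ∈ Icc 0 T, SolvesTransportWeakly U t (G t)) : IsWeakVelocity U T G := by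
  refine ⟨hG, hG2, ?_⟩
  filter_upwards [ae_aestronglyMeasurable_slice hG, ae_integrable_slice hG2,
    ae_restrict_mem measurableSet_Icc] with t h2 h3 ht h hh hhc
  have hw := continuous_rho (d := d) hU (Icc_subset_unit hT ht)
  exact (hGs t ht).integral_inner_eq hU hT hS ht h2 h3 (hasWeakGradient_of_contDiff hh)
    (integrable_sq_mul_of_hasCompactSupport hw hh.continuous hhc)
    (integrable_sq_mul_of_hasCompactSupport hw (continuous_gradient hh)
      (hasCompactSupport_gradient hhc))

theorem HasWeakGradient.sub_of_ae_eq {f f' : E d → ℝ} {g g' : E d → E d}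
    (h : HasWeakGradient f g) (h' : HasWeakGradient f' g') (hg : g =ᵐ[volume] g') :
    HasWeakGradient (fun x => f x - f' x) fun _ => 0 := by
  refine ⟨h.1.sub h'.1, locallyIntegrable_const 0, fun η hη => ?_⟩
  have hgc := continuous_gradient hη.contDiff_one
  have hgs := hasCompactSupport_gradient hη.2
  have e : ∫ x, η x • g x = ∫ x, η x • g' x :=
    integral_congr_ae (hg.mono fun x hx => by simp only [hx])
  simp_rw [sub_smul]
  rw [integral_sub (h.1.integrable_smul_right_of_hasCompactSupport hgc hgs)
    (h'.1.integrable_smul_right_of_hasCompactSupport hgc hgs), h.2.2 η hη, h'.2.2 η hη, e]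
  simp

/-- Weakly differentiable functions with the same gradient differ by a constant, in the presence
of a Poincaré inequality. -/
theorem HasWeakGradient.exists_ae_eq_add_const {w : E d → ℝ} (hw : Continuous w)
    (hw0 : ∀ x, 0 < w x) (hwi : Integrable w) (hw1 : ∫ x, w x = 1) {C : ℝ}
    (hC : ∀ η, IsTest η → ∫ x, (η x - ∫ y, η y * w y) ^ 2 * w x
      ≤ C * ∫ x, ‖gradient η x‖ ^ 2 * w x)
    {f f' : E d → ℝ} {g g' : E d → E d} (h : HasWeakGradient f g) (h' : HasWeakGradient f' g')
    (hf : Integrable fun x => ‖f x‖ ^ 2 * w x) (hf' : Integrable fun x => ‖f' x‖ ^ 2 * w x)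
    (hg : g =ᵐ[volume] g') : ∃ c : ℝ, ∀ᵐ x, f x = f' x + c := by
  have hwm : AEStronglyMeasurable w := hw.aestronglyMeasurable
  have hw0' : ∀ᵐ x : E d, 0 ≤ w x := Eventually.of_forall fun x => (hw0 x).le
  have hm := h.1.aestronglyMeasurable
  have hm' := h'.1.aestronglyMeasurable
  have hi := integrable_sub_sq_mul hwm hw0' hm hm' hf hf'
  have hp := poincare_of_hasWeakGradient hw hw0 hwi hw1 hC (h.sub_of_ae_eq h' hg) hi (by simp)
  set c := ∫ y, (f y - f' y) * w y
  have hi2 : Integrable fun x => (f x - f' x - c) ^ 2 * w x := by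
    have := integrable_sub_sq_mul (u := fun x => f x - f' x) (v := fun _ : E d => c) hwm hw0' (hm.sub hm')
      aestronglyMeasurable_const hi (hwi.const_mul _)
    simpa only [Real.norm_eq_abs, sq_abs] using this
  have hnn : ∀ x, 0 ≤ (f x - f' x - c) ^ 2 * w x := fun x => mul_nonneg (sq_nonneg _) (hw0 x).le
  have h0 : ∫ x, (f x - f' x - c) ^ 2 * w x = 0 :=
    le_antisymm (by simpa using hp) (integral_nonneg hnn)
  refine ⟨c, ((integral_eq_zero_iff_of_nonneg hnn hi2).1 h0).mono fun x hx => ?_⟩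
  have := (mul_eq_zero.1 hx).resolve_right (hw0 x).ne'
  have := pow_eq_zero_iff two_ne_zero |>.1 this
  linarith

/-- A vanishing distance means equal gradients at almost every time, and the Poincaré inequality
makes the potentials differ by a constant. Conversely, weak gradients are unique and blind to
constants. -/
theorem FiniteEnergy.setIntegral_sub_sq_eq_zero_iff (hU : IsPotentialPath U)
    (hT : T ∈ Ioc (0 : ℝ) 1) (hgap : SpectralGap U T)
    {φ ψ : ℝ → E d → ℝ} {G H : ℝ → E d → E d}
    (hφ : FiniteEnergy U T φ G) (hψ : FiniteEnergy U T ψ H) :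
    ∫ p in slab d T, ‖H p.1 p.2 - G p.1 p.2‖ ^ 2 * rho U p.1 p.2 = 0
      ↔ ∀ᵐ t ∂volume.restrict (Icc 0 T), ∃ c : ℝ, ∀ᵐ x, ψ t x = φ t x + c := by
  obtain ⟨C, hC⟩ := hgap
  have hi : IntegrableOn (fun p : ℝ × E d => ‖H p.1 p.2 - G p.1 p.2‖ ^ 2 * rho U p.1 p.2)
      (slab d T) :=
    integrable_sub_sq_mul (aestronglyMeasurable_rho (d := d) hU hT) (ae_rho_nonneg hU hT)
      hψ.aesm_gradient hφ.aesm_gradient hψ.gradient_sq hφ.gradient_sq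
  have hnorm : ∀ {u : ℝ → E d → ℝ},
      IntegrableOn (fun p : ℝ × E d => u p.1 p.2 ^ 2 * rho U p.1 p.2) (slab d T) →
      ∀ᵐ t ∂volume.restrict (Icc 0 T), Integrable fun x => ‖u t x‖ ^ 2 * rho U t x := by
    intro u hu
    simpa only [Real.norm_eq_abs, sq_abs] using ae_integrable_slice hu
  constructor
  · intro h0
    filter_upwards [ae_ae_of_ae_slab ((setIntegral_sq_mul_rho_eq_zero_iff hU hT hi).1 h0),
      hφ.weakGradient, hψ.weakGradient, hnorm hφ.sq, hnorm hψ.sq,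
      ae_restrict_mem measurableSet_Icc] with t h1 h2 h3 h4 h5 ht
    have ht1 := Icc_subset_unit hT ht
    exact h3.exists_ae_eq_add_const (continuous_rho hU ht1) (rho_pos hU ht1) (integrable_rho hU ht1)
      (integral_rho hU ht1) (hC t ht) h2 h5 h4 (h1.mono fun x hx => sub_eq_zero.1 hx)
  · intro h
    rw [setIntegral_slab hT.1.le hi, intervalIntegral.integral_of_le hT.1.le,
      ← integral_Icc_eq_integral_Ioc]
    refine integral_eq_zero_of_ae ?_
    filter_upwards [h, hφ.weakGradient, hψ.weakGradient] with t ⟨c, hc⟩ h2 h3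
    refine integral_eq_zero_of_ae ((h3.ae_eq h2 hc).mono fun x hx => ?_)
    simp [hx]

/-- The completed square gives the lower bound. It is approached along the test functions whose
gradients tend to `G`, even if no classical potential attains it. -/
theorem isGLB_actionLoss (hU : IsPotentialPath U) (hT : T ∈ Ioc (0 : ℝ) 1)
    {G : ℝ → E d → E d} (hb : IsWeakVelocity U T G) {η : ℕ → ℝ → E d → ℝ}
    (hη : ∀ n, IsSpaceTimeTest (η n))
    (hlim : Tendsto (fun n => ∫ p in slab d T, ‖gradient (η n p.1) p.2 - G p.1 p.2‖ ^ 2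
      * rho U p.1 p.2) atTop (𝓝 0)) :
    IsGLB (actionLoss U T '' {ζ | Admissible U T ζ})
      (-(1 / 2 * ∫ p in slab d T, ‖G p.1 p.2‖ ^ 2 * rho U p.1 p.2)) := by
  constructor
  · rintro _ ⟨ζ, hζ, rfl⟩
    rw [hb.actionLoss_eq hU hT hζ]
    have : 0 ≤ ∫ p in slab d T, ‖gradient (ζ p.1) p.2 - G p.1 p.2‖ ^ 2 * rho U p.1 p.2 :=
      integral_nonneg_of_ae ((ae_rho_nonneg hU hT).mono fun p hp => mul_nonneg (sq_nonneg _) hp)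
    linarith
  · intro m hm
    have l := (hlim.const_mul (1 / 2)).sub_const
      (1 / 2 * ∫ p in slab d T, ‖G p.1 p.2‖ ^ 2 * rho U p.1 p.2)
    rw [mul_zero, zero_sub] at l
    refine ge_of_tendsto' l fun n => ?_
    have ha := (hη n).admissible hU hT
    rw [← hb.actionLoss_eq hU hT ha]
    exact hm ⟨η n, ha, rfl⟩

end EnergySpace

end ActionMatching

end

/-! ### The main theorem. -/

open ActionMatching in
theorem proposition5 {d : ℕ} (U : ℝ → E d → ℝ) (hU : IsPotentialPath U)
    (T : ℝ) (hT : T ∈ Ioc (0 : ℝ) 1) :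
    -- a classical potential is a minimizer exactly when its gradient solves the equation
    -- at all times of `[0, T]`
    (∀ φ, Admissible U T φ →
      (IsMinimizer U T φ ↔ ∀ t ∈ Icc 0 T, SolvesTransport U t (gradient (φ t)))) ∧
    -- the minimizer is unique up to a constant in space
    (∀ φ, IsMinimizer U T φ → ∀ ψ, Admissible U T ψ →
      (IsMinimizer U T ψ ↔ ∃ c : ℝ → ℝ, ∀ t ∈ Icc 0 T, ∀ x, ψ t x = φ t x + c t)) ∧
    -- existence, uniqueness and the equation in the energy space
    (SpectralGap U T → SquareIntegrableRate U T →
      -- the functional of the energy space extends the action-matching functional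
      (∀ ζ, Admissible U T ζ →
        IntegrableOn (fun p : ℝ × E d => ζ p.1 p.2 ^ 2 * rho U p.1 p.2) (Icc 0 T ×ˢ univ) →
        FiniteEnergy U T ζ (fun t => gradient (ζ t)) ∧
          energyLoss U T ζ (fun t => gradient (ζ t)) = actionLoss U T ζ) ∧
      ∃ φ G, IsEnergyMinimizer U T φ G ∧
        (∀ t ∈ Icc 0 T, HasWeakGradient (φ t) (G t) ∧ SolvesTransportWeakly U t (G t)) ∧
        IsGLB (actionLoss U T '' {ζ | Admissible U T ζ}) (energyLoss U T φ G) ∧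
        ∀ ψ H, FiniteEnergy U T ψ H →
          (IsEnergyMinimizer U T ψ H ↔
            ∀ᵐ t ∂volume.restrict (Icc 0 T), ∃ c : ℝ, ∀ᵐ x, ψ t x = φ t x + c)) := by
  have hT0 := hT.1.le
  refine ⟨fun φ hφ => isMinimizer_iff_solvesTransport hU hT hφ,
    fun φ hφ ψ hψ => hφ.isMinimizer_iff hU hT hψ, fun hgap hS =>
    ⟨fun ζ hζ hζ2 => ⟨hζ.finiteEnergy hT hζ2, hζ.energyLoss_eq hU hT hS hζ2⟩, ?_⟩⟩
  obtain ⟨φ, G, hφ, hsol, η, hη, hlim⟩ := exists_finiteEnergy_solution hU hT hgap hS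
  have hGs : ∀ t ∈ Icc 0 T, SolvesTransportWeakly U t (G t) := fun t ht => (hsol t ht).2
  have hb := isWeakVelocity_of_solvesTransportWeakly hU hT hS hφ.aesm_gradient hφ.gradient_sq hGs
  have hsq : ∀ ψ H, FiniteEnergy U T ψ H → energyLoss U T ψ H
      = 1 / 2 * (∫ p in slab d T, ‖H p.1 p.2 - G p.1 p.2‖ ^ 2 * rho U p.1 p.2)
        - 1 / 2 * ∫ p in slab d T, ‖G p.1 p.2‖ ^ 2 * rho U p.1 p.2 := fun ψ H hψ =>
    hψ.energyLoss_eq hU hT hS hφ.aesm_gradient hφ.gradient_sq hGs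
  have hnn : ∀ H : ℝ → E d → E d,
      0 ≤ ∫ p in slab d T, ‖H p.1 p.2 - G p.1 p.2‖ ^ 2 * rho U p.1 p.2 := fun H =>
    integral_nonneg_of_ae ((ae_rho_nonneg hU hT).mono fun p hp => mul_nonneg (sq_nonneg _) hp)
  have hval : energyLoss U T φ G
      = -(1 / 2 * ∫ p in slab d T, ‖G p.1 p.2‖ ^ 2 * rho U p.1 p.2) := by
    rw [hsq φ G hφ]
    simp
  have hle : ∀ ψ H, FiniteEnergy U T ψ H → energyLoss U T φ G ≤ energyLoss U T ψ H := by
    intro ψ H hψ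
    rw [hval, hsq ψ H hψ]
    linarith [hnn H]
  refine ⟨φ, G, ⟨hφ, hle⟩, hsol, hval ▸ isGLB_actionLoss hU hT hb hη hlim, fun ψ H hψ => ?_⟩
  -- By the completed square the energy of a competitor exceeds the minimum by half its squared
  -- distance to `G`, so minimality means that this distance vanishes.
  rw [← hφ.setIntegral_sub_sq_eq_zero_iff hU hT hgap hψ]
  constructor
  · intro h
    have h1 := h.2 φ G hφ
    rw [hval, hsq ψ H hψ] at h1
    linarith [hnn H]
  · intro h
    refine ⟨hψ, fun ψ' H' h' => le_trans (le_of_eq ?_) (hle ψ' H' h')⟩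
    rw [hval, hsq ψ H hψ, h]
    ring
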